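/- Let $m,r,p,q\ge 1$ be integers, $\sigma>0$, $T>0$, $c>0$. Consider $$y^{(r)}(t)=f\big(d(t),\mathbf T(y,\dot y,\dots,y^{(r-1)})(t),u(t)\big),\qquad y|_{[-\sigma,0]}=y^0\in C^{r-1}([-\sigma,0];\mathbb R^m), \tag{1}$$ under the following assumptions. * $d\in L^\infty(\mathbb R_{\ge0};\mathbb R^p)$. * $f\in C(\mathbb R^p\times\mathbb R^q\times\mathbb R^m;\mathbb R^m)$ has the high-gain property: there is $\rho\in(0,1)$ such that for all nonempty compact $K_p\subset\mathbb R^p$, $K_q\subset\mathbb R^q$ the function $\chi(s)=\min\{\langle v,f(\delta,z,-sv)\rangle : \delta\in K_p,\ z\in K_q,\ \rho\le\|v\|\le1\}$ satisfies $\sup_{s\in\mathbb R}\chi(s)=\infty$. * $\mathbf T:C([-\sigma,\infty);\mathbb R^{rm})\to L^\infty_{\rm loc}(\mathbb R_{\ge0};\mathbb R^q)$ has three properties. (a) For every $c_1>0$ there is $c_2>0$ such that $\sup_{t\ge-\sigma}\|\xi(t)\|\le c_1$ implies $\|\mathbf T(\xi)(t)\|\le c_2$ for a.a. $t\ge0$.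 (b) It is causal: if $\zeta=\xi$ on $[-\sigma,t)$, then $\mathbf T(\zeta)=\mathbf T(\xi)$ a.e. on $[0,t)$. (c) It is locally Lipschitz: for all $t\ge0$ and $\xi\in C([-\sigma,t];\mathbb R^{rm})$ there are $\Delta,\delta,\ell>0$ such that for all $\zeta_1,\zeta_2\in C([-\sigma,\infty);\mathbb R^{rm})$ that agree with $\xi$ on $[-\sigma,t]$ and satisfy $\|\zeta_i(s)-\xi(t)\|<\delta$ for $s\in[t,t+\Delta]$, $i=1,2$, one has $\operatorname{ess\,sup}_{[t,t+\Delta]}\|\mathbf T(\zeta_1)-\mathbf T(\zeta_2)\|\le \ell\sup_{[t,t+\Delta]}\|\zeta_1-\zeta_2\|$. Let $y_{\rm ref}\in W^{r,\infty}([0,T);\mathbb R^m)$ (its $C^{r-1}$ representative), $\varphi(t)=\frac{1}{c(T-t)}$ on $[0,T)$, let $N\in C(\mathbb R_{\ge0};\mathbb R)$ be surjective, and let $\alpha\in C^{r-1}([0,1);[c(r+1),\infty))$ be bijective. With $e=y-y_{\rm ref}$ define recursively for $k=1,\dots,r$ $$e_k=\varphi\,e^{(k-1)}+\varphi\sum_{i=1}^{k-1}\gamma_i^{(k-1-i)},\qquad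 \gamma_k=\alpha(\|e_k\|^2)\,e_k,$$ and apply the feedback $u(t)=N\big(\alpha(\|e_r(t)\|^2)\big)\,e_r(t)$. Assume $\|e_k(0)\|<1$ for $k=1,\dots,r$; these vectors are determined by the derivatives up to order $r-1$ of $y^0$ and $y_{\rm ref}$ at $0$. A solution of the closed loop is a function $y\in C^{r-1}(I;\mathbb R^m)$ with $I=[-\sigma,b]$, $0<b<\infty$, or $I=[-\sigma,b)$, $0<b\le\infty$, such that $y=y^0$ on $[-\sigma,0]$; $t<T$ and $\|e_k(t)\|<1$, $k=1,\dots,r$, for all $t\in I$, $t\ge0$; and $y^{(r-1)}$ is, on $I\cap[0,\infty)$, the integral of the right-hand side of (1), which is integrable on $[0,t]$ for each $t\in I$, $t>0$. Here $\mathbf T(x)$ on $[0,t]$ means $\mathbf T(x_t)$, where $x_t$ is $x=(y,\dots,y^{(r-1)})$ stopped at time $t$. A solution is maximal if it has no proper right extension that is a solution. Then the closed loop has a solution, indeed a maximal one, and every maximal solution $y$ has the following properties. 1. Its interval is exactly $[-\sigma,T)$. 2. $u\in L^\infty([0,T);\mathbb R^m)$ and $y\in W^{r,\infty}([0,T);\mathbb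 R^m)$; moreover $y\in W^{r-1,\infty}([-\sigma,T);\mathbb R^m)$, and $y\in W^{r,\infty}([-\sigma,T);\mathbb R^m)$ whenever $y^0\in W^{r,\infty}([-\sigma,0];\mathbb R^m)$. 3. $\varphi(t)\|e(t)\|<1$ for all $t\in[0,T)$. 4. $\lim_{t\to T}\|e^{(i)}(t)\|=0$ for $i=0,\dots,r-1$. -/

import Mathlib

open MeasureTheory Set Filter Topology
open scoped ContDiff

noncomputable section

/-- `ℝⁿ` with the Euclidean norm. -/
abbrev Vec (n : ℕ) : Type := EuclideanSpace ℝ (Fin n)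

/-- `ℝ^{rm}` with the Euclidean norm, written as `r` blocks of length `m`. -/
abbrev StateVec (r m : ℕ) : Type := PiLp 2 (fun _ : Fin r => Vec m)

section Sobolev

variable {E : Type*} [NormedAddCommGroup E] [NormedSpace ℝ E]

/-- `h` is a weak derivative of `g` on the interval `I`: integration by parts holds against every
smooth `ψ` with compact support in the interior of `I`. -/
def HasWeakDerivOn (I : Set ℝ) (g h : ℝ → E) : Prop :=
  ∀ ψ : ℝ → ℝ, ContDiff ℝ ∞ ψ → HasCompactSupport ψ → tsupport ψ ⊆ interior I →
    ∫ t in I, deriv ψ t • g t = -∫ t in I, ψ t • h t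

/-- `f ∈ W^{k,∞}(I; E)`: `f` is `k` times weakly differentiable on `I`, and `f` and its weak
derivatives up to order `k` are essentially bounded. -/
def MemSobolevInf (k : ℕ) (f : ℝ → E) (I : Set ℝ) : Prop :=
  ∃ g : ℕ → ℝ → E, g 0 = f ∧
    (∀ j ≤ k, MemLp (g j) ⊤ (volume.restrict I)) ∧
    ∀ j < k, HasWeakDerivOn I (g j) (g (j + 1))

end Sobolev

section OperatorClass

variable {X Z : Type*} [NormedAddCommGroup X] [NormedAddCommGroup Z]

/-- The operator class `𝒯_σ` of operators `C([-σ,∞); X) → L^∞_loc([0,∞); Z)`. Elements of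
`C([-σ,∞); X)` are represented by functions on `ℝ` that are continuous on `[-σ,∞)`; by causality
the values off `[-σ,∞)` are irrelevant. -/
structure OperatorClass (σ : ℝ) (Op : (ℝ → X) → ℝ → Z) : Prop where
  /-- the values are measurable and locally essentially bounded on `[0,∞)` -/
  locBdd : ∀ ξ : ℝ → X, ContinuousOn ξ (Ici (-σ)) →
    ∀ b : ℝ, MemLp (Op ξ) ⊤ (volume.restrict (Icc 0 b))
  /-- bounded trajectories are mapped to bounded trajectories -/
  bibo : ∀ c₁ > (0 : ℝ), ∃ c₂ > (0 : ℝ), ∀ ξ : ℝ → X, ContinuousOn ξ (Ici (-σ)) →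
    (∀ t ∈ Ici (-σ), ‖ξ t‖ ≤ c₁) → ∀ᵐ t ∂(volume.restrict (Ici (0 : ℝ))), ‖Op ξ t‖ ≤ c₂
  /-- causality -/
  causal : ∀ t : ℝ, 0 ≤ t → ∀ ζ ξ : ℝ → X,
    ContinuousOn ζ (Ici (-σ)) → ContinuousOn ξ (Ici (-σ)) → EqOn ζ ξ (Ico (-σ) t) →
    ∀ᵐ s ∂(volume.restrict (Ico 0 t)), Op ζ s = Op ξ s
  /-- local Lipschitz continuity -/
  locLip : ∀ t : ℝ, 0 ≤ t → ∀ ξ : ℝ → X, ContinuousOn ξ (Icc (-σ) t) →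
    ∃ Δ > (0 : ℝ), ∃ δ > (0 : ℝ), ∃ c > (0 : ℝ), ∀ ζ₁ ζ₂ : ℝ → X,
      ContinuousOn ζ₁ (Ici (-σ)) → ContinuousOn ζ₂ (Ici (-σ)) →
      EqOn ζ₁ ξ (Icc (-σ) t) → EqOn ζ₂ ξ (Icc (-σ) t) →
      (∀ s ∈ Icc t (t + Δ), ‖ζ₁ s - ξ t‖ < δ) → (∀ s ∈ Icc t (t + Δ), ‖ζ₂ s - ξ t‖ < δ) →
      ∀ᵐ s ∂(volume.restrict (Icc t (t + Δ))),
        ‖Op ζ₁ s - Op ζ₂ s‖ ≤ c * sSup ((fun τ => ‖ζ₁ τ - ζ₂ τ‖) '' Icc t (t + Δ))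

/-- The path that agrees with `x` up to time `τ` and is constant afterwards. -/
def stopAt (x : ℝ → X) (τ : ℝ) : ℝ → X := fun t => x (min t τ)

end OperatorClass

/-- `χ(s)`, the minimum of `⟨v, f(δ, z, -s v)⟩` over `δ ∈ Kp`, `z ∈ Kq`, `ρ ≤ ‖v‖ ≤ 1`
(attained when `f` is continuous and `Kp`, `Kq` are nonempty and compact). -/
def highGainFun {m p q : ℕ} (f : Vec p × Vec q × Vec m → Vec m) (ρ : ℝ)
    (Kp : Set (Vec p)) (Kq : Set (Vec q)) (s : ℝ) : ℝ :=
  sInf {a : ℝ | ∃ δ ∈ Kp, ∃ z ∈ Kq, ∃ v : Vec m, ρ ≤ ‖v‖ ∧ ‖v‖ ≤ 1 ∧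
    a = inner ℝ v (f (δ, z, -(s • v)))}

/-- The high-gain property: for some `ρ ∈ (0,1)` and all nonempty compact `Kp`, `Kq`,
`sup_s χ(s) = ∞`. -/
def HighGain {m p q : ℕ} (f : Vec p × Vec q × Vec m → Vec m) : Prop :=
  ∃ ρ ∈ Ioo (0 : ℝ) 1, ∀ (Kp : Set (Vec p)) (Kq : Set (Vec q)),
    IsCompact Kp → Kp.Nonempty → IsCompact Kq → Kq.Nonempty →
      ¬ BddAbove (range (highGainFun f ρ Kp Kq))

/-- The system class `𝒩^{m,r}` for the system
`y⁽ʳ⁾(t) = f(d(t), Op(y, …, y⁽ʳ⁻¹⁾)(t), u(t))` with memory `σ`. -/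
structure SystemClass {m r p q : ℕ} (σ : ℝ) (d : ℝ → Vec p)
    (f : Vec p × Vec q × Vec m → Vec m) (Op : (ℝ → StateVec r m) → ℝ → Vec q) : Prop where
  memory_pos : 0 < σ
  disturbance : MemLp d ⊤ (volume.restrict (Ici 0))
  continuous : Continuous f
  highGain : HighGain f
  operator : OperatorClass σ Op

/-- The funnel function `φ(t) = 1 / (c (T - t))`. -/
def funnelFun (c T t : ℝ) : ℝ := 1 / c * (1 / (T - t))

/-- The admissible gain `α` and switching function `N`: `N ∈ C([0,∞); ℝ)` is a surjection and
`α ∈ C^{r-1}([0,1); [c(r+1),∞))` is a bijection. -/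
structure ControlDesign (r : ℕ) (c : ℝ) (α N : ℝ → ℝ) : Prop where
  N_cont : ContinuousOn N (Ici 0)
  N_surj : SurjOn N (Ici 0) univ
  α_smooth : ContDiffOn ℝ ((r - 1 : ℕ) : WithTop ℕ∞) α (Ico 0 1)
  α_bij : BijOn α (Ico 0 1) (Ici (c * (r + 1)))

/-- The signals `e_k`, `k ≥ 1`, built from an error signal `e` on the time interval `J`:
`e_k = φ e^{(k-1)} + φ ∑_{i=1}^{k-1} γ_i^{(k-1-i)}` with `γ_i = α(‖e_i‖²) e_i`. All derivatives are
derivatives within `J` (one-sided at an end point of `J`). -/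
def errVar {m : ℕ} (φ α : ℝ → ℝ) (J : Set ℝ) (e : ℝ → Vec m) (k : ℕ) : ℝ → Vec m := fun t =>
  φ t • iteratedDerivWithin (k - 1) e J t +
    φ t • ∑ i : {i : ℕ // i ∈ Finset.Ico 1 k},
      iteratedDerivWithin (k - 1 - i.1)
        (fun s => α (‖errVar φ α J e i.1 s‖ ^ 2) • errVar φ α J e i.1 s) J t
termination_by k
decreasing_by all_goals exact (Finset.mem_Ico.mp i.2).2

/-- The feedback `u(t) = N(α(‖e_r(t)‖²)) e_r(t)`. -/
def feedback {m : ℕ} (r : ℕ) (φ α N : ℝ → ℝ) (J : Set ℝ) (e : ℝ → Vec m) (t : ℝ) : Vec m :=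
  N (α (‖errVar φ α J e r t‖ ^ 2)) • errVar φ α J e r t

/-- The initial condition `‖e_k(0)‖ < 1`, `k = 1, …, r`. The vector `e_k(0)` involves only the
derivatives at time `0` up to order `k - 1 ≤ r - 1`, which `y0` prescribes; it is evaluated along
a `C^{r-1}` continuation `z` of `y0`, and which continuation is taken is immaterial. -/
def InitialCondition {m : ℕ} (r : ℕ) (σ c T : ℝ) (α : ℝ → ℝ) (yref y0 : ℝ → Vec m) : Prop :=
  ∃ z : ℝ → Vec m, ContDiffOn ℝ ((r - 1 : ℕ) : WithTop ℕ∞) z (Ico (-σ) T) ∧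
    EqOn z y0 (Icc (-σ) 0) ∧
    ∀ k, 1 ≤ k → k ≤ r →
      ‖errVar (funnelFun c T) α (Ico 0 T) (fun t => z t - yref t) k 0‖ < 1

/-- Intervals on which solutions live: `[-σ, b]` or `[-σ, b)` with `0 < b < ∞`, or `[-σ, ∞)`. -/
def IsSolutionInterval (σ : ℝ) (I : Set ℝ) : Prop :=
  (∃ b > (0 : ℝ), I = Icc (-σ) b) ∨ (∃ b > (0 : ℝ), I = Ico (-σ) b) ∨ I = Ici (-σ)

/-- The trajectory `x = (y, y', …, y^{(r-1)})` on `I`. -/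
def stateOf {m : ℕ} (r : ℕ) (y : ℝ → Vec m) (I : Set ℝ) (t : ℝ) : StateVec r m :=
  WithLp.toLp 2 (fun k : Fin r => iteratedDerivWithin k.1 y I t)

/-- `y` is a solution on `I` of the closed loop of the system with the funnel controller, with
initial data `y0` on `[-σ,0]`. -/
structure IsClosedLoopSolution {m r p q : ℕ} (σ : ℝ) (d : ℝ → Vec p)
    (f : Vec p × Vec q × Vec m → Vec m) (Op : (ℝ → StateVec r m) → ℝ → Vec q)
    (c T : ℝ) (α N : ℝ → ℝ) (yref y0 : ℝ → Vec m) (I : Set ℝ) (y : ℝ → Vec m) : Prop where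
  interval : IsSolutionInterval σ I
  smooth : ContDiffOn ℝ ((r - 1 : ℕ) : WithTop ℕ∞) y I
  initial : EqOn y y0 (Icc (-σ) 0)
  /-- the solution stays in the domain `t < T`, `‖e_k‖ < 1` of the feedback law -/
  time_lt : ∀ t ∈ I ∩ Ici 0, t < T
  in_domain : ∀ t ∈ I ∩ Ici 0, ∀ k, 1 ≤ k → k ≤ r →
    ‖errVar (funnelFun c T) α (I ∩ Ici 0) (fun s => y s - yref s) k t‖ < 1
  /-- the right-hand side is integrable and `y^{(r-1)}` is its primitive; on `[0,t]` the value of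
  the operator along `x` is that along `x` stopped at time `t` -/
  integrable : ∀ t ∈ I ∩ Ioi 0, IntervalIntegrable
    (fun s => f (d s, Op (stopAt (stateOf r y I) t) s,
      feedback r (funnelFun c T) α N (I ∩ Ici 0) (fun s => y s - yref s) s)) volume 0 t
  equation : ∀ t ∈ I ∩ Ioi 0,
    iteratedDerivWithin (r - 1) y I t = iteratedDerivWithin (r - 1) y I 0 +
      ∫ s in (0 : ℝ)..t, f (d s, Op (stopAt (stateOf r y I) t) s,
        feedback r (funnelFun c T) α N (I ∩ Ici 0) (fun s => y s - yref s) s)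

/-- A maximal solution: a solution without a proper right extension that is also a solution. -/
def IsMaximalClosedLoopSolution {m r p q : ℕ} (σ : ℝ) (d : ℝ → Vec p)
    (f : Vec p × Vec q × Vec m → Vec m) (Op : (ℝ → StateVec r m) → ℝ → Vec q)
    (c T : ℝ) (α N : ℝ → ℝ) (yref y0 : ℝ → Vec m) (I : Set ℝ) (y : ℝ → Vec m) : Prop :=
  IsClosedLoopSolution σ d f Op c T α N yref y0 I y ∧
    ∀ (I' : Set ℝ) (y' : ℝ → Vec m), IsClosedLoopSolution σ d f Op c T α N yref y0 I' y' →
      I ⊆ I' → EqOn y' y I → I' = I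

end

/-! The signals `e_1, …, e_r` depend only on time and on the jet `(e, ė, …, e^{(r-1)})` of the
error. The functions `corrFun` and `errFun` compute them on an open set `errDomain`, where `t < T`
and the norms are below one. In these coordinates the closed loop is a causal first order equation
for `x = (y, …, y^{(r-1)})` on an open domain, so everything rests on bounds that hold uniformly up
to the end `b ≤ T` of a solution.

For `k < r` the identity `φ' = c φ²` gives `ė_k = c φ e_k + e_{k+1} - φ γ_k`. Only `‖e_{k+1}‖ < 1`
is needed, and nothing about `f`: since `α` is unbounded near one and `φ` is bounded below, `‖e_k‖`
stays away from one (`exists_bound_errFun_lt_one`). Moreover `w = φ^{r-k} e_k` satisfies `w' = φ ((c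
(r-k+1) - α) w + φ^{r-k-1} e_{k+1})`, and `α ≥ c (r+1)` makes the coefficient of `w` at most `-c φ`.
Downward induction from `e_r` yields `e_k = O((T-t)^{r-k})` (`exists_bound_weighted_errFun`). Each
further derivative costs one power of `φ`; `WeightedBdd` keeps the account. The outcome is `e^{(k)}
= O((T-t)^{r-k})` for `k < r`, and a bounded derivative for the correction term in `e_r`.

For `e_r = φ g` the derivative of `g` is `f(d, Op x, u)` plus bounded terms. The high-gain property
supplies an `s` for which `χ(s)` exceeds all these bounds and also every value of `χ` at gains from
a given compact range. As `N` is surjective, `s = N(α(κ))` with `κ` beyond that range, hence above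
the initial value of `‖e_r‖²`. Continuity spreads the estimate to a thin shell, which `‖e_r‖²`
cannot cross (`HighGain.shellGain`, `norm_sq_le_of_inner_le`, `TrackData.exists_bound_lastErr`).

Hence the control and the derivative of `x` are bounded, `x` is Lipschitz, and its limit at any `b <
T` lies in the domain, so the solution continues (`TrackData.exists_extension_of_lt`). Local
existence is Tonelli's delay method with Arzelà–Ascoli (`exists_solution_of_causal`); maximal
solutions come from Zorn's lemma, and uniqueness is never used. The Sobolev statements follow by
identifying weak derivatives with integrands of primitives. -/

set_option linter.unusedSectionVars false

/-! ### Iterated one-sided derivatives from chains of derivatives. -/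

section Jets

variable {E : Type*} [NormedAddCommGroup E] [NormedSpace ℝ E]

/-- A chain of derivatives computes the iterated derivatives. -/
theorem iteratedDerivWithin_eqOn_of_chain {s : Set ℝ} (hs : UniqueDiffOn ℝ s) {g : ℕ → ℝ → E}
    {n : ℕ} (h : ∀ k < n, ∀ t ∈ s, HasDerivWithinAt (g k) (g (k + 1) t) s t) :
    ∀ k ≤ n, EqOn (iteratedDerivWithin k (g 0) s) (g k) s := by
  intro k
  induction k with
  | zero => intro _ t _; simp
  | succ k ih =>
    intro hk t ht
    rw [iteratedDerivWithin_succ, derivWithin_congr (ih (by omega)) (ih (by omega) ht)]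
    exact (h k (by omega) t ht).derivWithin (hs t ht)

theorem contDiffOn_of_chain {s : Set ℝ} (hs : UniqueDiffOn ℝ s) {g : ℕ → ℝ → E} {n : ℕ}
    (h : ∀ k < n, ∀ t ∈ s, HasDerivWithinAt (g k) (g (k + 1) t) s t)
    (hc : ContinuousOn (g n) s) : ContDiffOn ℝ (n : WithTop ℕ∞) (g 0) s := by
  have key := iteratedDerivWithin_eqOn_of_chain hs h
  rw [contDiffOn_nat_iff_continuousOn_differentiableOn_deriv hs]
  constructor
  · intro k hk
    refine ContinuousOn.congr ?_ (key k hk)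
    rcases hk.eq_or_lt with rfl | hk
    · exact hc
    · exact fun t ht => (h k hk t ht).continuousWithinAt
  · intro k hk
    refine DifferentiableOn.congr ?_ (key k hk.le)
    exact fun t ht => (h k hk t ht).differentiableWithinAt

theorem ContDiffOn.hasDerivWithinAt_iteratedDerivWithin {s : Set ℝ} (hs : UniqueDiffOn ℝ s)
    {f : ℝ → E} {n : ℕ} (hf : ContDiffOn ℝ (n : WithTop ℕ∞) f s) {k : ℕ} (hk : k < n) {t : ℝ}
    (ht : t ∈ s) :
    HasDerivWithinAt (iteratedDerivWithin k f s) (iteratedDerivWithin (k + 1) f s t) s t := by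
  have := (hf.differentiableOn_iteratedDerivWithin (m := k) (by exact_mod_cast hk) hs) t ht
  rw [iteratedDerivWithin_succ]
  exact this.hasDerivWithinAt

/-- The derivatives within `u`, restricted to `s`, form a chain within `s`. This makes one-sided
jets at an end point of `s`, such as time `0`, comparable with those of a larger interval. -/
theorem iteratedDerivWithin_eqOn_subset {s u : Set ℝ} (hs : UniqueDiffOn ℝ s)
    (hu : UniqueDiffOn ℝ u) (hsu : s ⊆ u) {f : ℝ → E} {n : ℕ}
    (hf : ContDiffOn ℝ (n : WithTop ℕ∞) f u) {k : ℕ} (hk : k ≤ n) :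
    EqOn (iteratedDerivWithin k f s) (iteratedDerivWithin k f u) s := by
  have := iteratedDerivWithin_eqOn_of_chain hs (g := fun k => iteratedDerivWithin k f u) (n := n)
    (fun k hk t ht => (hf.hasDerivWithinAt_iteratedDerivWithin hu hk (hsu ht)).mono hsu) k hk
  simpa using this

end Jets

/-! ### Barrier principles for continuous functions. -/

section Barrier

/-- A continuous function which cannot increase while its values lie in `[K, K']` stays
below `K` if it starts there. -/
theorem le_of_no_increase_in_band {a b K K' : ℝ} (hK : K < K') {V : ℝ → ℝ}
    (hV : ContinuousOn V (Ico a b)) (h0 : V a ≤ K)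
    (h : ∀ s t, a ≤ s → s < t → t < b → (∀ τ ∈ Icc s t, K ≤ V τ ∧ V τ ≤ K') → V t ≤ V s) :
    ∀ t ∈ Ico a b, V t ≤ K := by
  intro t₁ ht₁
  by_contra! hlt
  have hsub : Icc a t₁ ⊆ Ico a b := fun τ hτ => ⟨hτ.1, hτ.2.trans_lt ht₁.2⟩
  have hVc : ContinuousOn V (Icc a t₁) := hV.mono hsub
  -- the last time at which `V ≤ K`
  have hcl : IsClosed {τ ∈ Icc a t₁ | V τ ≤ K} := hVc.preimage_isClosed_of_isClosed isClosed_Icc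
    isClosed_Iic
  have hcomp : IsCompact {τ ∈ Icc a t₁ | V τ ≤ K} :=
    isCompact_Icc.of_isClosed_subset hcl (fun τ hτ => hτ.1)
  obtain ⟨s, hs, hsmax⟩ := hcomp.exists_isGreatest ⟨a, ⟨le_rfl, ht₁.1⟩, h0⟩
  have hst : s < t₁ := by
    rcases hs.1.2.eq_or_lt with h | h
    · exact absurd hs.2 (by rw [h]; exact not_le.2 hlt)
    · exact h
  have hgt : ∀ τ ∈ Ioc s t₁, K < V τ := by
    intro τ hτ
    by_contra! hle
    exact absurd (hsmax ⟨⟨hs.1.1.trans hτ.1.le, hτ.2⟩, hle⟩) (not_le.2 hτ.1)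
  -- a time shortly after `s`
  have hcs : ContinuousWithinAt V (Icc a t₁) s := hVc s hs.1
  have hev : ∀ᶠ τ in 𝓝[Icc a t₁] s, V τ < K' := hcs.eventually_lt_const (hs.2.trans_lt hK)
  rw [eventually_nhdsWithin_iff, Metric.eventually_nhds_iff] at hev
  obtain ⟨ε, hε, hev⟩ := hev
  obtain ⟨t, hst', ht⟩ : ∃ t, s < t ∧ t ≤ min t₁ (s + ε / 2) :=
    ⟨min t₁ (s + ε / 2), by simp [hst, hε], le_rfl⟩
  have ht1 : t ≤ t₁ := ht.trans (min_le_left _ _)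
  have ht2 : t ≤ s + ε / 2 := ht.trans (min_le_right _ _)
  -- The band hypothesis is needed on the closed interval, so `s` itself must be included: `K ≤ V s`
  -- is the limit of `K < V τ` from the right.
  have hKs : K ≤ V s := by
    have hcs' : ContinuousWithinAt V (Ioc s t₁) s :=
      hcs.mono (fun τ hτ => ⟨hs.1.1.trans hτ.1.le, hτ.2⟩)
    have : (𝓝[Ioc s t₁] s).NeBot := by
      rw [← mem_closure_iff_nhdsWithin_neBot, closure_Ioc hst.ne]
      exact ⟨le_rfl, hst.le⟩
    exact ge_of_tendsto hcs' (eventually_nhdsWithin_of_forall fun τ hτ => (hgt τ hτ).le)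
  have := h s t hs.1.1 hst' (ht1.trans_lt ht₁.2) (by
    intro τ hτ
    constructor
    · rcases hτ.1.eq_or_lt with h | h
      · exact h ▸ hKs
      · exact (hgt τ ⟨h, hτ.2.trans ht1⟩).le
    · refine (hev (y := τ) ?_ ⟨hs.1.1.trans hτ.1, hτ.2.trans ht1⟩).le
      rw [Real.dist_eq, abs_of_nonneg (by linarith [hτ.1])]
      linarith [hτ.2])
  linarith [hgt t ⟨hst', ht1⟩, hs.2]

/-- Barrier principle for differentiable functions. -/
theorem le_of_deriv_nonpos_above {a b K : ℝ} {V V' : ℝ → ℝ}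
    (hV : ∀ t ∈ Ico a b, HasDerivWithinAt V (V' t) (Ico a b) t) (h0 : V a ≤ K)
    (h : ∀ t ∈ Ico a b, K ≤ V t → V' t ≤ 0) : ∀ t ∈ Ico a b, V t ≤ K := by
  refine le_of_no_increase_in_band (lt_add_one K) (fun t ht => (hV t ht).continuousWithinAt) h0 ?_
  intro s t has hst htb hband
  have hsub : Icc s t ⊆ Ico a b := fun τ hτ => ⟨has.trans hτ.1, hτ.2.trans_lt htb⟩
  refine antitoneOn_of_hasDerivWithinAt_nonpos (D := Icc s t) (f' := V') (convex_Icc s t)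
    (fun τ hτ => ((hV τ (hsub hτ)).mono hsub).continuousWithinAt) ?_ ?_ ⟨le_rfl, hst.le⟩
    ⟨hst.le, le_rfl⟩ hst.le
  · intro τ hτ
    exact (hV τ (hsub (interior_subset hτ))).mono (interior_subset.trans hsub)
  · intro τ hτ
    exact h τ (hsub (interior_subset hτ)) (hband τ (interior_subset hτ)).1

end Barrier

/-! ### Absolutely continuous functions with values in a normed space. -/

section AbsolutelyContinuous

variable {E : Type*} [NormedAddCommGroup E] [NormedSpace ℝ E]

/-- Sums of increments of `f` are dominated by those of `g`. This transfers absolute continuity from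
scalar primitives to vector-valued ones, and from a curve to its squared norm. -/
theorem AbsolutelyContinuousOnInterval.of_dist_le {X Y : Type*} [PseudoMetricSpace X]
    [PseudoMetricSpace Y] {f : ℝ → X} {g : ℝ → Y} {a b C : ℝ}
    (hg : AbsolutelyContinuousOnInterval g a b)
    (h : ∀ s ∈ uIcc a b, ∀ t ∈ uIcc a b, dist (f s) (f t) ≤ C * dist (g s) (g t)) :
    AbsolutelyContinuousOnInterval f a b := by
  rw [absolutelyContinuousOnInterval_iff] at hg ⊢
  intro ε hε
  -- The divisor `|C| + 1` is positive without any sign condition on `C`.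
  obtain ⟨δ, hδ, H⟩ := hg (ε / (|C| + 1)) (by positivity)
  refine ⟨δ, hδ, fun I hI hlen => ?_⟩
  have := H I hI hlen
  calc ∑ i ∈ Finset.range I.1, dist (f (I.2 i).1) (f (I.2 i).2)
      ≤ ∑ i ∈ Finset.range I.1, (|C| + 1) * dist (g (I.2 i).1) (g (I.2 i).2) := by
        refine Finset.sum_le_sum fun i hi => ?_
        have hm := hI.1 i hi
        refine (h _ hm.1 _ hm.2).trans ?_
        gcongr
        linarith [le_abs_self C]
    _ = (|C| + 1) * ∑ i ∈ Finset.range I.1, dist (g (I.2 i).1) (g (I.2 i).2) := by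
        rw [Finset.mul_sum]
    _ < (|C| + 1) * (ε / (|C| + 1)) := by gcongr
    _ = ε := by field_simp

/-- The increments are dominated by those of the scalar primitive of `‖h‖`. -/
theorem IntervalIntegrable.absolutelyContinuousOnInterval_primitive {h : ℝ → E} {a b : ℝ}
    (hh : IntervalIntegrable h volume a b) :
    AbsolutelyContinuousOnInterval (fun x => ∫ v in a..x, h v) a b := by
  have hn := hh.norm.absolutelyContinuousOnInterval_intervalIntegral (c := a) left_mem_uIcc
  refine hn.of_dist_le (C := 1) fun s hs t ht => ?_
  have has : IntervalIntegrable h volume a s := hh.mono_set (uIcc_subset_uIcc left_mem_uIcc hs)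
  have hat : IntervalIntegrable h volume a t := hh.mono_set (uIcc_subset_uIcc left_mem_uIcc ht)
  rw [one_mul, dist_eq_norm, dist_eq_norm, intervalIntegral.integral_interval_sub_left has hat,
    intervalIntegral.integral_interval_sub_left has.norm hat.norm]
  rw [Real.norm_eq_abs]
  exact intervalIntegral.norm_integral_le_abs_integral_norm

/-- The fundamental theorem of calculus for absolutely continuous functions with values in a
normed space, for an a.e. derivative that is known to be integrable. -/
theorem AbsolutelyContinuousOnInterval.sub_eq_integral [CompleteSpace E] {f f' : ℝ → E} {a b : ℝ}
    (hf : AbsolutelyContinuousOnInterval f a b)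
    (hd : ∀ᵐ x, x ∈ uIcc a b → HasDerivAt f (f' x) x)
    (hi : IntervalIntegrable f' volume a b) : f b - f a = ∫ x in a..b, f' x := by
  have hg : AbsolutelyContinuousOnInterval (fun x => f x - ∫ v in a..x, f' v) a b :=
    hf.sub hi.absolutelyContinuousOnInterval_primitive
  obtain ⟨C, hC⟩ := hg.const_of_ae_hasDerivAt_zero (by
    filter_upwards [hd, hi.ae_hasDerivAt_integral] with x h₁ h₂ hx
    have := (h₁ hx).sub (h₂ hx a left_mem_uIcc)
    rw [sub_self] at this
    exact this)
  have h1 := hC a left_mem_uIcc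
  have h2 := hC b right_mem_uIcc
  simp only [intervalIntegral.integral_same, sub_zero] at h1 h2
  rw [h1, ← h2]; abel

end AbsolutelyContinuous

/-! ### Weak derivatives, primitives and the du Bois-Reymond lemma. -/

section WeakDerivative

variable {E : Type*} [NormedAddCommGroup E] [NormedSpace ℝ E]

theorem IsCompact.exists_Ioo_between {K : Set ℝ} (hK : IsCompact K) {a b : ℝ} (hab : a < b)
    (hKs : K ⊆ Ioo a b) : ∃ s t, a < s ∧ s < t ∧ t < b ∧ K ⊆ Ioo s t := by
  -- Adding the midpoint makes the set nonempty, so that an empty `K` needs no separate case.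
  have hc : IsCompact (insert ((a + b) / 2) K) := hK.insert _
  have hsub : insert ((a + b) / 2) K ⊆ Ioo a b :=
    insert_subset ⟨by linarith, by linarith⟩ hKs
  obtain ⟨u, hu, hul⟩ := hc.exists_isLeast (insert_nonempty _ _)
  obtain ⟨v, hv, hvl⟩ := hc.exists_isGreatest (insert_nonempty _ _)
  have h1 := hsub hu
  have h2 := hsub hv
  have huv := hul hv
  refine ⟨(a + u) / 2, (v + b) / 2, by linarith [h1.1], by linarith [h1.1, h2.2],
    by linarith [h2.2], fun x hx => ⟨?_, ?_⟩⟩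
  · linarith [hul (mem_insert_of_mem _ hx), h1.1]
  · linarith [hvl (mem_insert_of_mem _ hx), h2.2]

theorem setIntegral_eq_intervalIntegral_of_support {F : ℝ → E} {I : Set ℝ} {a b s t : ℝ}
    (hI : I =ᵐ[volume] Ioo a b) (has : a < s) (hst : s ≤ t) (htb : t < b)
    (hF : ∀ x, x ∉ Ioo s t → F x = 0) : ∫ x in I, F x = ∫ x in s..t, F x := by
  rw [setIntegral_congr_set hI, intervalIntegral.integral_of_le hst]
  refine (setIntegral_eq_of_subset_of_forall_sdiff_eq_zero measurableSet_Ioo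
    (fun x hx => ⟨has.trans hx.1, hx.2.trans_lt htb⟩) ?_)
  intro x hx
  exact hF x fun hx' => hx.2 ⟨hx'.1, hx'.2.le⟩

variable [CompleteSpace E]

/-- Integration by parts against a smooth function vanishing at the end points. -/
theorem intervalIntegral_deriv_smul_eq_neg {s t : ℝ} (hst : s ≤ t) {g h : ℝ → E} {ψ : ℝ → ℝ}
    (hψ : ContDiff ℝ ∞ ψ) (hs : ψ s = 0) (ht : ψ t = 0) (hh : IntervalIntegrable h volume s t)
    (hg : ∀ x ∈ Icc s t, g x = g s + ∫ v in s..x, h v) :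
    ∫ x in s..t, deriv ψ x • g x = -∫ x in s..t, ψ x • h x := by
  set G : ℝ → E := fun x => g s + ∫ v in s..x, h v with hG
  have hGac : AbsolutelyContinuousOnInterval G s t :=
    hh.absolutelyContinuousOnInterval_primitive.of_dist_le (C := 1) (by simp [hG])
  have hψac : AbsolutelyContinuousOnInterval ψ s t :=
    (hψ.of_le (by simp : (1 : WithTop ℕ∞) ≤ ∞)).contDiffOn.absolutelyContinuousOnInterval
  have hψ' : Continuous (deriv ψ) := hψ.continuous_deriv (by simp)
  have hint1 : IntervalIntegrable (fun x => ψ x • h x) volume s t :=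
    hh.continuousOn_smul hψ.continuous.continuousOn
  have hint2 : IntervalIntegrable (fun x => deriv ψ x • G x) volume s t :=
    (hψ'.continuousOn.smul hGac.continuousOn).intervalIntegrable
  have key := (hψac.smul hGac).sub_eq_integral
    (f' := fun x => ψ x • h x + deriv ψ x • G x) (by
      filter_upwards [hh.ae_hasDerivAt_integral] with x hx hxm
      exact (hψ.differentiable (by simp) x).hasDerivAt.smul
        ((hx hxm s left_mem_uIcc).const_add (g s))) (hint1.add hint2)
  rw [intervalIntegral.integral_add hint1 hint2] at key
  simp only [Pi.smul_apply', hs, ht, zero_smul, sub_self] at key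
  have hcong : ∫ x in s..t, deriv ψ x • g x = ∫ x in s..t, deriv ψ x • G x := by
    refine intervalIntegral.integral_congr fun x hx => ?_
    rw [uIcc_of_le hst] at hx
    simp only [hG, ← hg x hx]
  rw [hcong, eq_neg_iff_add_eq_zero, add_comm]
  exact key.symm

/-- A primitive has its integrand as weak derivative. -/
theorem hasWeakDerivOn_of_primitive {I : Set ℝ} {a b : ℝ} (hab : a < b)
    (hI : I =ᵐ[volume] Ioo a b) (hI' : interior I = Ioo a b) {g h : ℝ → E}
    (hprim : ∀ s ∈ Ioo a b, ∀ t ∈ Ioo a b, s ≤ t →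
      IntervalIntegrable h volume s t ∧ g t = g s + ∫ x in s..t, h x) :
    HasWeakDerivOn I g h := by
  intro ψ hψ hψc hψs
  rw [hI'] at hψs
  obtain ⟨s, t, has, hst, htb, hsub⟩ := hψc.isCompact.exists_Ioo_between hab hψs
  have hz : ∀ x, x ∉ Ioo s t → ψ x = 0 := fun x hx =>
    image_eq_zero_of_notMem_tsupport fun h => hx (hsub h)
  have hz' : ∀ x, x ∉ Ioo s t → deriv ψ x = 0 := fun x hx => by
    by_contra hne
    exact hx (hsub (support_deriv_subset hne))
  rw [setIntegral_eq_intervalIntegral_of_support hI has hst.le htb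
      (fun x hx => by rw [hz' x hx, zero_smul]),
    setIntegral_eq_intervalIntegral_of_support hI has hst.le htb
      (fun x hx => by rw [hz x hx, zero_smul])]
  have hs : s ∈ Ioo a b := ⟨has, hst.trans htb⟩
  have ht : t ∈ Ioo a b := ⟨has.trans hst, htb⟩
  refine intervalIntegral_deriv_smul_eq_neg hst.le hψ (hz s (by simp)) (hz t (by simp))
    (hprim s hs t ht hst.le).1 fun x hx => ?_
  exact (hprim s hs x ⟨has.trans_le hx.1, hx.2.trans_lt htb⟩ hx.1).2

/-- A continuous function with vanishing weak derivative is constant. -/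
theorem exists_const_of_weakDeriv_zero {a b : ℝ} (hab : a < b) {k : ℝ → E}
    (hk : ContinuousOn k (Ioo a b))
    (h : ∀ ψ : ℝ → ℝ, ContDiff ℝ ∞ ψ → HasCompactSupport ψ → tsupport ψ ⊆ Ioo a b →
      ∫ t in Ioo a b, deriv ψ t • k t = 0) : ∃ C, ∀ t ∈ Ioo a b, k t = C := by
  -- a normalised bump function
  obtain ⟨θ, hθs, hθc, hθ, hθ0⟩ : ∃ θ : ℝ → ℝ, tsupport θ ⊆ Ioo a b ∧ HasCompactSupport θ ∧
      ContDiff ℝ ∞ θ ∧ ∫ t in Ioo a b, θ t = 1 := by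
    set c := (a + b) / 2
    set f : ContDiffBump c := ⟨(b - a) / 8, (b - a) / 4, by linarith, by linarith⟩
    have hsub : tsupport (f.normed volume) ⊆ Ioo a b := by
      rw [f.tsupport_normed_eq, Real.closedBall_eq_Icc]
      intro x hx
      simp only [f, c, mem_Icc, mem_Ioo] at hx ⊢
      constructor <;> linarith
    refine ⟨f.normed volume, hsub, f.hasCompactSupport_normed, f.contDiff_normed, ?_⟩
    rw [setIntegral_eq_integral_of_forall_compl_eq_zero]
    · exact f.integral_normed
    · intro x hx
      exact image_eq_zero_of_notMem_tsupport fun h => hx (hsub h)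
  set C := ∫ t in Ioo a b, θ t • k t with hC
  have hint : ∀ ψ : ℝ → ℝ, ContDiff ℝ ∞ ψ → HasCompactSupport ψ → tsupport ψ ⊆ Ioo a b →
      IntegrableOn (fun t => ψ t • k t) (Ioo a b) := by
    intro ψ hψ hψc hψs
    have h1 : IntegrableOn (fun t => ψ t • k t) (tsupport ψ) :=
      ((hψ.continuous.continuousOn).smul (hk.mono hψs)).integrableOn_compact hψc.isCompact
    have : Integrable (fun t => ψ t • k t) := by
      rw [← integrableOn_iff_integrable_of_support_subset (s := tsupport ψ)]
      · exact h1
      · intro x hx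
        by_contra hx'
        exact hx (by simp [image_eq_zero_of_notMem_tsupport hx'])
    exact this.integrableOn
  refine ⟨C, ?_⟩
  have hae : ∀ᵐ t, t ∈ Ioo a b → k t - C = 0 := by
    refine isOpen_Ioo.ae_eq_zero_of_integral_contDiff_smul_eq_zero
      ((hk.sub continuousOn_const).locallyIntegrableOn measurableSet_Ioo) ?_
    intro ψ hψ hψc hψs
    set c₀ := ∫ t in Ioo a b, ψ t with hc₀
    -- Subtracting the multiple of the bump with the same integral leaves mean zero. The primitive
    -- `W` of `w` then has compact support and is an admissible test function with `W' = w`.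
    set w : ℝ → ℝ := fun t => ψ t - c₀ * θ t with hw
    have hwd : ContDiff ℝ ∞ w := hψ.sub (contDiff_const.mul hθ)
    obtain ⟨s, t, has, hst, htb, hsub⟩ :=
      (hψc.isCompact.union hθc.isCompact).exists_Ioo_between hab (union_subset hψs hθs)
    have hwz : ∀ x, x ∉ Ioo s t → w x = 0 := fun x hx => by
      have h1 := image_eq_zero_of_notMem_tsupport fun h => hx (hsub (Or.inl h))
      have h2 := image_eq_zero_of_notMem_tsupport fun h => hx (hsub (Or.inr h))
      simp [hw, h1, h2]
    have hwi : ∫ x in s..t, w x = 0 := by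
      rw [← setIntegral_eq_intervalIntegral_of_support (I := Ioo a b) (ae_eq_refl _) has hst.le htb
        hwz]
      simp only [hw]
      rw [integral_sub, integral_const_mul, hθ0, mul_one, ← hc₀, sub_self]
      · exact (hψ.continuous.integrable_of_hasCompactSupport hψc).integrableOn
      · exact ((hθ.continuous.integrable_of_hasCompactSupport hθc).const_mul _).integrableOn
    set W : ℝ → ℝ := fun x => ∫ v in s..x, w v with hW
    have hWd : ∀ x, HasDerivAt W (w x) x := fun x =>
      intervalIntegral.integral_hasDerivAt_right (hwd.continuous.intervalIntegrable _ _)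
        hwd.continuous.stronglyMeasurable.stronglyMeasurableAtFilter hwd.continuous.continuousAt
    have hWderiv : deriv W = w := funext fun x => (hWd x).deriv
    have hWs : ContDiff ℝ ∞ W := by
      rw [contDiff_infty_iff_deriv, hWderiv]
      exact ⟨fun x => (hWd x).differentiableAt, hwd⟩
    have hWz : ∀ x, x ∉ Icc s t → W x = 0 := by
      intro x hx
      rcases lt_or_ge x s with hxs | hxs
      · simp only [hW]
        rw [intervalIntegral.integral_congr (g := fun _ => (0 : ℝ))]
        · simp
        · intro y hy
          rw [uIcc_of_ge hxs.le] at hy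
          exact hwz y fun h => absurd h.1 (not_lt.2 hy.2)
      · have hxt : t < x := by
          by_contra! hle
          exact hx ⟨hxs, hle⟩
        simp only [hW]
        rw [← intervalIntegral.integral_add_adjacent_intervals (b := t)
          (hwd.continuous.intervalIntegrable _ _) (hwd.continuous.intervalIntegrable _ _), hwi,
          intervalIntegral.integral_congr (a := t) (b := x) (g := fun _ => (0 : ℝ))]
        · simp
        · intro y hy
          rw [uIcc_of_le hxt.le] at hy
          exact hwz y fun h => absurd h.2 (not_lt.2 hy.1)
    have hsupp : tsupport W ⊆ Icc s t :=
      closure_minimal (fun x hx => by by_contra h'; exact hx (hWz x h')) isClosed_Icc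
    have hWc : HasCompactSupport W := isCompact_Icc.of_isClosed_subset (isClosed_tsupport _) hsupp
    have h0 := h W hWs hWc (hsupp.trans fun x hx => ⟨has.trans_le hx.1, hx.2.trans_lt htb⟩)
    rw [hWderiv] at h0
    have hi1 := hint ψ hψ hψc hψs
    have hi2 := hint θ hθ hθc hθs
    have h0' : ∫ t in Ioo a b, (ψ t • k t - c₀ • (θ t • k t)) = 0 := by
      rw [← h0]
      refine integral_congr_ae (Eventually.of_forall fun x => ?_)
      simp only [hw, sub_smul, mul_smul]
    rw [integral_sub hi1 (show IntegrableOn (fun t => c₀ • (θ t • k t)) _ _ from hi2.smul c₀),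
      integral_smul, ← hC, sub_eq_zero] at h0'
    have hgoal : ∫ x, ψ x • (k x - C) = ∫ x in Ioo a b, (ψ x • k x - ψ x • C) := by
      rw [← setIntegral_eq_integral_of_forall_compl_eq_zero (s := Ioo a b)]
      · simp only [smul_sub]
      · intro x hx
        rw [image_eq_zero_of_notMem_tsupport fun h => hx (hψs h), zero_smul]
    rw [hgoal, integral_sub hi1, h0', integral_smul_const, sub_self]
    exact ((hψ.continuous.integrable_of_hasCompactSupport hψc).smul_const C).integrableOn
  have hae' : k =ᵐ[volume.restrict (Ioo a b)] fun _ => C := by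
    rw [EventuallyEq, ae_restrict_iff' measurableSet_Ioo]
    filter_upwards [hae] with t ht htm
    exact sub_eq_zero.1 (ht htm)
  exact Measure.eqOn_open_of_ae_eq hae' isOpen_Ioo hk continuousOn_const

end WeakDerivative

/-! ### Sobolev functions on intervals and their continuous representatives. -/

section SobolevIntervals

variable {E : Type*} [NormedAddCommGroup E] [NormedSpace ℝ E]

theorem ae_eq_Ioo_of_interval {I : Set ℝ} {a b : ℝ} (hI : I = Icc a b ∨ I = Ico a b) :
    I =ᵐ[volume] Ioo a b := by
  rcases hI with rfl | rfl
  · exact Ioo_ae_eq_Icc.symm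
  · exact Ioo_ae_eq_Ico.symm

theorem interior_of_interval {I : Set ℝ} {a b : ℝ} (hI : I = Icc a b ∨ I = Ico a b) :
    interior I = Ioo a b := by
  rcases hI with rfl | rfl
  · exact interior_Icc
  · exact interior_Ico

theorem Ioo_subset_of_interval {I : Set ℝ} {a b : ℝ} (hI : I = Icc a b ∨ I = Ico a b) :
    Ioo a b ⊆ I := by
  rcases hI with rfl | rfl
  · exact Ioo_subset_Icc_self
  · exact Ioo_subset_Ico_self

theorem subset_Icc_of_interval {I : Set ℝ} {a b : ℝ} (hI : I = Icc a b ∨ I = Ico a b) :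
    I ⊆ Icc a b := by
  rcases hI with rfl | rfl
  · exact le_rfl
  · exact Ico_subset_Icc_self

theorem uniqueDiffOn_of_interval {I : Set ℝ} {a b : ℝ} (hab : a < b)
    (hI : I = Icc a b ∨ I = Ico a b) : UniqueDiffOn ℝ I := by
  rcases hI with rfl | rfl
  · exact uniqueDiffOn_Icc hab
  · exact uniqueDiffOn_Ico a b

theorem Icc_subset_of_interval {I : Set ℝ} {a b s t : ℝ} (hI : I = Icc a b ∨ I = Ico a b)
    (hs : s ∈ I) (ht : t ∈ I) : Icc s t ⊆ I := by
  rcases hI with rfl | rfl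
  · exact ordConnected_Icc.out hs ht
  · exact ordConnected_Ico.out hs ht

theorem intervalIntegrable_of_memLp_top {I : Set ℝ} {a b : ℝ} (hab : a ≤ b)
    (hI : I = Icc a b ∨ I = Ico a b) {h : ℝ → E} (hh : MemLp h ⊤ (volume.restrict I)) :
    IntervalIntegrable h volume a b := by
  rw [Measure.restrict_congr_set (ae_eq_Ioo_of_interval hI)] at hh
  rw [intervalIntegrable_iff_integrableOn_Ioo_of_le hab]
  exact hh.integrable le_top

/-- A bound that holds a.e. on an interval holds everywhere for a continuous function. -/
theorem norm_le_of_ae_of_continuousOn {I : Set ℝ} {a b C : ℝ} (hab : a < b)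
    (hI : I = Icc a b ∨ I = Ico a b) {f : ℝ → E} (hf : ContinuousOn f I)
    (h : ∀ᵐ t ∂(volume.restrict I), ‖f t‖ ≤ C) : ∀ t ∈ I, ‖f t‖ ≤ C := by
  rw [Measure.restrict_congr_set (ae_eq_Ioo_of_interval hI)] at h
  have hf' : ContinuousOn (fun t => max ‖f t‖ C) I := by fun_prop
  have h1 : (fun t => max ‖f t‖ C) =ᵐ[volume.restrict (Ioo a b)] fun _ => C := by
    filter_upwards [h] with t ht
    exact max_eq_right ht
  have h2 := Measure.eqOn_open_of_ae_eq h1 isOpen_Ioo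
    (hf'.mono (Ioo_subset_of_interval hI)) continuousOn_const
  have h3 : EqOn (fun t => max ‖f t‖ C) (fun _ => C) I := by
    refine h2.of_subset_closure hf' continuousOn_const (Ioo_subset_of_interval hI) ?_
    rw [closure_Ioo hab.ne]
    exact subset_Icc_of_interval hI
  intro t ht
  exact max_eq_right_iff.1 (h3 ht)

theorem primitive_of_hasDerivWithinAt [CompleteSpace E] {g g' : ℝ → E} {s t : ℝ} (hst : s ≤ t)
    (hg : ∀ x ∈ Icc s t, HasDerivWithinAt g (g' x) (Icc s t) x) (hg' : ContinuousOn g' (Icc s t)) :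
    IntervalIntegrable g' volume s t ∧ g t = g s + ∫ x in s..t, g' x := by
  have hi : IntervalIntegrable g' volume s t :=
    ContinuousOn.intervalIntegrable (by rwa [uIcc_of_le hst])
  refine ⟨hi, ?_⟩
  rw [intervalIntegral.integral_eq_sub_of_hasDerivAt_of_le hst
    (fun x hx => (hg x hx).continuousWithinAt)
    (fun x hx => (hg x ⟨hx.1.le, hx.2.le⟩).hasDerivAt (Icc_mem_nhds hx.1 hx.2)) hi]
  abel

variable [CompleteSpace E]

/-- The primitive `H` of `h` has the same weak derivative as `g`, so `g - H` is constant on the open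
interval, and by continuity also at the end points that belong to `I`. -/
theorem primitive_of_hasWeakDerivOn {I : Set ℝ} {a b : ℝ} (hab : a < b)
    (hI : I = Icc a b ∨ I = Ico a b) {g h : ℝ → E} (hg : ContinuousOn g I)
    (hh : IntervalIntegrable h volume a b) (hw : HasWeakDerivOn I g h) :
    ∀ s ∈ I, ∀ t ∈ I, g t = g s + ∫ x in s..t, h x := by
  have hIae := ae_eq_Ioo_of_interval hI
  have hIcc := subset_Icc_of_interval hI
  have hint : ∀ s ∈ Icc a b, ∀ t ∈ Icc a b, IntervalIntegrable h volume s t := fun s hs t ht =>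
    hh.mono_set (by
      rw [uIcc_of_le hab.le]
      exact uIcc_subset_Icc hs ht)
  set H : ℝ → E := fun t => ∫ x in a..t, h x with hH
  have haI : a ∈ Icc a b := left_mem_Icc.2 hab.le
  have hHprim : ∀ s ∈ Icc a b, ∀ t ∈ Icc a b, H t = H s + ∫ x in s..t, h x := fun s hs t ht =>
    (intervalIntegral.integral_add_adjacent_intervals (hint a haI s hs) (hint s hs t ht)).symm
  have hHw : HasWeakDerivOn I H h :=
    hasWeakDerivOn_of_primitive hab hIae (interior_of_interval hI) fun s hs t ht hst =>
      ⟨hint s (Ioo_subset_Icc_self hs) t (Ioo_subset_Icc_self ht),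
        hHprim s (Ioo_subset_Icc_self hs) t (Ioo_subset_Icc_self ht)⟩
  have hHc : ContinuousOn H (Icc a b) := by
    have := hh.absolutelyContinuousOnInterval_primitive.continuousOn
    rwa [uIcc_of_le hab.le] at this
  have hk : ContinuousOn (fun t => g t - H t) I := hg.sub (hHc.mono hIcc)
  obtain ⟨C, hC⟩ := exists_const_of_weakDeriv_zero hab
    (hk.mono (Ioo_subset_of_interval hI)) (by
    intro ψ hψ hψc hψs
    have hs' : tsupport ψ ⊆ interior I := by rwa [interior_of_interval hI]
    have h1 := hw ψ hψ hψc hs'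
    have h2 := hHw ψ hψ hψc hs'
    obtain ⟨s, t, has, hst, htb, hsub⟩ := hψc.isCompact.exists_Ioo_between hab hψs
    have hz' : ∀ x, x ∉ Ioo s t → deriv ψ x = 0 := fun x hx => by
      by_contra hne
      exact hx (hsub (support_deriv_subset hne))
    have hsubI : Icc s t ⊆ I :=
      Icc_subset_of_interval hI (Ioo_subset_of_interval hI ⟨has, hst.trans htb⟩)
        (Ioo_subset_of_interval hI ⟨has.trans hst, htb⟩)
    rw [setIntegral_eq_intervalIntegral_of_support hIae has hst.le htb
      (fun x hx => by rw [hz' x hx, zero_smul])] at h1 h2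
    rw [setIntegral_eq_intervalIntegral_of_support (ae_eq_refl _) has hst.le htb
      (fun x hx => by rw [hz' x hx, zero_smul])]
    have hψ' : Continuous (deriv ψ) := hψ.continuous_deriv (by simp)
    have i1 : IntervalIntegrable (fun x => deriv ψ x • g x) volume s t := by
      refine ContinuousOn.intervalIntegrable ?_
      rw [uIcc_of_le hst.le]
      exact hψ'.continuousOn.smul (hg.mono hsubI)
    have i2 : IntervalIntegrable (fun x => deriv ψ x • H x) volume s t := by
      refine ContinuousOn.intervalIntegrable ?_
      rw [uIcc_of_le hst.le]
      exact hψ'.continuousOn.smul (hHc.mono (hsubI.trans hIcc))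
    simp only [smul_sub]
    rw [intervalIntegral.integral_sub i1 i2, h1, h2, sub_self])
  have hC' : EqOn (fun t => g t - H t) (fun _ => C) I := by
    refine EqOn.of_subset_closure (s := Ioo a b) hC hk continuousOn_const
      (Ioo_subset_of_interval hI) ?_
    rw [closure_Ioo hab.ne]
    exact hIcc
  intro s hs t ht
  have e1 := hC' hs
  have e2 := hC' ht
  simp only at e1 e2
  have e3 := hHprim s (hIcc hs) t (hIcc ht)
  rw [sub_eq_iff_eq_add] at e1 e2
  rw [e2, e3, e1]; abel

/-- Uniqueness of weak derivatives. The second one need only be locally integrable, because it will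
be a classical derivative, continuous on a possibly half-open interval. -/
theorem ae_eq_of_hasWeakDerivOn {I : Set ℝ} {a b : ℝ} (hab : a < b)
    (hI : I = Icc a b ∨ I = Ico a b) {g h h' : ℝ → E}
    (hh : IntervalIntegrable h volume a b) (hh' : LocallyIntegrableOn h' (Ioo a b))
    (hw : HasWeakDerivOn I g h) (hw' : HasWeakDerivOn I g h') :
    h =ᵐ[volume.restrict I] h' := by
  have hIae := ae_eq_Ioo_of_interval hI
  rw [Measure.restrict_congr_set hIae]
  have hloc : LocallyIntegrableOn h (Ioo a b) := by
    rw [intervalIntegrable_iff_integrableOn_Ioo_of_le hab.le] at hh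
    exact hh.locallyIntegrableOn
  have := isOpen_Ioo.ae_eq_zero_of_integral_contDiff_smul_eq_zero (hloc.sub hh') (by
    intro ψ hψ hψc hψs
    have hs' : tsupport ψ ⊆ interior I := by rwa [interior_of_interval hI]
    have h1 := hw ψ hψ hψc hs'
    have h2 := hw' ψ hψ hψc hs'
    rw [h1, neg_inj, setIntegral_congr_set hIae, setIntegral_congr_set hIae] at h2
    have hi : ∀ {k : ℝ → E}, LocallyIntegrableOn k (Ioo a b) →
        IntegrableOn (fun t => ψ t • k t) (Ioo a b) := by
      intro k hk
      have h1 : IntegrableOn (fun t => ψ t • k t) (tsupport ψ) :=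
        (hk.integrableOn_compact_subset hψs hψc.isCompact).continuousOn_smul
          hψ.continuous.continuousOn hψc.isCompact
      have : Integrable (fun t => ψ t • k t) := by
        rw [← integrableOn_iff_integrable_of_support_subset (s := tsupport ψ)]
        · exact h1
        · intro x hx
          by_contra hx'
          exact hx (by simp [image_eq_zero_of_notMem_tsupport hx'])
      exact this.integrableOn
    rw [← setIntegral_eq_integral_of_forall_compl_eq_zero (s := Ioo a b)]
    · simp only [Pi.sub_apply, smul_sub]
      rw [integral_sub (hi hloc) (hi hh'), h2, sub_self]
    · intro x hx
      rw [image_eq_zero_of_notMem_tsupport fun h => hx (hψs h), zero_smul])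
  rw [EventuallyEq, ae_restrict_iff' measurableSet_Ioo]
  filter_upwards [this] with t ht htm
  exact sub_eq_zero.1 (ht htm)

theorem HasWeakDerivOn.congr_left {I : Set ℝ} {g g' h : ℝ → E}
    (hw : HasWeakDerivOn I g h) (hg : g =ᵐ[volume.restrict I] g') : HasWeakDerivOn I g' h := by
  intro ψ hψ hψc hψs
  rw [← hw ψ hψ hψc hψs]
  refine integral_congr_ae ?_
  filter_upwards [hg] with t ht
  rw [ht]

theorem hasWeakDerivOn_of_hasDerivWithinAt {I : Set ℝ} {a b : ℝ} (hab : a < b)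
    (hI : I = Icc a b ∨ I = Ico a b) {g g' : ℝ → E}
    (hg : ∀ x ∈ I, HasDerivWithinAt g (g' x) I x) (hg' : ContinuousOn g' I) :
    HasWeakDerivOn I g g' :=
  hasWeakDerivOn_of_primitive hab (ae_eq_Ioo_of_interval hI) (interior_of_interval hI)
    fun s hs t ht hst => by
      have hsub : Icc s t ⊆ I := Icc_subset_of_interval hI (Ioo_subset_of_interval hI hs)
        (Ioo_subset_of_interval hI ht)
      exact primitive_of_hasDerivWithinAt hst (fun x hx => (hg x (hsub hx)).mono hsub)
        (hg'.mono hsub)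

/-- The jet of the `C^{n-1}` representative of a function in `W^{n,∞}` is bounded, and its top
component is the primitive of an essentially bounded function. -/
theorem MemSobolevInf.bounded_jet_and_primitive {I : Set ℝ} {a b : ℝ} (hab : a < b)
    (hI : I = Icc a b ∨ I = Ico a b) {n : ℕ} (hn : 0 < n) {f : ℝ → E} (hf : MemSobolevInf n f I)
    (hfc : ContDiffOn ℝ ((n - 1 : ℕ) : WithTop ℕ∞) f I) :
    (∀ k < n, ∃ C, ∀ t ∈ I, ‖iteratedDerivWithin k f I t‖ ≤ C) ∧
    ∃ h : ℝ → E, MemLp h ⊤ (volume.restrict I) ∧ ∀ s ∈ I, ∀ t ∈ I,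
      iteratedDerivWithin (n - 1) f I t = iteratedDerivWithin (n - 1) f I s + ∫ x in s..t, h x := by
  obtain ⟨g, rfl, hgL, hgw⟩ := hf
  have hu := uniqueDiffOn_of_interval hab hI
  have hcont : ∀ k < n, ContinuousOn (iteratedDerivWithin k (g 0) I) I := fun k hk =>
    hfc.continuousOn_iteratedDerivWithin (by exact_mod_cast (by omega)) hu
  -- Below the top order, weak derivatives agree a.e. with the classical derivatives of the
  -- representative; essential bounds then become pointwise ones by continuity.
  have hae : ∀ k < n, g k =ᵐ[volume.restrict I] iteratedDerivWithin k (g 0) I := by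
    intro k
    induction k with
    | zero => intro _; simp
    | succ k ih =>
      intro hk
      have hw := (hgw k (by omega)).congr_left (ih (by omega))
      have hw' : HasWeakDerivOn I (iteratedDerivWithin k (g 0) I)
          (iteratedDerivWithin (k + 1) (g 0) I) :=
        hasWeakDerivOn_of_hasDerivWithinAt hab hI
          (fun x hx => hfc.hasDerivWithinAt_iteratedDerivWithin hu (by omega) hx) (hcont _ hk)
      exact ae_eq_of_hasWeakDerivOn hab hI
        (intervalIntegrable_of_memLp_top hab.le hI (hgL (k + 1) hk.le))
        (((hcont _ hk).mono (Ioo_subset_of_interval hI)).locallyIntegrableOn measurableSet_Ioo)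
        hw hw'
  constructor
  · intro k hk
    refine ⟨(eLpNormEssSup (g k) (volume.restrict I)).toReal,
      norm_le_of_ae_of_continuousOn hab hI (hcont k hk) ?_⟩
    have hfin : eLpNormEssSup (g k) (volume.restrict I) ≠ ⊤ := by
      have := (hgL k hk.le).2
      rw [eLpNorm_exponent_top] at this
      exact this.ne
    filter_upwards [hae k hk, ae_le_eLpNormEssSup (f := g k) (μ := volume.restrict I)]
      with t ht ht'
    rw [← ht]
    have := ENNReal.toReal_mono hfin ht'
    simpa using this
  · refine ⟨g n, hgL n le_rfl, ?_⟩
    have hw := (hgw (n - 1) (by omega)).congr_left (hae (n - 1) (by omega))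
    rw [Nat.sub_add_cancel hn] at hw
    exact primitive_of_hasWeakDerivOn hab hI (hcont _ (by omega))
      (intervalIntegrable_of_memLp_top hab.le hI (hgL n le_rfl)) hw

end SobolevIntervals

/-! ### Existence for causal integral equations by Tonelli's delay method. -/

section Tonelli

variable {X : Type*} [NormedAddCommGroup X] [NormedSpace ℝ X]

/-- Continuous paths which agree with `hist` up to time `a` and stay `ε`-close to `hist a`
afterwards. -/
def pathTube (hist : ℝ → X) (a ε : ℝ) : Set (ℝ → X) :=
  {x | Continuous x ∧ (∀ t ≤ a, x t = hist t) ∧ ∀ t, a ≤ t → ‖x t - hist a‖ ≤ ε}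

/-- Tonelli's delayed integral operator. -/
noncomputable def delayOp (hist : ℝ → X) (a b δ : ℝ) (Φ : (ℝ → X) → ℝ → X) (x : ℝ → X)
    (t : ℝ) : X :=
  hist (min t a) + ∫ s in a..max a (min t b - δ), Φ x s

variable {hist : ℝ → X} {a b ε M : ℝ} {Φ : (ℝ → X) → ℝ → X}

theorem intervalIntegrable_of_ae_bound {F : ℝ → X} (hab : a ≤ b)
    (hm : AEStronglyMeasurable F (volume.restrict (Icc a b)))
    (hb : ∀ᵐ s ∂(volume.restrict (Icc a b)), ‖F s‖ ≤ M) : IntervalIntegrable F volume a b := by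
  rw [intervalIntegrable_iff_integrableOn_Icc_of_le hab]
  exact Integrable.of_bound hm M hb

theorem norm_integral_le_of_ae_bound {F : ℝ → X} {s t : ℝ} (has : a ≤ s) (hst : s ≤ t)
    (htb : t ≤ b) (hb : ∀ᵐ s ∂(volume.restrict (Icc a b)), ‖F s‖ ≤ M) :
    ‖∫ τ in s..t, F τ‖ ≤ M * (t - s) := by
  have := intervalIntegral.norm_integral_le_of_norm_le_const_ae (a := s) (b := t) (f := F) (C := M)
    (by
      rw [ae_restrict_iff' measurableSet_Icc] at hb
      filter_upwards [hb] with τ hτ hm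
      rw [uIoc_of_le hst] at hm
      exact hτ ⟨has.trans hm.1.le, hm.2.trans htb⟩)
  rwa [abs_of_nonneg (by linarith)] at this

/-- The upper limit `max a (min t b - δ)` is 1-Lipschitz in `t`. The Lipschitz constant `M` does not
depend on the delay, which gives equicontinuity of the approximations. -/
theorem norm_delayOp_sub_le (hab : a ≤ b) {δ : ℝ} {x : ℝ → X} (hδ : 0 ≤ δ) (hM : 0 ≤ M)
    (hm : AEStronglyMeasurable (Φ x) (volume.restrict (Icc a b)))
    (hb : ∀ᵐ s ∂(volume.restrict (Icc a b)), ‖Φ x s‖ ≤ M) {s t : ℝ} (hs : a ≤ s) (hst : s ≤ t) :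
    ‖delayOp hist a b δ Φ x t - delayOp hist a b δ Φ x s‖ ≤ M * (t - s) := by
  have hint := intervalIntegrable_of_ae_bound hab hm hb
  have hmem : ∀ t, max a (min t b - δ) ∈ uIcc a b := fun t => by
    rw [uIcc_of_le hab]
    exact ⟨le_max_left _ _, max_le hab (by linarith [min_le_right t b])⟩
  have hi : ∀ t, IntervalIntegrable (Φ x) volume a (max a (min t b - δ)) := fun t =>
    hint.mono_set (uIcc_subset_uIcc left_mem_uIcc (hmem t))
  have hmon : max a (min s b - δ) ≤ max a (min t b - δ) :=
    max_le_max le_rfl (by linarith [min_le_min_right b hst])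
  have hlen : max a (min t b - δ) - max a (min s b - δ) ≤ t - s := by
    have h1 : min t b - min s b ≤ t - s := by
      rcases le_total t b with h | h <;> rcases le_total s b with h' | h' <;> simp [h, h'] <;>
        linarith
    rcases le_total a (min t b - δ) with h | h
    · rw [max_eq_right h]
      linarith [le_max_right a (min s b - δ)]
    · rw [max_eq_left h]
      linarith [le_max_left a (min s b - δ)]
  have he : delayOp hist a b δ Φ x t - delayOp hist a b δ Φ x s =
      ∫ τ in (max a (min s b - δ))..(max a (min t b - δ)), Φ x τ := by
    rw [delayOp, delayOp, min_eq_right (hs.trans hst), min_eq_right hs,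
      ← intervalIntegral.integral_interval_sub_left (hi t) (hi s)]
    abel
  rw [he]
  refine (norm_integral_le_of_ae_bound (le_max_left _ _) hmon
    (by have := hmem t; rw [uIcc_of_le hab] at this; exact this.2) hb).trans ?_
  gcongr

theorem delayOp_of_le {δ t : ℝ} (hδ : 0 ≤ δ) (ht : t ≤ a) (x : ℝ → X) :
    delayOp hist a b δ Φ x t = hist t := by
  have : max a (min t b - δ) = a := max_eq_left (by linarith [min_le_left t b])
  simp [delayOp, this, ht]

theorem continuous_of_continuousOn_Iic_Ici {x : ℝ → X} (h1 : ContinuousOn x (Iic a))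
    (h2 : ContinuousOn x (Ici a)) : Continuous x := by
  rw [← continuousOn_univ, ← Iic_union_Ici (a := a)]
  exact h1.union_of_isClosed h2 isClosed_Iic isClosed_Ici

theorem delayOp_mem_pathTube (hhist : Continuous hist) (hab : a ≤ b) {δ : ℝ} (hδ : 0 ≤ δ)
    (hM : 0 ≤ M) (hMε : M * (b - a) ≤ ε) {x : ℝ → X}
    (hm : AEStronglyMeasurable (Φ x) (volume.restrict (Icc a b)))
    (hb : ∀ᵐ s ∂(volume.restrict (Icc a b)), ‖Φ x s‖ ≤ M) :
    delayOp hist a b δ Φ x ∈ pathTube hist a ε := by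
  refine ⟨?_, fun t ht => delayOp_of_le hδ ht x, fun t ht => ?_⟩
  · refine continuous_of_continuousOn_Iic_Ici (a := a) ?_ ?_
    · exact hhist.continuousOn.congr fun t ht => delayOp_of_le hδ ht x
    · refine LipschitzOnWith.continuousOn (K := M.toNNReal) ?_
      refine LipschitzOnWith.of_dist_le_mul fun s hs t ht => ?_
      rw [Real.coe_toNNReal M hM]
      rcases le_total s t with h | h
      · rw [dist_comm, dist_eq_norm, dist_comm, Real.dist_eq, abs_of_nonneg (by linarith)]
        exact norm_delayOp_sub_le hab hδ hM hm hb hs h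
      · rw [dist_eq_norm, Real.dist_eq, abs_of_nonneg (by linarith)]
        exact norm_delayOp_sub_le hab hδ hM hm hb ht h
  · rw [delayOp, min_eq_right ht, add_sub_cancel_left]
    have h1 : max a (min t b - δ) ≤ b := max_le hab (by linarith [min_le_right t b])
    refine (norm_integral_le_of_ae_bound le_rfl (le_max_left _ _) h1 hb).trans (le_trans ?_ hMε)
    gcongr

/-- The delayed integral equation has a solution. -/
theorem exists_fixedPoint_delayOp (hhist : Continuous hist) (hab : a ≤ b) {n : ℕ} {δ : ℝ}
    (hδ : 0 ≤ δ) (hn : b ≤ a + n * δ) (hM : 0 ≤ M) (hMε : M * (b - a) ≤ ε)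
    (hm : ∀ x ∈ pathTube hist a ε, AEStronglyMeasurable (Φ x) (volume.restrict (Icc a b)))
    (hb : ∀ x ∈ pathTube hist a ε, ∀ᵐ s ∂(volume.restrict (Icc a b)), ‖Φ x s‖ ≤ M)
    (hc : ∀ x ∈ pathTube hist a ε, ∀ x' ∈ pathTube hist a ε, ∀ t ∈ Icc a b,
      (∀ s ≤ t, x s = x' s) → ∀ᵐ s ∂(volume.restrict (Ico a t)), Φ x s = Φ x' s) :
    ∃ x ∈ pathTube hist a ε, delayOp hist a b δ Φ x = x := by
  set P := delayOp hist a b δ Φ with hP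
  have hPS : ∀ x ∈ pathTube hist a ε, P x ∈ pathTube hist a ε := fun x hx =>
    delayOp_mem_pathTube hhist hab hδ hM hMε (hm x hx) (hb x hx)
  have hε : 0 ≤ ε := (mul_nonneg hM (sub_nonneg.2 hab)).trans hMε
  set x₀ : ℝ → X := fun t => hist (min t a) with hx₀
  have hx₀S : x₀ ∈ pathTube hist a ε :=
    ⟨hhist.comp (continuous_id.min continuous_const), fun t ht => by simp [hx₀, ht],
      fun t ht => by simpa [hx₀, ht] using hε⟩
  -- At time `s` the delayed operator looks at `Φ x` only up to `s - δ`, so each application extends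
  -- the interval of agreement by `δ`.
  have hstep : ∀ x ∈ pathTube hist a ε, ∀ x' ∈ pathTube hist a ε, ∀ τ,
      (∀ s ≤ τ, x s = x' s) → ∀ s ≤ τ + δ, P x s = P x' s := by
    intro x hx x' hx' τ h s hs
    simp only [hP, delayOp, add_right_inj]
    rcases le_or_gt (min s b - δ) a with hle | hgt
    · simp [max_eq_left hle]
    rw [max_eq_right hgt.le]
    have hmem : min s b - δ ∈ Icc a b := ⟨hgt.le, by linarith [min_le_right s b]⟩
    have hae := hc x hx x' hx' _ hmem (fun u hu => h u (by linarith [min_le_left s b]))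
    rw [intervalIntegral.integral_of_le hgt.le, intervalIntegral.integral_of_le hgt.le]
    refine integral_congr_ae ?_
    rwa [Measure.restrict_congr_set Ico_ae_eq_Ioc] at hae
  have hiter : ∀ k : ℕ, ∀ x ∈ pathTube hist a ε, ∀ x' ∈ pathTube hist a ε,
      P^[k] x ∈ pathTube hist a ε ∧ P^[k] x' ∈ pathTube hist a ε ∧
      ∀ s ≤ a + k * δ, P^[k] x s = P^[k] x' s := by
    intro k
    induction k with
    | zero =>
      intro x hx x' hx'
      refine ⟨hx, hx', fun s hs => ?_⟩
      simp only [Nat.cast_zero, zero_mul, add_zero] at hs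
      simp [hx.2.1 s hs, hx'.2.1 s hs]
    | succ k ih =>
      intro x hx x' hx'
      obtain ⟨h1, h2, h3⟩ := ih x hx x' hx'
      rw [Function.iterate_succ_apply', Function.iterate_succ_apply']
      refine ⟨hPS _ h1, hPS _ h2, fun s hs => hstep _ h1 _ h2 _ h3 s ?_⟩
      push_cast at hs
      linarith
  -- The `n`-th iterates from `P x₀` and from `P (P x₀)` agree up to `b ≤ a + n δ`. The second is
  -- `P` of the first, and images under `P` are constant after `b`, so the first iterate is a fixed
  -- point.
  obtain ⟨h1, h2, h3⟩ := hiter n (P x₀) (hPS _ hx₀S) (P (P x₀)) (hPS _ (hPS _ hx₀S))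
  refine ⟨P^[n] (P x₀), h1, ?_⟩
  have hsat : ∀ (x : ℝ → X) (t : ℝ), b ≤ t → P x t = P x b := fun x t ht => by
    simp only [hP, delayOp, min_eq_right (hab.trans ht), min_eq_right hab, min_eq_right ht,
      min_self]
  have e1 : P^[n] (P x₀) = P (P^[n] x₀) := by
    rw [← Function.iterate_succ_apply, Function.iterate_succ_apply']
  have e2 : P^[n] (P (P x₀)) = P (P^[n] (P x₀)) := by
    rw [← Function.iterate_succ_apply, Function.iterate_succ_apply']
  rw [← e2]
  funext t
  rcases le_total t b with ht | ht
  · exact (h3 t (ht.trans hn)).symm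
  · rw [e1, e2, hsat _ t ht, hsat _ t ht, ← e1, ← e2]
    exact (h3 b hn).symm

/-- **Existence for causal integral equations.** A Peano type theorem for functionals `Φ` on
continuous paths which are causal, bounded and sequentially continuous on a tube. -/
theorem exists_solution_of_causal [FiniteDimensional ℝ X] (hhist : Continuous hist) (hab : a < b)
    (hM : 0 ≤ M) (hMε : M * (b - a) ≤ ε)
    (hm : ∀ x ∈ pathTube hist a ε, AEStronglyMeasurable (Φ x) (volume.restrict (Icc a b)))
    (hb : ∀ x ∈ pathTube hist a ε, ∀ᵐ s ∂(volume.restrict (Icc a b)), ‖Φ x s‖ ≤ M)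
    (hc : ∀ x ∈ pathTube hist a ε, ∀ x' ∈ pathTube hist a ε, ∀ t ∈ Icc a b,
      (∀ s ≤ t, x s = x' s) → ∀ᵐ s ∂(volume.restrict (Ico a t)), Φ x s = Φ x' s)
    (hcont : ∀ (u : ℕ → ℝ → X) (x : ℝ → X), (∀ n, u n ∈ pathTube hist a ε) →
      x ∈ pathTube hist a ε → TendstoUniformly u x atTop →
      ∀ᵐ s ∂(volume.restrict (Icc a b)), Tendsto (fun n => Φ (u n) s) atTop (𝓝 (Φ x s))) :
    ∃ x ∈ pathTube hist a ε, ∀ t ∈ Icc a b, x t = hist a + ∫ s in a..t, Φ x s := by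
  have : ProperSpace X := FiniteDimensional.proper ℝ X
  set δ : ℕ → ℝ := fun n => (b - a) / (n + 1) with hδ
  have hδ0 : ∀ n, 0 ≤ δ n := fun n => div_nonneg (by linarith) (by positivity)
  have hδlim : Tendsto δ atTop (𝓝 0) := by
    have := (tendsto_one_div_add_atTop_nhds_zero_nat (𝕜 := ℝ)).const_mul (b - a)
    simpa only [mul_one_div, mul_zero] using this
  have hfix : ∀ n, ∃ x ∈ pathTube hist a ε, delayOp hist a b (δ n) Φ x = x := fun n =>
    exists_fixedPoint_delayOp hhist hab.le (n := n + 1) (hδ0 n) (by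
      simp only [hδ]; push_cast; field_simp; linarith) hM hMε hm hb hc
  choose u hu hufix using hfix
  have hlip : ∀ n s t, a ≤ s → s ≤ t → ‖u n t - u n s‖ ≤ M * (t - s) := fun n s t hs hst => by
    have := norm_delayOp_sub_le (hist := hist) hab.le (hδ0 n) hM (hm _ (hu n)) (hb _ (hu n)) hs hst
    rwa [hufix n] at this
  have hsat : ∀ n t, b ≤ t → u n t = u n b := fun n t ht => by
    rw [← hufix n]
    simp only [delayOp, min_eq_right (hab.le.trans ht), min_eq_right hab.le, min_eq_right ht,
      min_self]
  -- a uniformly convergent subsequence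
  set F : ℕ → BoundedContinuousFunction (Icc a b) X := fun n =>
    BoundedContinuousFunction.mkOfCompact ⟨fun t => u n t, (hu n).1.comp continuous_subtype_val⟩
    with hF
  have hcomp : IsCompact (closure (range F)) := by
    refine BoundedContinuousFunction.arzela_ascoli (Metric.closedBall (hist a) ε)
      (isCompact_closedBall _ _) _ ?_ ?_
    · rintro _ t ⟨n, rfl⟩
      rw [mem_closedBall_iff_norm]
      exact (hu n).2.2 t t.2.1
    · refine Metric.equicontinuous_of_continuity_modulus (fun d => M * d) ?_ _ ?_
      · have : Tendsto (fun d : ℝ => M * d) (𝓝 0) (𝓝 (M * 0)) :=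
          (continuous_const.mul continuous_id).tendsto 0
        simpa using this
      · rintro s t ⟨_, n, rfl⟩
        change dist (u n s) (u n t) ≤ M * dist s t
        rw [Subtype.dist_eq]
        rcases le_total (s : ℝ) t with h | h
        · rw [dist_comm, dist_eq_norm, dist_comm, Real.dist_eq, abs_of_nonneg (by linarith)]
          exact hlip n s t s.2.1 h
        · rw [dist_eq_norm, Real.dist_eq, abs_of_nonneg (by linarith)]
          exact hlip n t s t.2.1 h
  obtain ⟨G, -, κ, hκ, hG⟩ := hcomp.tendsto_subseq (fun n => subset_closure (mem_range_self n))
  have hGu := BoundedContinuousFunction.tendsto_iff_tendstoUniformly.1 hG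
  have hGa : G ⟨a, left_mem_Icc.2 hab.le⟩ = hist a := by
    have h1 := hGu.tendsto_at ⟨a, left_mem_Icc.2 hab.le⟩
    refine tendsto_nhds_unique h1 ?_
    refine tendsto_const_nhds.congr fun n => ?_
    exact ((hu (κ n)).2.1 a le_rfl).symm
  -- The uniform limit on `[a, b]` is extended by the history to the left and by its last value to
  -- the right, exactly as the approximations are; convergence is therefore uniform on all of `ℝ`.
  set x : ℝ → X := fun t => if t ≤ a then hist t else G (projIcc a b hab.le t) with hx
  have hxge : ∀ t, a ≤ t → x t = G (projIcc a b hab.le t) := by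
    intro t ht
    rcases ht.eq_or_lt with rfl | ht
    · simp [hx, projIcc_left, hGa]
    · simp [hx, not_le.2 ht]
  have huge : ∀ n t, a ≤ t → u n t = u n (projIcc a b hab.le t) := by
    intro n t ht
    rcases le_total t b with h | h
    · rw [projIcc_of_mem hab.le ⟨ht, h⟩]
    · rw [projIcc_of_right_le hab.le h]
      exact hsat n t h
  have hunif : TendstoUniformly (fun n => u (κ n)) x atTop := by
    rw [Metric.tendstoUniformly_iff] at hGu ⊢
    intro e he
    filter_upwards [hGu e he] with n hn t
    rcases le_or_gt t a with ht | ht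
    · rw [(hu (κ n)).2.1 t ht]
      simpa [hx, ht] using he
    · rw [hxge t ht.le, huge _ t ht.le]
      exact hn _
  have hxS : x ∈ pathTube hist a ε := by
    refine ⟨hunif.continuous (Frequently.of_forall fun n => (hu _).1), fun t ht => by simp [hx, ht],
      fun t ht => ?_⟩
    refine le_of_tendsto ((hunif.tendsto_at t).sub_const (hist a)).norm
      (Eventually.of_forall fun n => (hu (κ n)).2.2 t ht)
  refine ⟨x, hxS, fun t ht => ?_⟩
  have hae := hcont (fun n => u (κ n)) x (fun n => hu _) hxS hunif
  have hconv : Tendsto (fun n => ∫ s in a..t, Φ (u (κ n)) s) atTop (𝓝 (∫ s in a..t, Φ x s)) := by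
    have hsub : Ioc a t ⊆ Icc a b := fun s hs => ⟨hs.1.le, hs.2.trans ht.2⟩
    have hmono : volume.restrict (Ioc a t) ≤ volume.restrict (Icc a b) :=
      Measure.restrict_mono hsub le_rfl
    simp only [intervalIntegral.integral_of_le ht.1]
    refine tendsto_integral_of_dominated_convergence (fun _ => M) (fun n => ?_) ?_ (fun n => ?_) ?_
    · exact (hm _ (hu _)).mono_measure hmono
    · exact integrable_const M
    · exact ae_mono hmono (hb _ (hu _))
    · exact ae_mono hmono hae
  -- The approximation violates the undelayed equation only by an integral over an interval of
  -- length at most the delay.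
  have htail : Tendsto (fun n => u (κ n) t - (hist a + ∫ s in a..t, Φ (u (κ n)) s)) atTop (𝓝 0)
      := by
    refine squeeze_zero_norm (a := fun n => M * δ (κ n)) (fun n => ?_) ?_
    · have hi : IntervalIntegrable (Φ (u (κ n))) volume a t :=
        (intervalIntegrable_of_ae_bound hab.le (hm _ (hu _)) (hb _ (hu _))).mono_set (by
          rw [uIcc_of_le ht.1, uIcc_of_le hab.le]; exact Icc_subset_Icc le_rfl ht.2)
      set τ := max a (min t b - δ (κ n)) with hτ
      have hτt : τ ≤ t := max_le ht.1 (by linarith [min_le_left t b, hδ0 (κ n)])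
      have hi' : IntervalIntegrable (Φ (u (κ n))) volume a τ := hi.mono_set (by
        rw [uIcc_of_le ht.1, uIcc_of_le (le_max_left _ _)]; exact Icc_subset_Icc le_rfl hτt)
      have e : u (κ n) t = hist a + ∫ s in a..τ, Φ (u (κ n)) s := by
        conv_lhs => rw [← hufix (κ n)]
        rw [delayOp, min_eq_right ht.1]
      rw [e, add_sub_add_left_eq_sub, norm_sub_rev,
        intervalIntegral.integral_interval_sub_left hi hi']
      refine (norm_integral_le_of_ae_bound (le_max_left _ _) hτt ht.2 (hb _ (hu _))).trans ?_
      have : t - δ (κ n) ≤ τ := by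
        rw [hτ, min_eq_left ht.2]
        exact le_max_right _ _
      gcongr
      linarith
    · simpa using (hδlim.comp hκ.tendsto_atTop).const_mul M
  have h1 := (hunif.tendsto_at t).sub ((tendsto_const_nhds (x := hist a)).add hconv)
  exact sub_eq_zero.1 (tendsto_nhds_unique h1 htail)

end Tonelli

/-! ### Block coordinates on the space of jets. -/

noncomputable section

/-- Blocks `(η_0, …, η_{r-1})` of elements of `E`, with the Euclidean norm. -/
abbrev JetVec (r : ℕ) (E : Type*) : Type _ := PiLp 2 (fun _ : Fin r => E)

section StateCoordinates

variable {r : ℕ} {E : Type*} [NormedAddCommGroup E] [InnerProductSpace ℝ E]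

/-- The `j`-th block of a state vector, and zero for `j ≥ r`. -/
def coordL (r : ℕ) (E : Type*) [NormedAddCommGroup E] [InnerProductSpace ℝ E] (j : ℕ) :
    JetVec r E →L[ℝ] E :=
  if h : j < r then PiLp.proj 2 (fun _ : Fin r => E) ⟨j, h⟩ else 0

theorem coordL_apply {j : ℕ} (h : j < r) (η : JetVec r E) : coordL r E j η = η ⟨j, h⟩ := by
  simp [coordL, h]

theorem coordL_of_le {j : ℕ} (h : r ≤ j) (η : JetVec r E) : coordL r E j η = 0 := by
  simp [coordL, not_lt.2 h]

theorem coordL_toLp (v : ℕ → E) {j : ℕ} (h : j < r) :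
    coordL r E j (WithLp.toLp 2 (fun k : Fin r => v k)) = v j := by
  simp [coordL_apply h]

theorem stateVec_ext {η ζ : JetVec r E} (h : ∀ j < r, coordL r E j η = coordL r E j ζ) :
    η = ζ := by
  ext1 k
  have := h k k.2
  rwa [coordL_apply k.2, coordL_apply k.2] at this

/-- A linear map on states, given blockwise by continuous linear maps. -/
def blockL (r : ℕ) (E : Type*) [NormedAddCommGroup E] [InnerProductSpace ℝ E]
    (L : ℕ → JetVec r E →L[ℝ] E) : JetVec r E →L[ℝ] JetVec r E :=
  (PiLp.continuousLinearEquiv 2 ℝ (fun _ : Fin r => E)).symm.toContinuousLinearMap ∘L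
    ContinuousLinearMap.pi fun k : Fin r => L k

theorem coordL_blockL (L : ℕ → JetVec r E →L[ℝ] E) {j : ℕ} (h : j < r) (η : JetVec r E) :
    coordL r E j (blockL r E L η) = L j η := by
  simp [coordL_apply h, blockL]

/-- The shift `(η_0, …, η_{r-1}) ↦ (η_1, …, η_{r-1}, 0)`. -/
def shiftL (r : ℕ) (E : Type*) [NormedAddCommGroup E] [InnerProductSpace ℝ E] :
    JetVec r E →L[ℝ] JetVec r E := blockL r E fun k => coordL r E (k + 1)

theorem coordL_shiftL (j : ℕ) (η : JetVec r E) :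
    coordL r E j (shiftL r E η) = coordL r E (j + 1) η := by
  rcases lt_or_ge j r with h | h
  · exact coordL_blockL _ h η
  · rw [coordL_of_le h, coordL_of_le (by omega)]

/-- The truncation `(η_0, …, η_{r-1}) ↦ (η_0, …, η_{n-1}, 0, …, 0)`. -/
def truncL (r : ℕ) (E : Type*) [NormedAddCommGroup E] [InnerProductSpace ℝ E] (n : ℕ) :
    JetVec r E →L[ℝ] JetVec r E :=
  blockL r E fun k => if k < n then coordL r E k else 0

theorem coordL_truncL (n j : ℕ) (η : JetVec r E) :
    coordL r E j (truncL r E n η) = if j < n then coordL r E j η else 0 := by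
  rcases lt_or_ge j r with h | h
  · rw [truncL, coordL_blockL _ h η]
    split_ifs <;> rfl
  · rw [coordL_of_le h, coordL_of_le h, ite_self]

/-- The embedding of `ℝᵐ` as the last block of the state space. -/
def lastL (r : ℕ) (E : Type*) [NormedAddCommGroup E] [InnerProductSpace ℝ E] : E →L[ℝ] JetVec r E :=
  (PiLp.continuousLinearEquiv 2 ℝ (fun _ : Fin r => E)).symm.toContinuousLinearMap ∘L
    ContinuousLinearMap.pi fun k : Fin r =>
      if (k : ℕ) + 1 = r then ContinuousLinearMap.id ℝ (E) else 0

theorem coordL_lastL {j : ℕ} (h : j < r) (v : E) :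
    coordL r E j (lastL r E v) = if j + 1 = r then v else 0 := by
  simp only [coordL_apply h, lastL, ContinuousLinearMap.comp_apply, ContinuousLinearEquiv.coe_coe,
    PiLp.coe_symm_continuousLinearEquiv, ContinuousLinearMap.coe_pi']
  split_ifs <;> simp

theorem norm_stateVec_le {η : JetVec r E} {C : ℝ} (h : ∀ j < r, ‖coordL r E j η‖ ≤ C) :
    ‖η‖ ≤ Real.sqrt (r * C ^ 2) := by
  rw [PiLp.norm_eq_of_L2]
  refine Real.sqrt_le_sqrt ?_
  calc ∑ i : Fin r, ‖η i‖ ^ 2 ≤ ∑ _i : Fin r, C ^ 2 := by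
        refine Finset.sum_le_sum fun i _ => ?_
        have := h i i.2
        rw [coordL_apply i.2] at this
        gcongr
    _ = r * C ^ 2 := by simp

theorem norm_coordL_le (j : ℕ) (η : JetVec r E) : ‖coordL r E j η‖ ≤ ‖η‖ := by
  rcases lt_or_ge j r with h | h
  · rw [coordL_apply h]
    exact PiLp.norm_apply_le η _
  · rw [coordL_of_le h, norm_zero]
    positivity

/-- Derivative of a state-valued curve from the derivatives of its blocks. -/
theorem hasDerivWithinAt_of_coordL {x : ℝ → JetVec r E} {x' : JetVec r E} {J : Set ℝ} {t : ℝ}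
    (h : ∀ j < r, HasDerivWithinAt (fun s => coordL r E j (x s)) (coordL r E j x') J t) :
    HasDerivWithinAt x x' J t := by
  rw [hasDerivWithinAt_iff_hasFDerivWithinAt, hasFDerivWithinAt_piLp]
  intro i
  have := (h i i.2).hasFDerivWithinAt
  simp only [coordL_apply i.2] at this
  have he : (PiLp.proj 2 (fun _ : Fin r => E) i) ∘L ContinuousLinearMap.toSpanSingleton ℝ x' =
      ContinuousLinearMap.toSpanSingleton ℝ (x' i) := by
    ext
    simp
  rw [he]
  exact this

theorem continuousOn_of_coordL {Y : Type*} [TopologicalSpace Y] {x : Y → JetVec r E} {J : Set Y}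
    (h : ∀ j < r, ContinuousOn (fun s => coordL r E j (x s)) J) : ContinuousOn x J := by
  have h1 : ContinuousOn (fun s => (WithLp.ofLp (x s) : Fin r → E)) J := by
    rw [continuousOn_pi]
    intro i
    have := h i i.2
    simpa only [coordL_apply i.2] using this
  exact (PiLp.continuousLinearEquiv 2 ℝ
    (fun _ : Fin r => E)).symm.continuous.comp_continuousOn h1

end StateCoordinates

/-! ### The error signals as functions of time and of the jet. -/

section ErrorFunctions

variable {r : ℕ} {E : Type*} [NormedAddCommGroup E] [InnerProductSpace ℝ E] (φ α : ℝ → ℝ)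

/-- The derivative of `F(t, η(t))` along curves `η` with `η_j' = η_{j+1}`. -/
def totalDeriv (F : ℝ × JetVec r E → E) (p : ℝ × JetVec r E) : E :=
  fderiv ℝ F p (1, shiftL r E p.2)

/-- The correction term `∑_{i ≤ n} γ_i^{(n-i)}` in `e_{n+1}`, as a function of time and of the jet
of the error. -/
def corrFun : ℕ → ℝ × JetVec r E → E
  | 0 => fun _ => 0
  | n + 1 => fun p => totalDeriv (corrFun n) p +
      α (‖φ p.1 • (coordL r E n p.2 + corrFun n p)‖ ^ 2) • φ p.1 • (coordL r E n p.2 + corrFun n p)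

/-- `e_{n+1}` as a function of time and of the jet of the error. -/
def errFun (n : ℕ) (p : ℝ × JetVec r E) : E :=
  φ p.1 • (coordL r E n p.2 + corrFun φ α n p)

/-- `γ_{n+1}` as a function of time and of the jet of the error. -/
def gainFun (n : ℕ) (p : ℝ × JetVec r E) : E :=
  α (‖errFun φ α n p‖ ^ 2) • errFun φ α n p

/-- Differentiating `∑_{i ≤ n} γ_i^{(n-i)}` raises every order by one; the new summand is `γ_{n+1}`,
which is `gainFun n` because the indices here start at zero. -/
theorem corrFun_succ (n : ℕ) (p : ℝ × JetVec r E) :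
    corrFun φ α (n + 1) p = totalDeriv (corrFun φ α n) p + gainFun φ α n p := rfl

/-- The set where `t < T` and `‖e_1‖, …, ‖e_n‖ < 1`. -/
def errDomain (T : ℝ) (n : ℕ) : Set (ℝ × JetVec r E) :=
  {p | p.1 < T ∧ ∀ k < n, ‖errFun φ α k p‖ < 1}

variable {φ α} {T : ℝ}

theorem errDomain_anti {k n : ℕ} (h : k ≤ n) :
    (errDomain φ α T n : Set (ℝ × JetVec r E)) ⊆ errDomain φ α T k :=
  fun _ hp => ⟨hp.1, fun j hj => hp.2 j (hj.trans_le h)⟩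

theorem mem_errDomain_succ {n : ℕ} {p : ℝ × JetVec r E} :
    p ∈ errDomain φ α T (n + 1) ↔ p ∈ errDomain φ α T n ∧ ‖errFun φ α n p‖ < 1 := by
  simp only [errDomain, mem_ofPred_eq, Nat.lt_succ_iff_lt_or_eq]
  constructor
  · exact fun h => ⟨⟨h.1, fun k hk => h.2 k (Or.inl hk)⟩, h.2 n (Or.inr rfl)⟩
  · rintro ⟨⟨h1, h2⟩, h3⟩
    exact ⟨h1, fun k hk => hk.elim (h2 k) (fun h => h ▸ h3)⟩

theorem contDiffOn_errFun_of_corrFun (hφ : ContDiffOn ℝ ∞ φ (Iio T)) {n l : ℕ}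
    (h : ContDiffOn ℝ (l : WithTop ℕ∞) (corrFun φ α n)
      (errDomain φ α T n : Set (ℝ × JetVec r E))) :
    ContDiffOn ℝ (l : WithTop ℕ∞) (errFun φ α n)
      (errDomain φ α T n : Set (ℝ × JetVec r E)) := by
  have hφ' : ContDiffOn ℝ (l : WithTop ℕ∞) (fun p : ℝ × JetVec r E => φ p.1)
      (errDomain φ α T n) :=
    (hφ.of_le (by exact_mod_cast le_top)).comp contDiff_fst.contDiffOn fun p hp => hp.1
  exact hφ'.smul ((((coordL r E n).contDiff.comp contDiff_snd).contDiffOn).add h)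

theorem contDiffOn_gainFun_of_corrFun (hφ : ContDiffOn ℝ ∞ φ (Iio T)) {n l : ℕ}
    (hα : ContDiffOn ℝ (l : WithTop ℕ∞) α (Ico 0 1))
    (h : ContDiffOn ℝ (l : WithTop ℕ∞) (corrFun φ α n)
      (errDomain φ α T n : Set (ℝ × JetVec r E))) :
    ContDiffOn ℝ (l : WithTop ℕ∞) (gainFun φ α n)
      (errDomain φ α T (n + 1) : Set (ℝ × JetVec r E)) := by
  have he := (contDiffOn_errFun_of_corrFun hφ h).mono (errDomain_anti n.le_succ)
  refine ContDiffOn.smul (hα.comp (he.norm_sq ℝ) fun p hp => ⟨by positivity, ?_⟩) he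
  have := hp.2 n n.lt_succ_self
  exact pow_lt_one₀ (norm_nonneg _) this two_ne_zero

/-- The domains are open and the correction terms are smooth on them. -/
theorem isOpen_errDomain_and_contDiffOn_corrFun (hφ : ContDiffOn ℝ ∞ φ (Iio T))
    (hα : ContDiffOn ℝ ((r - 1 : ℕ) : WithTop ℕ∞) α (Ico 0 1)) (n : ℕ) (hn : n ≤ r) :
    IsOpen (errDomain φ α T n : Set (ℝ × JetVec r E)) ∧
      ContDiffOn ℝ ((r - n : ℕ) : WithTop ℕ∞) (corrFun φ α n)
        (errDomain φ α T n : Set (ℝ × JetVec r E)) := by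
  induction n with
  | zero =>
    refine ⟨?_, contDiffOn_const⟩
    have : (errDomain φ α T 0 : Set (ℝ × JetVec r E)) = Prod.fst ⁻¹' Iio T := by
      ext p; simp [errDomain]
    rw [this]
    exact isOpen_Iio.preimage continuous_fst
  | succ n ih =>
    obtain ⟨ho, hc⟩ := ih (by omega)
    have he := contDiffOn_errFun_of_corrFun hφ hc
    have hopen : IsOpen (errDomain φ α T (n + 1) : Set (ℝ × JetVec r E)) := by
      have : (errDomain φ α T (n + 1) : Set (ℝ × JetVec r E)) =
          errDomain φ α T n ∩ (fun p => ‖errFun φ α n p‖) ⁻¹' Iio 1 := by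
        ext p; exact mem_errDomain_succ
      rw [this]
      exact he.continuousOn.norm.isOpen_inter_preimage ho isOpen_Iio
    refine ⟨hopen, ?_⟩
    -- Each total derivative costs one order of smoothness, and `r - (n + 1) ≤ r - 1` is all that is
    -- asked of `α`.
    have hle : ((r - (n + 1) : ℕ) : WithTop ℕ∞) + 1 ≤ ((r - n : ℕ) : WithTop ℕ∞) := by
      have : r - (n + 1) + 1 ≤ r - n := by omega
      exact_mod_cast this
    have h1 : ContDiffOn ℝ ((r - (n + 1) : ℕ) : WithTop ℕ∞) (totalDeriv (corrFun φ α n))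
        (errDomain φ α T (n + 1) : Set (ℝ × JetVec r E)) := by
      refine ContDiffOn.clm_apply
        ((hc.fderiv_of_isOpen ho hle).mono (errDomain_anti n.le_succ)) ?_
      exact (contDiff_const.prodMk ((shiftL r E).contDiff.comp contDiff_snd)).contDiffOn
    refine h1.add (contDiffOn_gainFun_of_corrFun hφ (hα.of_le ?_) (hc.of_le ?_))
    · exact_mod_cast (by omega : r - (n + 1) ≤ r - 1)
    · exact_mod_cast (by omega : r - (n + 1) ≤ r - n)

theorem isOpen_errDomain (hφ : ContDiffOn ℝ ∞ φ (Iio T))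
    (hα : ContDiffOn ℝ ((r - 1 : ℕ) : WithTop ℕ∞) α (Ico 0 1)) {n : ℕ} (hn : n ≤ r) :
    IsOpen (errDomain φ α T n : Set (ℝ × JetVec r E)) :=
  (isOpen_errDomain_and_contDiffOn_corrFun hφ hα n hn).1

theorem contDiffOn_corrFun (hφ : ContDiffOn ℝ ∞ φ (Iio T))
    (hα : ContDiffOn ℝ ((r - 1 : ℕ) : WithTop ℕ∞) α (Ico 0 1)) {n : ℕ} (hn : n ≤ r) :
    ContDiffOn ℝ ((r - n : ℕ) : WithTop ℕ∞) (corrFun φ α n)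
        (errDomain φ α T n : Set (ℝ × JetVec r E)) :=
  (isOpen_errDomain_and_contDiffOn_corrFun hφ hα n hn).2

theorem contDiffOn_errFun (hφ : ContDiffOn ℝ ∞ φ (Iio T))
    (hα : ContDiffOn ℝ ((r - 1 : ℕ) : WithTop ℕ∞) α (Ico 0 1)) {n : ℕ} (hn : n ≤ r) :
    ContDiffOn ℝ ((r - n : ℕ) : WithTop ℕ∞) (errFun φ α n)
        (errDomain φ α T n : Set (ℝ × JetVec r E)) :=
  contDiffOn_errFun_of_corrFun hφ (contDiffOn_corrFun hφ hα hn)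

theorem contDiffOn_gainFun (hφ : ContDiffOn ℝ ∞ φ (Iio T))
    (hα : ContDiffOn ℝ ((r - 1 : ℕ) : WithTop ℕ∞) α (Ico 0 1)) {n : ℕ} (hn : n < r) :
    ContDiffOn ℝ ((r - (n + 1) : ℕ) : WithTop ℕ∞) (gainFun φ α n)
        (errDomain φ α T (n + 1) : Set (ℝ × JetVec r E)) :=
  contDiffOn_gainFun_of_corrFun hφ (hα.of_le (by exact_mod_cast (by omega : r - (n + 1) ≤ r - 1)))
    ((contDiffOn_corrFun hφ hα hn.le).of_le (by exact_mod_cast (by omega : r - (n + 1) ≤ r - n)))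

theorem fderiv_eq_comp_of_eventuallyEq {V F : Type*} [NormedAddCommGroup V] [NormedSpace ℝ V]
    [NormedAddCommGroup F] [NormedSpace ℝ F] {f : V → F} {τ : V →L[ℝ] V} {p : V}
    (hev : f =ᶠ[𝓝 p] f ∘ τ) (hd : DifferentiableAt ℝ f (τ p)) :
    fderiv ℝ f p = (fderiv ℝ f (τ p)).comp τ :=
  ((hd.hasFDerivAt.comp p τ.hasFDerivAt).congr_of_eventuallyEq hev).fderiv

/-- Truncation of the state variable in the extended phase space. -/
def truncPairL (r : ℕ) (E : Type*) [NormedAddCommGroup E] [InnerProductSpace ℝ E] (n : ℕ) :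
    ℝ × JetVec r E →L[ℝ] ℝ × JetVec r E :=
  (ContinuousLinearMap.id ℝ ℝ).prodMap (truncL r E n)

theorem truncPairL_apply (n : ℕ) (p : ℝ × JetVec r E) :
    truncPairL r E n p = (p.1, truncL r E n p.2) := rfl

/-- `corrFun n` and `errDomain n` only depend on the first `n` blocks of the state. -/
theorem corrFun_congr (hφ : ContDiffOn ℝ ∞ φ (Iio T))
    (hα : ContDiffOn ℝ ((r - 1 : ℕ) : WithTop ℕ∞) α (Ico 0 1)) (n : ℕ) (hn : n ≤ r)
    (p q : ℝ × JetVec r E) (h1 : p.1 = q.1)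
    (h2 : ∀ k < n, coordL r E k p.2 = coordL r E k q.2) (hp : p ∈ errDomain φ α T n) :
    q ∈ errDomain φ α T n ∧ corrFun φ α n p = corrFun φ α n q := by
  induction n generalizing p q with
  | zero => exact ⟨⟨h1 ▸ hp.1, by simp⟩, rfl⟩
  | succ n ih =>
    have ih := ih (by omega)
    rw [mem_errDomain_succ] at hp
    obtain ⟨hq, hpq⟩ := ih p q h1 (fun k hk => h2 k (by omega)) hp.1
    have herr : errFun φ α n p = errFun φ α n q := by
      simp only [errFun, hpq, h1, h2 n n.lt_succ_self]
    refine ⟨mem_errDomain_succ.2 ⟨hq, herr ▸ hp.2⟩, ?_⟩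
    rw [corrFun_succ, corrFun_succ, gainFun, gainFun, herr, add_left_inj]
    -- By induction `corrFun n` is unchanged by truncation near `p`, so its derivative factors
    -- through the truncation. After the shift in `totalDeriv`, only block `n` is newly involved.
    have key : ∀ p ∈ (errDomain φ α T n : Set (ℝ × JetVec r E)),
        fderiv ℝ (corrFun φ α n) p =
          (fderiv ℝ (corrFun φ α n) (truncPairL r E n p)).comp (truncPairL r E n) := by
      intro p hp
      have hev : corrFun φ α n =ᶠ[𝓝 p] corrFun φ α n ∘ truncPairL r E n := by
        filter_upwards [(isOpen_errDomain hφ hα (by omega)).mem_nhds hp] with p' hp'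
        exact (ih p' (truncPairL r E n p') rfl (fun k hk => by
          simp [truncPairL_apply, coordL_truncL, hk]) hp').2
      have hτ : truncPairL r E n p ∈ (errDomain φ α T n : Set (ℝ × JetVec r E)) :=
        (ih p (truncPairL r E n p) rfl (fun k hk => by
          simp [truncPairL_apply, coordL_truncL, hk]) hp).1
      have hd : DifferentiableAt ℝ (corrFun φ α n) (truncPairL r E n p) :=
        ((contDiffOn_corrFun hφ hα (by omega)).contDiffAt
          ((isOpen_errDomain hφ hα (by omega)).mem_nhds hτ)).differentiableAt (by
            have : r - n ≠ 0 := by omega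
            exact_mod_cast this)
      exact fderiv_eq_comp_of_eventuallyEq hev hd
    have hτ : truncPairL r E n p = truncPairL r E n q := by
      rw [truncPairL_apply, truncPairL_apply, h1]
      congr 1
      refine stateVec_ext fun j _ => ?_
      rw [coordL_truncL, coordL_truncL]
      split_ifs with hj
      · exact h2 j (by omega)
      · rfl
    simp only [totalDeriv, key p hp.1, key q hq, hτ, ContinuousLinearMap.comp_apply]
    congr 1
    rw [truncPairL_apply, truncPairL_apply]
    simp only [Prod.mk.injEq, true_and]
    refine stateVec_ext fun j _ => ?_
    rw [coordL_truncL, coordL_truncL, coordL_shiftL, coordL_shiftL]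
    split_ifs with hj
    · exact h2 (j + 1) (by omega)
    · rfl

/-- The chain rule for the correction terms along jets. -/
theorem hasDerivWithinAt_corrFun (hφ : ContDiffOn ℝ ∞ φ (Iio T))
    (hα : ContDiffOn ℝ ((r - 1 : ℕ) : WithTop ℕ∞) α (Ico 0 1)) {n : ℕ} (hn : n < r)
    {x : ℝ → JetVec r E} {J : Set ℝ} {t : ℝ} (hx : ContinuousWithinAt x J t)
    (hd : ∀ k, k + 1 < r →
      HasDerivWithinAt (fun s => coordL r E k (x s)) (coordL r E (k + 1) (x t)) J t)
    (hp : (t, x t) ∈ errDomain φ α T n) :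
    HasDerivWithinAt (fun s => corrFun φ α n (s, x s))
      (totalDeriv (corrFun φ α n) (t, x t)) J t := by
  have ho : IsOpen (errDomain φ α T n : Set (ℝ × JetVec r E)) := isOpen_errDomain hφ hα hn.le
  have hcoord : ∀ p : ℝ × JetVec r E, ∀ k < n,
      coordL r E k p.2 = coordL r E k (truncPairL r E n p).2 := fun p k hk => by
    simp [truncPairL_apply, coordL_truncL, hk]
  have hcongr : ∀ p ∈ (errDomain φ α T n : Set (ℝ × JetVec r E)),
      corrFun φ α n p = corrFun φ α n (truncPairL r E n p) := fun p hp =>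
    (corrFun_congr hφ hα n hn.le p (truncPairL r E n p) rfl (hcoord p) hp).2
  have hτ := (corrFun_congr hφ hα n hn.le (t, x t) (truncPairL r E n (t, x t)) rfl (hcoord _) hp).1
  have hdiff : ∀ q ∈ (errDomain φ α T n : Set (ℝ × JetVec r E)),
      DifferentiableAt ℝ (corrFun φ α n) q := fun q hq =>
    ((contDiffOn_corrFun hφ hα hn.le).contDiffAt (ho.mem_nhds hq)).differentiableAt (by
      have : r - n ≠ 0 := by omega
      exact_mod_cast this)
  have hpair : ContinuousWithinAt (fun s => (s, x s)) J t := continuousWithinAt_id.prodMk hx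
  have hev : (fun s => corrFun φ α n (s, x s)) =ᶠ[𝓝[J] t]
      fun s => corrFun φ α n (truncPairL r E n (s, x s)) := by
    filter_upwards [hpair (ho.mem_nhds hp)] with s hs
    exact hcongr _ hs
  -- The last block of a jet need not be differentiable. The chain rule is therefore applied to the
  -- truncated curve, whose nonzero blocks have index `j < n ≤ r - 1`.
  have hcurve : HasDerivWithinAt (fun s => truncPairL r E n (s, x s))
      (truncPairL r E n (1, shiftL r E (x t))) J t := by
    simp only [truncPairL_apply]
    refine (hasDerivWithinAt_id t J).prodMk (hasDerivWithinAt_of_coordL fun j hj => ?_)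
    simp only [coordL_truncL, coordL_shiftL]
    split_ifs with hjn
    · exact hd j (by omega)
    · exact hasDerivWithinAt_const _ _ _
  have h1 := (hdiff _ hτ).hasFDerivAt.comp_hasDerivWithinAt t hcurve
  have h2 : totalDeriv (corrFun φ α n) (t, x t) =
      fderiv ℝ (corrFun φ α n) (truncPairL r E n (t, x t))
        (truncPairL r E n (1, shiftL r E (x t))) := by
    have hev' : corrFun φ α n =ᶠ[𝓝 (t, x t)] corrFun φ α n ∘ truncPairL r E n := by
      filter_upwards [ho.mem_nhds hp] with p' hp'
      exact hcongr p' hp'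
    rw [totalDeriv, fderiv_eq_comp_of_eventuallyEq hev' (hdiff _ hτ),
      ContinuousLinearMap.comp_apply]
  rw [h2]
  exact h1.congr_of_eventuallyEq hev (hcongr _ hp)

end ErrorFunctions

end

/-! ### Evaluation of the error functions along jets of curves. -/

section ErrorAlongJets

variable {r : ℕ} {E : Type*} [NormedAddCommGroup E] [InnerProductSpace ℝ E]

/-- `x` is the jet `(x_0, x_0', …, x_0^{(r-1)})` of a `C^{r-1}` function on `J`. -/
structure IsJetOn (x : ℝ → JetVec r E) (J : Set ℝ) : Prop where
  continuousOn : ContinuousOn x J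
  hasDeriv : ∀ k, k + 1 < r → ∀ t ∈ J,
    HasDerivWithinAt (fun s => coordL r E k (x s)) (coordL r E (k + 1) (x t)) J t

theorem IsJetOn.mono {x : ℝ → JetVec r E} {J J' : Set ℝ} (hx : IsJetOn x J) (h : J' ⊆ J) :
    IsJetOn x J' :=
  ⟨hx.continuousOn.mono h, fun k hk t ht => (hx.hasDeriv k hk t (h ht)).mono h⟩

theorem IsJetOn.sub {x y : ℝ → JetVec r E} {J : Set ℝ} (hx : IsJetOn x J) (hy : IsJetOn y J) :
    IsJetOn (fun t => x t - y t) J :=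
  ⟨hx.continuousOn.sub hy.continuousOn, fun k hk t ht => by
    simpa only [map_sub] using (hx.hasDeriv k hk t ht).fun_sub (hy.hasDeriv k hk t ht)⟩

theorem IsJetOn.contDiffOn_coordL {x : ℝ → JetVec r E} {J : Set ℝ} (hJ : UniqueDiffOn ℝ J)
    (hx : IsJetOn x J) {k n : ℕ} (hk : k + n < r) :
    ContDiffOn ℝ (n : WithTop ℕ∞) (fun s => coordL r E k (x s)) J := by
  refine contDiffOn_of_chain hJ (g := fun j s => coordL r E (k + j) (x s)) (n := n) ?_ ?_
  · intro j hj t ht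
    exact hx.hasDeriv (k + j) (by omega) t ht
  · exact (coordL r E (k + n)).continuous.comp_continuousOn hx.continuousOn

theorem IsJetOn.iteratedDerivWithin_eqOn {x : ℝ → JetVec r E} {J : Set ℝ} (hJ : UniqueDiffOn ℝ J)
    (hx : IsJetOn x J) {f : ℝ → E} (hf : EqOn f (fun s => coordL r E 0 (x s)) J) {k : ℕ}
    (hk : k < r) : EqOn (iteratedDerivWithin k f J) (fun s => coordL r E k (x s)) J :=
  (iteratedDerivWithin_congr hf).trans
    (iteratedDerivWithin_eqOn_of_chain hJ (g := fun j s => coordL r E j (x s)) (n := r - 1)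
      (fun j hj t ht => hx.hasDeriv j (by omega) t ht) k (by omega))

/-- The jet `(f, f', …, f^{(r-1)})` of `f`, with derivatives within `J`. -/
noncomputable def jetOf (r : ℕ) (f : ℝ → E) (J : Set ℝ) (t : ℝ) : JetVec r E :=
  WithLp.toLp 2 (fun k : Fin r => iteratedDerivWithin k.1 f J t)

theorem coordL_jetOf (f : ℝ → E) (J : Set ℝ) (t : ℝ) {k : ℕ} (hk : k < r) :
    coordL r E k (jetOf r f J t) = iteratedDerivWithin k f J t :=
  coordL_toLp (fun k => iteratedDerivWithin k f J t) hk

theorem isJetOn_jetOf {f : ℝ → E} {J : Set ℝ} (hJ : UniqueDiffOn ℝ J)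
    (hf : ContDiffOn ℝ ((r - 1 : ℕ) : WithTop ℕ∞) f J) : IsJetOn (jetOf r f J) J := by
  constructor
  · refine continuousOn_of_coordL fun j hj => ?_
    simp only [coordL_jetOf f J _ hj]
    exact hf.continuousOn_iteratedDerivWithin (by exact_mod_cast (by omega : j ≤ r - 1)) hJ
  · intro k hk t ht
    simp only [coordL_jetOf f J _ hk, coordL_jetOf f J _ (k.lt_succ_self.trans hk)]
    exact hf.hasDerivWithinAt_iteratedDerivWithin hJ (by omega : k < r - 1) ht

variable {φ α : ℝ → ℝ} {T : ℝ}

/-- Only the blocks `0, …, n` of the jet enter `gainFun n`, and along a jet of length `r` these are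
of class `C^{r-(n+1)}`, so the composition loses no smoothness. -/
theorem contDiffWithinAt_gainFun_comp (hφ : ContDiffOn ℝ ∞ φ (Iio T))
    (hα : ContDiffOn ℝ ((r - 1 : ℕ) : WithTop ℕ∞) α (Ico 0 1)) {J : Set ℝ} (hJ : UniqueDiffOn ℝ J)
    {x : ℝ → JetVec r E} (hx : IsJetOn x J) {n : ℕ} (hn : n < r) {t : ℝ} (ht : t ∈ J)
    (hp : (t, x t) ∈ errDomain φ α T (n + 1)) :
    ContDiffWithinAt ℝ ((r - (n + 1) : ℕ) : WithTop ℕ∞) (fun s => gainFun φ α n (s, x s)) J t := by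
  have ho : IsOpen (errDomain φ α T (n + 1) : Set (ℝ × JetVec r E)) := isOpen_errDomain hφ hα hn
  have hcoord : ∀ p : ℝ × JetVec r E, ∀ k < n + 1,
      coordL r E k p.2 = coordL r E k (truncPairL r E (n + 1) p).2 := fun p k hk => by
    simp [truncPairL_apply, coordL_truncL, hk]
  have hcongr : ∀ p ∈ (errDomain φ α T (n + 1) : Set (ℝ × JetVec r E)),
      gainFun φ α n p = gainFun φ α n (truncPairL r E (n + 1) p) := fun p hp => by
    have h1 := (corrFun_congr hφ hα n hn.le p (truncPairL r E (n + 1) p) rfl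
      (fun k hk => hcoord p k (by omega)) (errDomain_anti n.le_succ hp)).2
    simp only [gainFun, errFun, h1, hcoord p n n.lt_succ_self]
    rfl
  have hτ := (corrFun_congr hφ hα (n + 1) hn (t, x t) (truncPairL r E (n + 1) (t, x t)) rfl
    (hcoord _) hp).1
  have hcurve : ContDiffOn ℝ ((r - (n + 1) : ℕ) : WithTop ℕ∞)
      (fun s => truncPairL r E (n + 1) (s, x s)) J := by
    simp only [truncPairL_apply]
    refine contDiffOn_id.prodMk ?_
    rw [contDiffOn_piLp]
    intro i
    have : (fun s => (truncL r E (n + 1) (x s)) i) =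
        fun s => if (i : ℕ) < n + 1 then coordL r E i (x s) else 0 := by
      funext s
      rw [← coordL_truncL, coordL_apply i.2]
    rw [this]
    split_ifs with hi
    · exact hx.contDiffOn_coordL hJ (by omega)
    · exact contDiffOn_const
  have hg := ((contDiffOn_gainFun hφ hα hn).contDiffAt (ho.mem_nhds hτ)).comp_contDiffWithinAt t
    (hcurve t ht)
  refine hg.congr_of_eventuallyEq ?_ (hcongr _ hp)
  have hpair : ContinuousWithinAt (fun s => (s, x s)) J t :=
    continuousWithinAt_id.prodMk (hx.continuousOn t ht)
  filter_upwards [hpair (ho.mem_nhds hp)] with s hs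
  exact hcongr _ hs

/-- The sums of iterated derivatives in the recursion for `e_k` are given by `corrFun`. -/
theorem sum_iteratedDerivWithin_eventuallyEq (hφ : ContDiffOn ℝ ∞ φ (Iio T))
    (hα : ContDiffOn ℝ ((r - 1 : ℕ) : WithTop ℕ∞) α (Ico 0 1)) {J : Set ℝ} (hJ : UniqueDiffOn ℝ J)
    {x : ℝ → JetVec r E} (hx : IsJetOn x J) {t₀ : ℝ} (ht₀ : t₀ ∈ J) {g : ℕ → ℝ → E} (n : ℕ)
    (hn : n < r) (hp : (t₀, x t₀) ∈ errDomain φ α T n)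
    (hg : ∀ i < n, g i =ᶠ[𝓝[J] t₀] fun t => gainFun φ α i (t, x t)) :
    (fun t => ∑ i ∈ Finset.range n, iteratedDerivWithin (n - 1 - i) (g i) J t) =ᶠ[𝓝[J] t₀]
      fun t => corrFun φ α n (t, x t) := by
  induction n with
  | zero => simp [corrFun]
  | succ n ih =>
    have ih := ih (by omega) (errDomain_anti n.le_succ hp) fun i hi => hg i (by omega)
    have ho : IsOpen (errDomain φ α T (n + 1) : Set (ℝ × JetVec r E)) :=
      isOpen_errDomain hφ hα hn.le
    have hpair : ContinuousWithinAt (fun s => (s, x s)) J t₀ :=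
      continuousWithinAt_id.prodMk (hx.continuousOn t₀ ht₀)
    have hdom : ∀ᶠ t in 𝓝[J] t₀, (t, x t) ∈ errDomain φ α T (n + 1) := hpair (ho.mem_nhds hp)
    -- The identities hold as germs within `J`, which is what differentiation preserves; a germ
    -- equality at `t₀` gives germ equalities at all nearby points.
    have hgg : ∀ᶠ t in 𝓝[J] t₀, ∀ i ∈ Finset.range (n + 1),
        g i =ᶠ[𝓝[J] t] fun t => gainFun φ α i (t, x t) := by
      rw [Finset.eventually_all]
      intro i hi
      exact eventually_eventually_nhdsWithin.2 (hg i (Finset.mem_range.1 hi))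
    -- Differentiating the identity for `n` raises every order in the sum by one; the remaining term
    -- `i = n` has order zero.
    have hder := ih.iteratedDerivWithin 1
    simp only [iteratedDerivWithin_one] at hder
    filter_upwards [hdom, hgg, hder, self_mem_nhdsWithin] with t hd hg' hder ht
    rw [Finset.sum_range_succ, corrFun_succ]
    have hlast : iteratedDerivWithin (n + 1 - 1 - n) (g n) J t = gainFun φ α n (t, x t) := by
      simp only [Nat.add_sub_cancel, Nat.sub_self, iteratedDerivWithin_zero]
      exact (hg' n (by simp)).eq_of_nhdsWithin ht
    rw [hlast, add_left_inj]
    have hchain := hasDerivWithinAt_corrFun hφ hα (by omega : n < r) (hx.continuousOn t ht)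
      (fun k hk => hx.hasDeriv k hk t ht) (errDomain_anti n.le_succ hd)
    rw [← hchain.derivWithin (hJ t ht), ← hder, derivWithin_fun_sum]
    · refine Finset.sum_congr rfl fun i hi => ?_
      have hi := Finset.mem_range.1 hi
      rw [← iteratedDerivWithin_succ]
      congr 1
      omega
    · intro i hi
      have hi := Finset.mem_range.1 hi
      have hc := (contDiffWithinAt_gainFun_comp hφ hα hJ hx (by omega : i < r) ht
        (errDomain_anti (by omega) hd)).congr_of_eventuallyEq (hg' i (by simp; omega))
        ((hg' i (by simp; omega)).eq_of_nhdsWithin ht)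
      exact hc.differentiableWithinAt_iteratedDerivWithin
        (by exact_mod_cast (by omega : n - 1 - i < r - (i + 1))) (by rwa [insert_eq_of_mem ht])

end ErrorAlongJets

section ErrVar

variable {r m : ℕ} {φ α : ℝ → ℝ} {T : ℝ}

theorem errVar_succ (J : Set ℝ) (e : ℝ → Vec m) (n : ℕ) (t : ℝ) :
    errVar φ α J e (n + 1) t = φ t • (iteratedDerivWithin n e J t +
      ∑ i ∈ Finset.range n, iteratedDerivWithin (n - 1 - i)
        (fun s => α (‖errVar φ α J e (i + 1) s‖ ^ 2) • errVar φ α J e (i + 1) s) J t) := by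
  rw [errVar, smul_add, Nat.add_sub_cancel]
  congr 2
  rw [Finset.sum_coe_sort (Finset.Ico 1 (n + 1)) (fun i => iteratedDerivWithin (n - i)
      (fun s => α (‖errVar φ α J e i s‖ ^ 2) • errVar φ α J e i s) J t),
    Finset.sum_Ico_eq_sum_range, Nat.add_sub_cancel]
  refine Finset.sum_congr rfl fun i _ => ?_
  rw [add_comm 1 i, Nat.sub_sub, add_comm 1 i]

/-- Strong induction along the recursion. Only the bounds on the `n` previous signals are required,
so this identity can itself serve to verify the bound on the next one. -/
theorem errVar_eventuallyEq (hφ : ContDiffOn ℝ ∞ φ (Iio T))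
    (hα : ContDiffOn ℝ ((r - 1 : ℕ) : WithTop ℕ∞) α (Ico 0 1)) {J : Set ℝ} (hJ : UniqueDiffOn ℝ J)
    {x : ℝ → JetVec r (Vec m)} (hx : IsJetOn x J) {e : ℝ → Vec m}
    (he : EqOn e (fun s => coordL r (Vec m) 0 (x s)) J) {t₀ : ℝ} (ht₀ : t₀ ∈ J) (n : ℕ)
    (hn : n < r) (hp : (t₀, x t₀) ∈ errDomain φ α T n) :
    errVar φ α J e (n + 1) =ᶠ[𝓝[J] t₀] fun t => errFun φ α n (t, x t) := by
  induction n using Nat.strong_induction_on with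
  | _ n ih =>
    have hg : ∀ i < n, (fun s => α (‖errVar φ α J e (i + 1) s‖ ^ 2) • errVar φ α J e (i + 1) s)
        =ᶠ[𝓝[J] t₀] fun t => gainFun φ α i (t, x t) := by
      intro i hi
      filter_upwards [ih i hi (by omega) (errDomain_anti hi.le hp)] with t ht
      rw [ht, gainFun]
    filter_upwards [sum_iteratedDerivWithin_eventuallyEq hφ hα hJ hx ht₀ n hn hp hg,
      self_mem_nhdsWithin] with t ht htJ
    rw [errVar_succ, ht, hx.iteratedDerivWithin_eqOn hJ he hn htJ, errFun]

end ErrVar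

/-! ### Calculus of functions bounded with a power of the funnel function as weight. -/

section Weighted

variable {F G H : Type*} [NormedAddCommGroup F] [NormedSpace ℝ F] [NormedAddCommGroup G]
  [NormedSpace ℝ G] [NormedAddCommGroup H] [NormedSpace ℝ H]

/-- `φ^{w-j} g^{(j)}` is bounded on `J` for all `j ≤ n`. -/
def WeightedBdd (φ : ℝ → ℝ) (J : Set ℝ) : ℕ → ℤ → (ℝ → F) → Prop
  | 0, w, g => ∃ C, ∀ t ∈ J, φ t ^ w * ‖g t‖ ≤ C
  | n + 1, w, g => (∃ C, ∀ t ∈ J, φ t ^ w * ‖g t‖ ≤ C) ∧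
      ∃ g' : ℝ → F, (∀ t ∈ J, HasDerivWithinAt g (g' t) J t) ∧ WeightedBdd φ J n (w - 1) g'

variable {φ : ℝ → ℝ} {J : Set ℝ}

namespace WeightedBdd

theorem bound {n : ℕ} {w : ℤ} {g : ℝ → F} (h : WeightedBdd φ J n w g) :
    ∃ C, ∀ t ∈ J, φ t ^ w * ‖g t‖ ≤ C := by
  cases n with
  | zero => exact h
  | succ n => exact h.1

theorem of_succ {n : ℕ} {w : ℤ} {g : ℝ → F} (h : WeightedBdd φ J (n + 1) w g) :
    WeightedBdd φ J n w g := by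
  induction n generalizing w g with
  | zero => exact h.1
  | succ n ih =>
    obtain ⟨h1, g', h2, h3⟩ := h
    exact ⟨h1, g', h2, ih h3⟩

theorem of_le {n n' : ℕ} {w : ℤ} {g : ℝ → F} (h : WeightedBdd φ J n w g) (hn : n' ≤ n) :
    WeightedBdd φ J n' w g := by
  induction hn with
  | refl => exact h
  | step _ ih => exact ih h.of_succ

theorem congr {n : ℕ} {w : ℤ} {g g₁ : ℝ → F} (h : WeightedBdd φ J n w g) (he : EqOn g₁ g J) :
    WeightedBdd φ J n w g₁ := by
  have hb : ∃ C, ∀ t ∈ J, φ t ^ w * ‖g₁ t‖ ≤ C := by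
    obtain ⟨C, hC⟩ := h.bound
    exact ⟨C, fun t ht => by rw [he ht]; exact hC t ht⟩
  cases n with
  | zero => exact hb
  | succ n =>
    obtain ⟨-, g', h2, h3⟩ := h
    exact ⟨hb, g', fun t ht => (h2 t ht).congr he (he ht), h3⟩

/-- The weight function is bounded below by `φ₀ > 0`, so a smaller exponent is a weaker condition.
-/
theorem of_weight_le {φ₀ : ℝ} (hφ₀ : 0 < φ₀) (hφ : ∀ t ∈ J, φ₀ ≤ φ t) {n : ℕ} {w w' : ℤ}
    {g : ℝ → F} (h : WeightedBdd φ J n w g) (hw : w' ≤ w) : WeightedBdd φ J n w' g := by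
  have key : ∀ {w w' : ℤ} {g : ℝ → F}, w' ≤ w → (∃ C, ∀ t ∈ J, φ t ^ w * ‖g t‖ ≤ C) →
      ∃ C, ∀ t ∈ J, φ t ^ w' * ‖g t‖ ≤ C := by
    rintro w w' g hw ⟨C, hC⟩
    refine ⟨φ₀ ^ (w' - w) * C, fun t ht => ?_⟩
    have hpos : 0 < φ t := hφ₀.trans_le (hφ t ht)
    have h1 : φ t ^ w' = φ t ^ (w' - w) * φ t ^ w := by
      rw [← zpow_add₀ hpos.ne']; congr 1; ring
    rw [h1, mul_assoc]
    have h2 : φ t ^ (w' - w) ≤ φ₀ ^ (w' - w) := by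
      obtain ⟨k, hk⟩ := Int.eq_ofNat_of_zero_le (sub_nonneg.2 hw)
      have : w' - w = -(k : ℤ) := by omega
      rw [this, zpow_neg, zpow_neg, zpow_natCast, zpow_natCast]
      exact inv_anti₀ (by positivity) (by gcongr; exact hφ t ht)
    exact mul_le_mul h2 (hC t ht) (by positivity) (by positivity)
  induction n generalizing w w' g with
  | zero => exact key hw h
  | succ n ih =>
    obtain ⟨h1, g', h2, h3⟩ := h
    exact ⟨key hw h1, g', h2, ih h3 (by omega)⟩

theorem zero (n : ℕ) (w : ℤ) : WeightedBdd φ J n w (fun _ => (0 : F)) := by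
  induction n generalizing w with
  | zero => exact ⟨0, fun t _ => by simp⟩
  | succ n ih => exact ⟨⟨0, fun t _ => by simp⟩, _, fun t _ => hasDerivWithinAt_const _ _ _, ih _⟩

theorem const (n : ℕ) (a : F) : WeightedBdd φ J n 0 (fun _ => a) := by
  cases n with
  | zero => exact ⟨‖a‖, fun t _ => by simp⟩
  | succ n =>
    exact ⟨⟨‖a‖, fun t _ => by simp⟩, _, fun t _ => hasDerivWithinAt_const _ _ _, zero _ _⟩

theorem add (hφ : ∀ t ∈ J, 0 < φ t) {n : ℕ} {w : ℤ} {f g : ℝ → F} (hf : WeightedBdd φ J n w f)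
    (hg : WeightedBdd φ J n w g) : WeightedBdd φ J n w (fun t => f t + g t) := by
  have key : ∀ {w : ℤ} {f g : ℝ → F}, (∃ C, ∀ t ∈ J, φ t ^ w * ‖f t‖ ≤ C) →
      (∃ C, ∀ t ∈ J, φ t ^ w * ‖g t‖ ≤ C) → ∃ C, ∀ t ∈ J, φ t ^ w * ‖f t + g t‖ ≤ C := by
    rintro w f g ⟨C, hC⟩ ⟨D, hD⟩
    refine ⟨C + D, fun t ht => ?_⟩
    have := hφ t ht
    calc φ t ^ w * ‖f t + g t‖ ≤ φ t ^ w * (‖f t‖ + ‖g t‖) := by gcongr; exact norm_add_le _ _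
      _ ≤ C + D := by rw [mul_add]; exact add_le_add (hC t ht) (hD t ht)
  induction n generalizing w f g with
  | zero => exact key hf hg
  | succ n ih =>
    obtain ⟨h1, f', h2, h3⟩ := hf
    obtain ⟨k1, g', k2, k3⟩ := hg
    exact ⟨key h1 k1, _, fun t ht => (h2 t ht).add (k2 t ht), ih h3 k3⟩

/-- Weights add, and in the Leibniz rule both terms carry the weight `w + w' - 1`, whichever factor
is differentiated. -/
theorem bilinear (hφ : ∀ t ∈ J, 0 < φ t) (B : F →L[ℝ] G →L[ℝ] H) {n : ℕ} {w w' : ℤ} {f : ℝ → F}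
    {g : ℝ → G} (hf : WeightedBdd φ J n w f) (hg : WeightedBdd φ J n w' g) :
    WeightedBdd φ J n (w + w') (fun t => B (f t) (g t)) := by
  have key : ∀ {w w' : ℤ} {f : ℝ → F} {g : ℝ → G}, (∃ C, ∀ t ∈ J, φ t ^ w * ‖f t‖ ≤ C) →
      (∃ C, ∀ t ∈ J, φ t ^ w' * ‖g t‖ ≤ C) →
      ∃ C, ∀ t ∈ J, φ t ^ (w + w') * ‖B (f t) (g t)‖ ≤ C := by
    rintro w w' f g ⟨C, hC⟩ ⟨D, hD⟩
    refine ⟨‖B‖ * (C * D), fun t ht => ?_⟩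
    have hpos := hφ t ht
    have hC0 : 0 ≤ C := le_trans (by positivity) (hC t ht)
    calc φ t ^ (w + w') * ‖B (f t) (g t)‖
        ≤ φ t ^ (w + w') * (‖B‖ * ‖f t‖ * ‖g t‖) := by gcongr; exact B.le_opNorm₂ _ _
      _ = ‖B‖ * ((φ t ^ w * ‖f t‖) * (φ t ^ w' * ‖g t‖)) := by
          rw [zpow_add₀ hpos.ne']; ring
      _ ≤ ‖B‖ * (C * D) := by
          gcongr
          · exact hC t ht
          · exact hD t ht
  induction n generalizing w w' f g with
  | zero => exact key hf hg
  | succ n ih =>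
    have hf0 := hf.of_succ
    have hg0 := hg.of_succ
    obtain ⟨h1, f', h2, h3⟩ := hf
    obtain ⟨k1, g', k2, k3⟩ := hg
    refine ⟨key h1 k1, _, fun t ht => B.hasDerivWithinAt_of_bilinear (h2 t ht) (k2 t ht), ?_⟩
    refine add hφ ?_ ?_
    · have := ih hf0 k3
      rwa [← add_sub_assoc] at this
    · have := ih h3 hg0
      rwa [sub_add_eq_add_sub] at this

theorem smul (hφ : ∀ t ∈ J, 0 < φ t) {n : ℕ} {w w' : ℤ} {f : ℝ → ℝ}
    {g : ℝ → F} (hf : WeightedBdd φ J n w f) (hg : WeightedBdd φ J n w' g) :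
    WeightedBdd φ J n (w + w') (fun t => f t • g t) :=
  bilinear hφ (ContinuousLinearMap.lsmul ℝ ℝ) hf hg

theorem const_smul (hφ : ∀ t ∈ J, 0 < φ t) {n : ℕ} {w : ℤ} {g : ℝ → F}
    (hg : WeightedBdd φ J n w g) (a : ℝ) : WeightedBdd φ J n w (fun t => a • g t) := by
  have := smul hφ (const (φ := φ) (J := J) n a) hg
  rwa [zero_add] at this

theorem sub (hφ : ∀ t ∈ J, 0 < φ t) {n : ℕ} {w : ℤ} {f g : ℝ → F} (hf : WeightedBdd φ J n w f)
    (hg : WeightedBdd φ J n w g) : WeightedBdd φ J n w (fun t => f t - g t) := by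
  refine (add hφ hf (const_smul hφ hg (-1))).congr fun t _ => ?_
  simp [sub_eq_add_neg]

/-- The weight function itself, if `φ' = c φ²`. -/
theorem weight (hφ : ∀ t ∈ J, 0 < φ t) {c : ℝ}
    (hd : ∀ t ∈ J, HasDerivWithinAt φ (c * φ t ^ 2) J t) (n : ℕ) : WeightedBdd φ J n (-1) φ := by
  have hb : ∃ C, ∀ t ∈ J, φ t ^ (-1 : ℤ) * ‖φ t‖ ≤ C := by
    refine ⟨1, fun t ht => ?_⟩
    have := hφ t ht
    rw [Real.norm_of_nonneg this.le, zpow_neg_one, inv_mul_cancel₀ this.ne']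
  induction n with
  | zero => exact hb
  | succ n ih =>
    -- The derivative `c φ²` is a product of two functions of weight `-1`, hence of weight `-2 = -1
    -- - 1`, as required.
    refine ⟨hb, _, hd, ?_⟩
    refine (const_smul hφ (smul hφ ih ih) c).congr fun t _ => ?_
    simp [sq]

/-- The equation `φ' = c φ²` makes `1/φ` affine, with derivative `-c`. -/
theorem inv_weight (hφ : ∀ t ∈ J, 0 < φ t) {c : ℝ}
    (hd : ∀ t ∈ J, HasDerivWithinAt φ (c * φ t ^ 2) J t) (n : ℕ) :
    WeightedBdd φ J n 1 (fun t => (φ t)⁻¹) := by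
  have hb : ∃ C, ∀ t ∈ J, φ t ^ (1 : ℤ) * ‖(φ t)⁻¹‖ ≤ C := by
    refine ⟨1, fun t ht => ?_⟩
    have := hφ t ht
    rw [Real.norm_of_nonneg (by positivity), zpow_one, mul_inv_cancel₀ this.ne']
  cases n with
  | zero => exact hb
  | succ n =>
    refine ⟨hb, fun _ => -c, fun t ht => ?_, const _ _⟩
    have hne := (hφ t ht).ne'
    have := (hd t ht).fun_inv hne
    rwa [show -(c * φ t ^ 2) / φ t ^ 2 = -c by field_simp] at this

/-- Composition with a smooth function on a compact part of its domain. -/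
theorem comp {n : ℕ} {α h : ℝ → ℝ} {ρ : ℝ} (hρ : ρ < 1) (hφ : ∀ t ∈ J, 0 < φ t)
    (hα : ContDiffOn ℝ (n : WithTop ℕ∞) α (Ico 0 1)) (hh : WeightedBdd φ J n 0 h)
    (hr : ∀ t ∈ J, h t ∈ Icc 0 ρ) : WeightedBdd φ J n 0 (fun t => α (h t)) := by
  have hsub : Icc 0 ρ ⊆ Ico (0 : ℝ) 1 := fun s hs => ⟨hs.1, hs.2.trans_lt hρ⟩
  have key : ∀ {α : ℝ → ℝ}, ContinuousOn α (Ico 0 1) →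
      ∃ C, ∀ t ∈ J, φ t ^ (0 : ℤ) * ‖α (h t)‖ ≤ C := by
    intro α hα
    obtain ⟨C, hC⟩ := isCompact_Icc.exists_bound_of_continuousOn (hα.mono hsub)
    exact ⟨C, fun t ht => by rw [zpow_zero, one_mul]; exact hC _ (hr t ht)⟩
  induction n generalizing α with
  | zero => exact key hα.continuousOn
  | succ n ih =>
    have hh0 := hh.of_succ
    obtain ⟨-, h', h2, h3⟩ := hh
    have hu : UniqueDiffOn ℝ (Ico (0 : ℝ) 1) := uniqueDiffOn_Ico 0 1
    have hα' : ContDiffOn ℝ (n : WithTop ℕ∞) (derivWithin α (Ico 0 1)) (Ico 0 1) :=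
      hα.derivWithin hu (by exact_mod_cast le_rfl)
    refine ⟨key hα.continuousOn, fun t => derivWithin α (Ico 0 1) (h t) * h' t, fun t ht => ?_, ?_⟩
    · have hd : DifferentiableWithinAt ℝ α (Ico 0 1) (h t) :=
        (hα.differentiableOn (by simp)) _ (hsub (hr t ht))
      exact hd.hasDerivWithinAt.comp t (h2 t ht) fun s hs => hsub (hr s hs)
    · have := smul hφ (ih hα' hh0) h3
      simpa only [zero_add, smul_eq_mul] using this

/-- Derivatives of weighted bounded functions. -/
theorem deriv (hJ : UniqueDiffOn ℝ J) {n : ℕ} {w : ℤ} {g g' : ℝ → F}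
    (h : WeightedBdd φ J (n + 1) w g) (hg : ∀ t ∈ J, HasDerivWithinAt g (g' t) J t) :
    WeightedBdd φ J n (w - 1) g' := by
  obtain ⟨-, g₁, h2, h3⟩ := h
  exact h3.congr fun t ht => (hJ t ht).eq_deriv _ (hg t ht) (h2 t ht)

end WeightedBdd

end Weighted

/-! ### Properties of the gain and of the funnel function. -/

section Design

theorem ControlDesign.le_α {r : ℕ} {c : ℝ} {α N : ℝ → ℝ} (h : ControlDesign r c α N) {s : ℝ}
    (hs : s ∈ Ico (0 : ℝ) 1) : c * (r + 1) ≤ α s := h.α_bij.mapsTo hs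

/-- A continuous injection on an interval is strictly monotone. A decrease is excluded since the
value `α 0 + 1` is attained at some `s`: if `s ≤ y`, then `α s ≤ α 0`; if `s > y`, then `α`
increases on `[0, s]` and so from `0` to `y`. -/
theorem ControlDesign.strictMonoOn_α {r : ℕ} {c : ℝ} {α N : ℝ → ℝ} (h : ControlDesign r c α N) :
    StrictMonoOn α (Ico 0 1) := by
  have hcont := h.α_smooth.continuousOn
  have h0 : (0 : ℝ) ∈ Ico (0 : ℝ) 1 := by simp
  have hsub : ∀ {z : ℝ}, z ∈ Ico (0 : ℝ) 1 → Icc 0 z ⊆ Ico (0 : ℝ) 1 :=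
    fun hz s hs => ⟨hs.1, hs.2.trans_lt hz.2⟩
  have hmono : ∀ z ∈ Ico (0 : ℝ) 1, α 0 ≤ α z → StrictMonoOn α (Icc 0 z) := fun z hz hle =>
    ContinuousOn.strictMonoOn_of_injOn_Icc hz.1 hle (hcont.mono (hsub hz))
      (h.α_bij.injOn.mono (hsub hz))
  intro x hx y hy hxy
  have hy0 : 0 < y := hx.1.trans_lt hxy
  rcases le_or_gt (α 0) (α y) with hle | hlt
  · exact hmono y hy hle ⟨hx.1, hxy.le⟩ ⟨hy.1, le_rfl⟩ hxy
  · exfalso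
    have hanti : StrictAntiOn α (Icc 0 y) :=
      ContinuousOn.strictAntiOn_of_injOn_Icc hy.1 hlt.le (hcont.mono (hsub hy))
        (h.α_bij.injOn.mono (hsub hy))
    obtain ⟨s, hs, hαs⟩ := h.α_bij.surjOn
      (show α 0 + 1 ∈ Ici (c * (r + 1)) from (h.le_α h0).trans (by linarith))
    rcases le_or_gt s y with hsy | hsy
    · have := hanti.antitoneOn ⟨le_rfl, hy.1⟩ ⟨hs.1, hsy⟩ hs.1
      linarith
    · have := hmono s hs (by linarith) ⟨le_rfl, hs.1⟩ ⟨hy.1, hsy.le⟩ hy0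
      linarith

theorem ControlDesign.exists_α_ge {r : ℕ} {c : ℝ} {α N : ℝ → ℝ} (h : ControlDesign r c α N)
    (A : ℝ) : ∃ s ∈ Ico (0 : ℝ) 1, ∀ s' ∈ Ico (0 : ℝ) 1, s ≤ s' → A ≤ α s' := by
  obtain ⟨s, hs, hαs⟩ := h.α_bij.surjOn (mem_Ici.2 (le_max_right A (c * (r + 1))))
  refine ⟨s, hs, fun s' hs' hle => ?_⟩
  have := h.strictMonoOn_α.monotoneOn hs hs' hle
  rw [hαs] at this
  exact (le_max_left _ _).trans this

theorem contDiffOn_funnelFun (c T : ℝ) : ContDiffOn ℝ ∞ (funnelFun c T) (Iio T) := by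
  unfold funnelFun
  refine contDiffOn_const.mul (contDiffOn_const.div (contDiffOn_const.sub contDiffOn_id) ?_)
  intro t ht
  exact (sub_pos.2 ht).ne'

theorem hasDerivAt_funnelFun {c T t : ℝ} (hc : c ≠ 0) (ht : t < T) :
    HasDerivAt (funnelFun c T) (c * funnelFun c T t ^ 2) t := by
  have hne : T - t ≠ 0 := (sub_pos.2 ht).ne'
  have h1 : HasDerivAt (fun t => T - t) (-1) t := by
    exact (hasDerivAt_id' t).const_sub T
  have h2 := ((h1.fun_inv hne).const_mul (1 / c))
  have h3 : (fun t => 1 / c * (T - t)⁻¹) = funnelFun c T := by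
    funext t
    simp [funnelFun]
  rw [h3] at h2
  refine h2.congr_deriv ?_
  simp only [funnelFun]
  field_simp

theorem funnelFun_pos {c T t : ℝ} (hc : 0 < c) (ht : t < T) : 0 < funnelFun c T t := by
  have := sub_pos.2 ht
  unfold funnelFun
  positivity

theorem funnelFun_ge {c T t : ℝ} (hc : 0 < c) (ht0 : 0 ≤ t) (ht : t < T) :
    1 / (c * T) ≤ funnelFun c T t := by
  have := sub_pos.2 ht
  unfold funnelFun
  rw [one_div_mul_one_div]
  gcongr
  linarith

end Design

/-! ### A priori bounds for the error signals and their derivatives. -/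

section JetEstimates

variable {r : ℕ} {E : Type*} [NormedAddCommGroup E] [InnerProductSpace ℝ E] {c T b : ℝ}
  {α N : ℝ → ℝ} {η : ℝ → JetVec r E}

/-- The differential equation `ė_k = cφ e_k + e_{k+1} - φ γ_k`. -/
theorem hasDerivWithinAt_errFun (hc : 0 < c) (hα : ControlDesign r c α N) {J : Set ℝ}
    (hη : IsJetOn η J) {t : ℝ} (ht : t ∈ J) {k : ℕ} (hk : k + 1 < r)
    (hp : (t, η t) ∈ errDomain (funnelFun c T) α T k) :
    HasDerivWithinAt (fun s => errFun (funnelFun c T) α k (s, η s))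
      ((c * funnelFun c T t) • errFun (funnelFun c T) α k (t, η t) + errFun (funnelFun c T) α
          (k + 1) (t, η t) -
        funnelFun c T t • gainFun (funnelFun c T) α k (t, η t)) J t := by
  have htT : t < T := hp.1
  have h1 := hasDerivWithinAt_corrFun (contDiffOn_funnelFun c T) hα.α_smooth
    (by omega : k < r) (hη.continuousOn t ht) (fun k hk => hη.hasDeriv k hk t ht) hp
  have h2 := (hasDerivAt_funnelFun hc.ne' htT).hasDerivWithinAt.smul
    ((hη.hasDeriv k hk t ht).add h1) (s := J)
  refine h2.congr_deriv ?_
  -- Differentiating the factor `φ` gives `c φ e_k`. In the other term, the block of index `k + 1`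
  -- plus the total derivative equals `e_{k+1}/φ - γ_k` by `corrFun_succ`.
  simp only [errFun, corrFun_succ, Pi.add_apply]
  module

variable (hc : 0 < c) (hr : 0 < r) (hb : 0 < b) (hbT : b ≤ T) (hα : ControlDesign r c α N)
  (hη : IsJetOn η (Ico 0 b)) (hdom : ∀ t ∈ Ico 0 b, (t, η t) ∈ errDomain (funnelFun c T) α T r)

include hc hb hbT hα hη hdom

/-- Half the derivative of `‖e_k‖²` is at most `φ (c - α) ‖e_k‖² + ‖e_k‖`, because `‖e_{k+1}‖ < 1`.
Near the unit sphere `α` is so large that the first term wins. -/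
theorem exists_bound_errFun_lt_one {k : ℕ} (hk : k + 1 < r) :
    ∃ ε < 1, ∀ t ∈ Ico 0 b, ‖errFun (funnelFun c T) α k (t, η t)‖ ^ 2 ≤ ε := by
  have hT : 0 < T := hb.trans_le hbT
  set e : ℝ → E := fun t => errFun (funnelFun c T) α k (t, η t) with he
  have he1 : ∀ t ∈ Ico 0 b, ‖e t‖ < 1 := fun t ht => (hdom t ht).2 k (by omega)
  have he2 : ∀ t ∈ Ico 0 b, ‖errFun (funnelFun c T) α (k + 1) (t, η t)‖ < 1 := fun t ht =>
      (hdom t ht).2 _ hk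
  -- As `φ ≥ 1/(c T)`, this level of `α` gives `φ (α - c) ≥ 2`.
  obtain ⟨s, hs, hsα⟩ := hα.exists_α_ge (c + 2 * (c * T))
  -- The entry `1/4` yields `‖e‖ ≥ 1/2`, so that `2 ‖e‖² ≥ ‖e‖` absorbs the inner product with
  -- `e_{k+1}`.
  set K := max (max s (1 / 4)) (‖e 0‖ ^ 2) with hK
  have h0 : (0 : ℝ) ∈ Ico 0 b := ⟨le_rfl, hb⟩
  have hK1 : K < 1 := max_lt (max_lt hs.2 (by norm_num))
    (pow_lt_one₀ (norm_nonneg _) (he1 0 h0) two_ne_zero)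
  refine ⟨K, hK1, ?_⟩
  have hderiv : ∀ t ∈ Ico 0 b, HasDerivWithinAt (fun t => ‖e t‖ ^ 2) _ (Ico 0 b) t := fun t ht =>
    (hasDerivWithinAt_errFun hc hα hη ht hk (errDomain_anti (by omega : k ≤ r) (hdom t ht))).norm_sq
  refine le_of_deriv_nonpos_above hderiv (le_max_right _ _) ?_
  intro t ht hKt
  have htT : t < T := ht.2.trans_le hbT
  have hφ0 := funnelFun_ge hc ht.1 htT
  have hφ := funnelFun_pos hc htT
  have hVlt : ‖e t‖ ^ 2 < 1 := pow_lt_one₀ (norm_nonneg _) (he1 t ht) two_ne_zero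
  have hαge : c + 2 * (c * T) ≤ α (‖e t‖ ^ 2) :=
    hsα _ ⟨by positivity, hVlt⟩ (le_trans ((le_max_left _ _).trans (le_max_left _ _)) hKt)
  have hhalf : 1 / 2 ≤ ‖e t‖ := by
    have : 1 / 4 ≤ ‖e t‖ ^ 2 := le_trans ((le_max_right _ _).trans (le_max_left _ _)) hKt
    nlinarith [norm_nonneg (e t)]
  have hinner : inner ℝ (e t) (errFun (funnelFun c T) α (k + 1) (t, η t)) ≤ ‖e t‖ := by
    refine (real_inner_le_norm _ _).trans ?_
    nlinarith [norm_nonneg (e t), he2 t ht, norm_nonneg (errFun (funnelFun c T) α (k + 1) (t, η t))]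
  have hexp : inner ℝ (e t) ((c * funnelFun c T t) • e t + errFun (funnelFun c T) α (k + 1) (t, η t) -
      funnelFun c T t • gainFun (funnelFun c T) α k (t, η t)) = funnelFun c T t *
          (c - α (‖e t‖ ^ 2)) * ‖e t‖ ^ 2 +
        inner ℝ (e t) (errFun (funnelFun c T) α (k + 1) (t, η t)) := by
    have hg : gainFun (funnelFun c T) α k (t, η t) = α (‖e t‖ ^ 2) • e t := rfl
    simp only [hg, inner_sub_right, inner_add_right, real_inner_smul_right,
      real_inner_self_eq_norm_sq]
    ring
  change 2 * inner ℝ (e t) ((c * funnelFun c T t) • e t + errFun (funnelFun c T) α (k + 1) (t, η t) -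
      funnelFun c T t • gainFun (funnelFun c T) α k (t, η t)) ≤ 0
  rw [hexp]
  have h1 : 2 ≤ funnelFun c T t * (α (‖e t‖ ^ 2) - c) := by
    calc (2 : ℝ) = 1 / (c * T) * (2 * (c * T)) := by field_simp
      _ ≤ funnelFun c T t * (α (‖e t‖ ^ 2) - c) := by
        gcongr
        linarith
  have h2 : 2 * ‖e t‖ ^ 2 ≤ funnelFun c T t * (α (‖e t‖ ^ 2) - c) * ‖e t‖ ^ 2 := by gcongr
  nlinarith

/-- Downward induction from the last signal: for `w = φ^{j+1} e_k` one has `w' = φ ((c (j+2) - α) w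
+ φ^j e_{k+1})`. If `‖φ^j e_{k+1}‖ ≤ B`, then `‖w‖` cannot grow once it is at least `B / c`. -/
theorem exists_bound_weighted_errFun (j : ℕ) (hj : j < r) :
    ∃ C, ∀ t ∈ Ico 0 b, funnelFun c T t ^ j * ‖errFun (funnelFun c T) α (r - 1 - j) (t, η t)‖ ≤ C
        := by
  induction j with
  | zero =>
    refine ⟨1, fun t ht => ?_⟩
    rw [pow_zero, one_mul]
    exact ((hdom t ht).2 _ (by omega)).le
  | succ j ih =>
    obtain ⟨B, hB⟩ := ih (by omega)
    have hB0 : 0 ≤ B := le_trans (mul_nonneg (pow_nonneg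
      (funnelFun_pos hc (hb.trans_le hbT)).le _) (norm_nonneg _)) (hB 0 ⟨le_rfl, hb⟩)
    set k := r - 1 - (j + 1) with hk
    have hk1 : k + 1 < r := by omega
    have hk2 : r - 1 - j = k + 1 := by omega
    rw [hk2] at hB
    set e : ℝ → E := fun t => errFun (funnelFun c T) α k (t, η t) with he
    set w : ℝ → E := fun t => funnelFun c T t ^ (j + 1) • e t with hw
    set K := max (‖w 0‖ ^ 2) ((B / c) ^ 2) with hK
    have hderiv : ∀ t ∈ Ico 0 b, HasDerivWithinAt w
        (funnelFun c T t ^ (j + 1) • ((c * funnelFun c T t) • e t + errFun (funnelFun c T) α (k + 1)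
            (t, η t) -
          funnelFun c T t • gainFun (funnelFun c T) α k (t, η t)) +
          (((j + 1 : ℕ) : ℝ) * funnelFun c T t ^ j * (c * funnelFun c T t ^ 2)) • e t) (Ico 0 b) t
              := fun t ht => by
      have h1 := ((hasDerivAt_funnelFun hc.ne' (ht.2.trans_le hbT)).fun_pow
          (j + 1)).hasDerivWithinAt
        (s := Ico 0 b)
      exact h1.fun_smul
        (hasDerivWithinAt_errFun hc hα hη ht hk1 (errDomain_anti (by omega : k ≤ r) (hdom t ht)))
    have key : ∀ t ∈ Ico 0 b, ‖w t‖ ^ 2 ≤ K := by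
      refine le_of_deriv_nonpos_above (fun t ht => (hderiv t ht).norm_sq) (le_max_left _ _) ?_
      intro t ht hKt
      have hφ := funnelFun_pos hc (ht.2.trans_le hbT)
      have hα1 : c * (r + 1) ≤ α (‖e t‖ ^ 2) := hα.le_α ⟨by positivity,
        pow_lt_one₀ (norm_nonneg _) ((hdom t ht).2 k (by omega)) two_ne_zero⟩
      have hexp : funnelFun c T t ^ (j + 1) •
          ((c * funnelFun c T t) • e t + errFun (funnelFun c T) α (k + 1) (t, η t) -
          funnelFun c T t • gainFun (funnelFun c T) α k (t, η t)) +
          (((j + 1 : ℕ) : ℝ) * funnelFun c T t ^ j * (c * funnelFun c T t ^ 2)) • e t =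
          (funnelFun c T t * (c * (j + 2) - α (‖e t‖ ^ 2))) • w t +
            funnelFun c T t • (funnelFun c T t ^ j • errFun (funnelFun c T) α (k + 1) (t, η t))
                := by
        have hg : gainFun (funnelFun c T) α k (t, η t) = α (‖e t‖ ^ 2) • e t := rfl
        simp only [hg, hw, pow_succ]
        push_cast
        module
      rw [hexp, inner_add_right, real_inner_smul_right (w t) (w t),
        real_inner_smul_right (w t) (_ • _), real_inner_self_eq_norm_sq]
      have hin : inner ℝ (w t) (funnelFun c T t ^ j • errFun (funnelFun c T) α (k + 1) (t, η t)) ≤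
          ‖w t‖ * B := by
        refine (real_inner_le_norm _ _).trans ?_
        gcongr
        rw [norm_smul, norm_pow, Real.norm_of_nonneg hφ.le]
        exact hB t ht
      -- This is where the lower bound `c (r + 1)` for the gain is needed: `j + 2 ≤ r` leaves a
      -- surplus damping of at least `c`.
      have hrj : c * (j + 2) - α (‖e t‖ ^ 2) ≤ -c := by
        have : (j : ℝ) + 2 ≤ r := by exact_mod_cast (by omega : j + 2 ≤ r)
        nlinarith
      have hwB : B ≤ c * ‖w t‖ := by
        have h1 : (B / c) ^ 2 ≤ ‖w t‖ ^ 2 := (le_max_right _ _).trans hKt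
        have h2 := abs_le_of_sq_le_sq h1 (norm_nonneg _)
        rw [← div_le_iff₀' hc]
        exact (le_abs_self _).trans (by simpa using h2)
      have h3 : funnelFun c T t * (c * (j + 2) - α (‖e t‖ ^ 2)) * ‖w t‖ ^ 2 ≤ funnelFun c T t * (-c)
          * ‖w t‖ ^ 2 := by
        gcongr
      have h4 : funnelFun c T t * inner ℝ (w t)
          (funnelFun c T t ^ j • errFun (funnelFun c T) α (k + 1) (t, η t)) ≤
          funnelFun c T t * (‖w t‖ * (c * ‖w t‖)) := by
        gcongr
        exact hin.trans (by gcongr)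
      nlinarith
    refine ⟨Real.sqrt K, fun t ht => ?_⟩
    have h1 : ‖w t‖ = funnelFun c T t ^ (j + 1) * ‖e t‖ := by
      rw [hw, norm_smul, norm_pow, Real.norm_of_nonneg (funnelFun_pos hc (ht.2.trans_le hbT)).le]
    rw [← h1]
    exact Real.le_sqrt_of_sq_le (key t ht)

/-- Since `‖e_k‖²` stays in a compact part of `[0,1)`, the factor `α(‖e_k‖²)` has weight zero, and
`γ_k` inherits the weight of `e_k`. -/
theorem weightedBdd_gainFun {n k : ℕ} (hk : k + 1 < r) (hn : n ≤ r - 1)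
    (he : WeightedBdd (funnelFun c T) (Ico 0 b) n ((r : ℤ) - 1 - k)
        (fun t => errFun (funnelFun c T) α k (t, η t))) :
    WeightedBdd (funnelFun c T) (Ico 0 b) n ((r : ℤ) - 1 - k)
        (fun t => gainFun (funnelFun c T) α k (t, η t)) := by
  have hφ : ∀ t ∈ Ico 0 b, 0 < funnelFun c T t := fun t ht => funnelFun_pos hc (ht.2.trans_le hbT)
  obtain ⟨ε, hε, hbd⟩ := exists_bound_errFun_lt_one hc hb hbT hα hη hdom hk
  have hT : 0 < T := hb.trans_le hbT
  have hsq := WeightedBdd.bilinear hφ (innerSL ℝ (E := E)) he he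
  have hsq' : WeightedBdd (funnelFun c T) (Ico 0 b) n 0
      (fun t => ‖errFun (funnelFun c T) α k (t, η t)‖ ^ 2) := by
    refine ((hsq.of_weight_le (φ₀ := 1 / (c * T)) (by positivity)
      (fun t ht => funnelFun_ge hc ht.1 (ht.2.trans_le hbT)) (by omega)).congr fun t _ => ?_)
    exact (real_inner_self_eq_norm_sq _).symm
  have hcomp := WeightedBdd.comp hε hφ (hα.α_smooth.of_le (by exact_mod_cast hn)) hsq'
    fun t ht => ⟨by positivity, hbd t ht⟩
  have := WeightedBdd.smul hφ hcomp he
  rwa [zero_add] at this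

/-- A bootstrap: the differential equation expresses `ė_k` through `φ e_k`, `φ γ_k` and `e_{k+1}`,
all of weight one less than `e_k`. -/
theorem weightedBdd_errFun (j : ℕ) (hj : j < r) :
    WeightedBdd (funnelFun c T) (Ico 0 b) j j
        (fun t => errFun (funnelFun c T) α (r - 1 - j) (t, η t)) := by
  have hφ : ∀ t ∈ Ico 0 b, 0 < funnelFun c T t := fun t ht => funnelFun_pos hc (ht.2.trans_le hbT)
  have hbd := exists_bound_weighted_errFun hc hb hbT hα hη hdom
  have hwt := WeightedBdd.weight hφ
    fun t ht => (hasDerivAt_funnelFun hc.ne' (ht.2.trans_le hbT)).hasDerivWithinAt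
  induction j with
  | zero =>
    obtain ⟨C, hC⟩ := hbd 0 hj
    exact ⟨C, fun t ht => by simpa using hC t ht⟩
  | succ j ih =>
    have ih := ih (by omega)
    set k := r - 1 - (j + 1) with hk
    have hk2 : r - 1 - j = k + 1 := by omega
    have hkz : ((r : ℤ) - 1 - k) = ((j + 1 : ℕ) : ℤ) := by omega
    rw [hk2] at ih
    have hb0 : ∃ C, ∀ t ∈ Ico 0 b, funnelFun c T t ^ ((j + 1 : ℕ) : ℤ) * ‖errFun (funnelFun c T) α k
        (t, η t)‖ ≤ C := by
      simpa only [zpow_natCast] using hbd (j + 1) hj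
    -- The inner induction gains one derivative of `e_k` at a time, while those of `e_{k+1}` are
    -- known from the outer one.
    suffices h : ∀ n ≤ j + 1, WeightedBdd (funnelFun c T) (Ico 0 b) n ((j + 1 : ℕ) : ℤ)
        (fun t => errFun (funnelFun c T) α k (t, η t)) from h _ le_rfl
    intro n
    induction n with
    | zero => exact fun _ => hb0
    | succ n ihn =>
      intro hn
      have ihn := ihn (by omega)
      refine ⟨hb0, _, fun t ht => hasDerivWithinAt_errFun hc hα hη ht (by omega)
        (errDomain_anti (by omega : k ≤ r) (hdom t ht)), ?_⟩
      have hg := weightedBdd_gainFun hc hb hbT hα hη hdom (k := k) (n := n) (by omega) (by omega)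
        (by rwa [hkz])
      rw [hkz] at hg
      have e1 : ((j + 1 : ℕ) : ℤ) - 1 = j := by omega
      have e2 : (-1 : ℤ) + ((j + 1 : ℕ) : ℤ) = j := by omega
      rw [e1]
      refine WeightedBdd.sub hφ (WeightedBdd.add hφ ?_ (ih.of_le (by omega))) ?_
      · have := WeightedBdd.smul hφ (WeightedBdd.const_smul hφ (hwt n) c) ihn
        rwa [e2] at this
      · have := WeightedBdd.smul hφ (hwt n) hg
        rwa [e2] at this

/-- In `corrFun_succ` the total derivative lowers the weight `r - k` by one, to the weight of
`gainFun k`. -/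
theorem weightedBdd_corrFun (k : ℕ) (hk : k < r) :
    WeightedBdd (funnelFun c T) (Ico 0 b) (r - k) ((r : ℤ) - k)
        (fun t => corrFun (funnelFun c T) α k (t, η t)) := by
  have hφ : ∀ t ∈ Ico 0 b, 0 < funnelFun c T t := fun t ht => funnelFun_pos hc (ht.2.trans_le hbT)
  induction k with
  | zero => exact WeightedBdd.zero _ _
  | succ k ih =>
    have ih := ih (by omega)
    have he := weightedBdd_errFun hc hb hbT hα hη hdom (r - 1 - k) (by omega)
    have e1 : r - 1 - (r - 1 - k) = k := by omega
    have e2 : ((r - 1 - k : ℕ) : ℤ) = (r : ℤ) - 1 - k := by omega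
    rw [e1, e2] at he
    have hg := weightedBdd_gainFun hc hb hbT hα hη hdom hk (by omega) he
    have e3 : r - k = (r - 1 - k) + 1 := by omega
    rw [e3] at ih
    have hd := ih.deriv (uniqueDiffOn_Ico 0 b) fun t ht =>
      hasDerivWithinAt_corrFun (contDiffOn_funnelFun c T) hα.α_smooth (by omega : k < r)
        (hη.continuousOn t ht) (fun k hk => hη.hasDeriv k hk t ht)
        (errDomain_anti (by omega : k ≤ r) (hdom t ht))
    have e4 : r - (k + 1) = r - 1 - k := by omega
    have e5 : (r : ℤ) - ((k + 1 : ℕ) : ℤ) = r - 1 - k := by omega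
    have e6 : (r : ℤ) - k - 1 = r - 1 - k := by omega
    rw [e4, e5]
    rw [e6] at hd
    exact WeightedBdd.add hφ hd hg

/-- The error itself is `e_1 / φ`, of weight `1 + (r - 1)`, and every differentiation lowers the
weight by one. -/
theorem weightedBdd_coordL (k : ℕ) (hk : k < r) :
    WeightedBdd (funnelFun c T) (Ico 0 b) (r - 1 - k) ((r : ℤ) - k) (fun t => coordL r E k (η t))
        := by
  have hφ : ∀ t ∈ Ico 0 b, 0 < funnelFun c T t := fun t ht => funnelFun_pos hc (ht.2.trans_le hbT)
  induction k with
  | zero =>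
    have he := weightedBdd_errFun hc hb hbT hα hη hdom (r - 1) (by omega)
    have hinv := WeightedBdd.inv_weight hφ (fun t ht => (hasDerivAt_funnelFun hc.ne'
      (ht.2.trans_le hbT)).hasDerivWithinAt) (r - 1)
    have h := WeightedBdd.smul hφ hinv he
    have e1 : (1 : ℤ) + ((r - 1 : ℕ) : ℤ) = r - (0 : ℕ) := by omega
    rw [e1] at h
    refine h.congr fun t ht => ?_
    have := (hφ t ht).ne'
    simp [errFun, corrFun, smul_smul, this]
  | succ k ih =>
    have ih := ih (by omega)
    have e1 : r - 1 - k = (r - 1 - (k + 1)) + 1 := by omega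
    rw [e1] at ih
    have hd := ih.deriv (uniqueDiffOn_Ico 0 b) fun t ht => hη.hasDeriv k hk t ht
    have e2 : (r : ℤ) - k - 1 = r - ((k + 1 : ℕ) : ℤ) := by omega
    rwa [e2] at hd

include hr in
-- The weight has dropped exactly to zero, so this derivative is a bounded perturbation in the
-- equation for the last signal.
theorem exists_bound_totalDeriv_corrFun :
    ∃ C, ∀ t ∈ Ico 0 b, ‖totalDeriv (corrFun (funnelFun c T) α (r - 1)) (t, η t)‖ ≤ C := by
  have h := weightedBdd_corrFun hc hb hbT hα hη hdom (r - 1) (by omega)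
  have e1 : r - (r - 1) = 0 + 1 := by omega
  rw [e1] at h
  have hd := h.deriv (uniqueDiffOn_Ico 0 b) fun t ht =>
      hasDerivWithinAt_corrFun (contDiffOn_funnelFun c T) hα.α_smooth (by omega : r - 1 < r)
        (hη.continuousOn t ht) (fun k hk => hη.hasDeriv k hk t ht)
        (errDomain_anti (by omega : r - 1 ≤ r) (hdom t ht))
  have e2 : (r : ℤ) - ((r - 1 : ℕ) : ℤ) - 1 = 0 := by omega
  rw [e2] at hd
  obtain ⟨C, hC⟩ := hd
  exact ⟨C, fun t ht => by simpa using hC t ht⟩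

/-- The derivatives of the error are `O(T - t)`. -/
theorem exists_bound_coordL {k : ℕ} (hk : k < r) :
    ∃ C, ∀ t ∈ Ico 0 b, ‖coordL r E k (η t)‖ ≤ C * (T - t) := by
  have hT : 0 < T := hb.trans_le hbT
  -- The weight `r - k` is at least one and may be lowered to one, where `1/φ = c (T - t)`.
  obtain ⟨C, hC⟩ := ((weightedBdd_coordL hc hb hbT hα hη hdom k hk).of_weight_le
    (φ₀ := 1 / (c * T)) (by positivity) (fun t ht => funnelFun_ge hc ht.1 (ht.2.trans_le hbT))
    (w' := 1) (by omega)).bound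
  refine ⟨C * c, fun t ht => ?_⟩
  have h := hC t ht
  have hpos : 0 < T - t := sub_pos.2 (ht.2.trans_le hbT)
  have h2 : ‖coordL r E k (η t)‖ = (c * (T - t)) *
      (funnelFun c T t ^ (1 : ℤ) * ‖coordL r E k (η t)‖) := by
    rw [zpow_one, funnelFun]
    field_simp
  rw [h2]
  calc (c * (T - t)) * (funnelFun c T t ^ (1 : ℤ) * ‖coordL r E k (η t)‖)
      ≤ (c * (T - t)) * C := by gcongr
    _ = C * c * (T - t) := by ring

end JetEstimates

/-! ### Measurability and a.e. equality along stopped paths. -/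

section Composition

theorem ContinuousOn.comp_aestronglyMeasurable_of_mem {A Y W : Type*} [MeasurableSpace A]
    [NormedAddCommGroup Y] [SecondCountableTopology Y] [NormedAddCommGroup W] {μ : Measure A}
    {G : Y → W} {S : Set Y} (hG : ContinuousOn G S) (hS : IsOpen S) {g : A → Y}
    (hg : AEStronglyMeasurable g μ) (h : ∀ᵐ a ∂μ, g a ∈ S) :
    AEStronglyMeasurable (fun a => G (g a)) μ := by
  borelize Y
  have h1 : (μ.map g).restrict S = μ.map g := by
    rw [Measure.restrict_eq_self_of_ae_mem]
    exact (ae_map_iff hg.aemeasurable hS.measurableSet).2 h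
  have h2 : AEStronglyMeasurable G (μ.map g) := h1 ▸ hG.aestronglyMeasurable hS.measurableSet
  exact h2.comp_aemeasurable hg.aemeasurable

theorem ae_restrict_mono_Ico {a b a' b' : ℝ} {P : ℝ → Prop} (ha : a ≤ a') (hb : b' ≤ b)
    (h : ∀ᵐ s ∂(volume.restrict (Ico a b)), P s) : ∀ᵐ s ∂(volume.restrict (Icc a' b')), P s := by
  rw [← restrict_Ico_eq_restrict_Icc]
  exact ae_restrict_of_ae_restrict_of_subset (Ico_subset_Ico ha hb) h

theorem integral_congr_of_ae_Ico {Y : Type*} [NormedAddCommGroup Y] [NormedSpace ℝ Y]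
    {F F' : ℝ → Y} {a b s t : ℝ} (has : a ≤ s) (hst : s ≤ t) (htb : t ≤ b)
    (h : ∀ᵐ τ ∂(volume.restrict (Ico a b)), F τ = F' τ) :
    ∫ τ in s..t, F τ = ∫ τ in s..t, F' τ := by
  rw [intervalIntegral.integral_of_le hst, intervalIntegral.integral_of_le hst]
  refine integral_congr_ae ?_
  have := ae_restrict_mono_Ico has htb h
  rwa [← restrict_Ioc_eq_restrict_Icc] at this

theorem continuousOn_stopAt {X : Type*} [TopologicalSpace X] {x : ℝ → X} {σ b : ℝ}
    (hσb : -σ ≤ b) (hx : ContinuousOn x (Icc (-σ) b)) : ContinuousOn (fun t => x (min t b))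
        (Ici (-σ)) := by
  refine hx.comp (continuous_id.min continuous_const).continuousOn fun t ht =>
      ⟨le_min ht hσb, min_le_right _ _⟩

end Composition

/-! ### Solutions of causal functional differential equations on an open domain. -/

section PathSolution

variable {P Z X : Type*} [NormedAddCommGroup P] [NormedAddCommGroup Z]
  [NormedAddCommGroup X] [NormedSpace ℝ X]

/-- `x` solves the functional differential equation `x'(t) = G (d(t), Op(x)(t), t, x(t))` on
`[-σ,b]` with initial path `x₀` on `[-σ,0]`, staying in `Ω` from time `0` on. -/
structure IsPathSolution (σ : ℝ) (d : ℝ → P) (Op : (ℝ → X) → ℝ → Z) (G : P × Z × ℝ × X → X)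
    (Ω : Set (ℝ × X)) (x₀ : ℝ → X) (b : ℝ) (x : ℝ → X) : Prop where
  nonneg : 0 ≤ b
  continuousOn : ContinuousOn x (Icc (-σ) b)
  initial : EqOn x x₀ (Icc (-σ) 0)
  mem : ∀ t ∈ Icc 0 b, (t, x t) ∈ Ω
  equation : ∀ t ∈ Icc 0 b, x t = x 0 + ∫ s in (0 : ℝ)..t, G (d s, Op (stopAt x b) s, s, x s)

variable {σ : ℝ} {d : ℝ → P} {Op : (ℝ → X) → ℝ → Z} {G : P × Z × ℝ × X → X} {Ω : Set (ℝ × X)}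
  {x₀ : ℝ → X}

/-- Before time `a` neither stopping is visible, so causality makes the operator values independent
of the stopping times. -/
theorem OperatorClass.stopAt_ae_eq (hOp : OperatorClass σ Op) (hσ : 0 < σ) {x x' : ℝ → X}
    {a b b' : ℝ} (ha : 0 ≤ a) (hab : a ≤ b) (hab' : a ≤ b') (hx : ContinuousOn x (Icc (-σ) b))
    (hx' : ContinuousOn x' (Icc (-σ) b')) (h : EqOn x x' (Ico (-σ) a)) :
    ∀ᵐ s ∂(volume.restrict (Ico 0 a)), Op (stopAt x b) s = Op (stopAt x' b') s := by
  refine hOp.causal a ha _ _ (continuousOn_stopAt (by linarith) hx)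
    (continuousOn_stopAt (by linarith) hx') fun t ht => ?_
  simp only [stopAt]
  rw [min_eq_left (ht.2.le.trans hab), min_eq_left (ht.2.le.trans hab')]
  exact h ht

theorem IsPathSolution.congr_of_le (hOp : OperatorClass σ Op) (hσ : 0 < σ) {x x' : ℝ → X}
    {b b' : ℝ} (h : IsPathSolution σ d Op G Ω x₀ b x) (hb' : 0 ≤ b') (hbb : b' ≤ b)
    (hxx : EqOn x x' (Icc (-σ) b')) : IsPathSolution σ d Op G Ω x₀ b' x' := by
  have hc : ContinuousOn x' (Icc (-σ) b') :=
    (h.continuousOn.mono (Icc_subset_Icc_right hbb)).congr hxx.symm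
  refine ⟨hb', hc, ?_, ?_, ?_⟩
  · exact fun t ht => (hxx ⟨ht.1, ht.2.trans hb'⟩).symm.trans (h.initial ht)
  · intro t ht
    rw [← hxx ⟨by linarith [ht.1], ht.2⟩]
    exact h.mem t ⟨ht.1, ht.2.trans hbb⟩
  · intro t ht
    rw [← hxx ⟨by linarith [ht.1], ht.2⟩, ← hxx ⟨by linarith [ht.1], hb'⟩,
      h.equation t ⟨ht.1, ht.2.trans hbb⟩]
    congr 1
    refine integral_congr_of_ae_Ico le_rfl ht.1 ht.2 ?_
    filter_upwards [hOp.stopAt_ae_eq hσ hb' hbb le_rfl h.continuousOn hc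
      (hxx.mono Ico_subset_Icc_self), ae_restrict_mem measurableSet_Ico] with s hs hs'
    rw [hs, hxx ⟨by linarith [hs'.1], hs'.2.le⟩]

/-- On `[0,b]`, the operator in the integral equation can be evaluated along any continuation. -/
theorem IsPathSolution.equation_of_le (hOp : OperatorClass σ Op) (hσ : 0 < σ) {x : ℝ → X}
    {b b' : ℝ} (h : IsPathSolution σ d Op G Ω x₀ b x) (hx : ContinuousOn x (Icc (-σ) b'))
    (hbb : b ≤ b') : ∀ t ∈ Icc 0 b,
      x t = x 0 + ∫ s in (0 : ℝ)..t, G (d s, Op (stopAt x b') s, s, x s) := by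
  intro t ht
  rw [h.equation t ht]
  congr 1
  refine integral_congr_of_ae_Ico le_rfl ht.1 ht.2 ?_
  filter_upwards [hOp.stopAt_ae_eq hσ h.nonneg le_rfl hbb h.continuousOn hx fun _ _ => rfl]
    with s hs
  rw [hs]

variable [ProperSpace P] [ProperSpace Z] [FiniteDimensional ℝ X]

theorem MeasureTheory.MemLp.exists_ae_bound {A Y : Type*} [MeasurableSpace A]
    [NormedAddCommGroup Y] {μ : Measure A} {g : A → Y} (hg : MemLp g ⊤ μ) :
    ∃ C, ∀ᵐ a ∂μ, ‖g a‖ ≤ C := by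
  refine ⟨(eLpNormEssSup g μ).toReal, ?_⟩
  have hfin : eLpNormEssSup g μ ≠ ⊤ := by
    rw [← eLpNorm_exponent_top]
    exact hg.2.ne
  filter_upwards [ae_le_eLpNormEssSup (f := g) (μ := μ)] with a ha
  rw [← toReal_enorm]
  exact ENNReal.toReal_mono hfin ha

/-- The disturbance and the operator values remain in fixed balls. `M` is chosen before the path
`ξ`, and the exceptional null set does not depend on `v`. -/
theorem exists_uniform_bound_rhs (hOp : OperatorClass σ Op)
    (hd : MemLp d ⊤ (volume.restrict (Ici 0))) (hG : ContinuousOn G {p | p.2.2 ∈ Ω})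
    {K : Set (ℝ × X)} (hK : IsCompact K) (hKΩ : K ⊆ Ω) {C : ℝ} (hC : 0 < C) :
    ∃ M, 0 ≤ M ∧ ∀ ξ : ℝ → X, ContinuousOn ξ (Ici (-σ)) → (∀ t ∈ Ici (-σ), ‖ξ t‖ ≤ C) →
      ∀ᵐ s ∂(volume.restrict (Ici 0)), ∀ v, (s, v) ∈ K → ‖G (d s, Op ξ s, s, v)‖ ≤ M := by
  obtain ⟨C₂, -, hC₂⟩ := hOp.bibo C hC
  obtain ⟨C₁, hC₁⟩ := hd.exists_ae_bound
  have hcomp : IsCompact (Metric.closedBall (0 : P) C₁ ×ˢ Metric.closedBall (0 : Z) C₂ ×ˢ K) :=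
    (isCompact_closedBall _ _).prod ((isCompact_closedBall _ _).prod hK)
  obtain ⟨M, hM⟩ := hcomp.exists_bound_of_continuousOn (hG.mono fun p hp => hKΩ hp.2.2)
  refine ⟨max M 0, le_max_right _ _, fun ξ hξ hb => ?_⟩
  filter_upwards [hC₁, hC₂ ξ hξ hb] with s h1 h2 v hv
  exact (hM _ ⟨by simpa using h1, by simpa using h2, hv⟩).trans (le_max_left _ _)

theorem aestronglyMeasurable_rhs (hOp : OperatorClass σ Op)
    (hd : MemLp d ⊤ (volume.restrict (Ici 0))) (hΩ : IsOpen Ω)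
    (hG : ContinuousOn G {p | p.2.2 ∈ Ω}) {ξ x : ℝ → X} {a b : ℝ} (ha : 0 ≤ a)
    (hξ : ContinuousOn ξ (Ici (-σ))) (hx : ContinuousOn x (Icc a b))
    (hmem : ∀ t ∈ Icc a b, (t, x t) ∈ Ω) :
    AEStronglyMeasurable (fun s => G (d s, Op ξ s, s, x s)) (volume.restrict (Icc a b)) := by
  have : ProperSpace X := FiniteDimensional.proper ℝ X
  have hS : IsOpen {p : P × Z × ℝ × X | p.2.2 ∈ Ω} :=
    hΩ.preimage (continuous_snd.comp continuous_snd)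
  refine hG.comp_aestronglyMeasurable_of_mem hS ?_ ?_
  · have hsub : Icc a b ⊆ Ici 0 := fun s hs => ha.trans hs.1
    have hsub' : Icc a b ⊆ Icc 0 b := Icc_subset_Icc_left ha
    exact (hd.1.mono_measure (Measure.restrict_mono hsub le_rfl)).prodMk
      (((hOp.locBdd _ hξ b).1.mono_measure (Measure.restrict_mono hsub' le_rfl)).prodMk
        ((continuousOn_id.prodMk hx).aestronglyMeasurable measurableSet_Icc))
  · filter_upwards [ae_restrict_mem measurableSet_Icc] with s hs using hmem s hs

/-- Along a continuous path with graph in `Ω`, the right-hand side is integrable. -/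
theorem intervalIntegrable_rhs (hOp : OperatorClass σ Op) (hσ : 0 < σ)
    (hd : MemLp d ⊤ (volume.restrict (Ici 0))) (hΩ : IsOpen Ω)
    (hG : ContinuousOn G {p | p.2.2 ∈ Ω}) {x : ℝ → X} {b : ℝ} (hb : 0 ≤ b)
    (hx : ContinuousOn x (Icc (-σ) b)) (hmem : ∀ t ∈ Icc 0 b, (t, x t) ∈ Ω) :
    IntervalIntegrable (fun s => G (d s, Op (stopAt x b) s, s, x s)) volume 0 b := by
  have hsub : Icc 0 b ⊆ Icc (-σ) b := Icc_subset_Icc_left (by linarith)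
  have hstopped := continuousOn_stopAt (by linarith : -σ ≤ b) hx
  have hxm : ContinuousOn (fun s => (s, x s)) (Icc 0 b) := continuousOn_id.prodMk (hx.mono hsub)
  obtain ⟨C₁, hC₁⟩ := isCompact_Icc.exists_bound_of_continuousOn hx
  obtain ⟨M, -, hM⟩ := exists_uniform_bound_rhs hOp hd hG (isCompact_Icc.image_of_continuousOn hxm)
    (by rintro _ ⟨t, ht, rfl⟩; exact hmem t ht) (C := max C₁ 1) (by positivity)
  refine intervalIntegrable_of_ae_bound (M := M) hb
    (aestronglyMeasurable_rhs hOp hd hΩ hG le_rfl hstopped (hx.mono hsub) hmem) ?_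
  have h1 := hM (stopAt x b) hstopped fun t ht =>
      (hC₁ _ ⟨le_min ht (by linarith), min_le_right _ _⟩).trans (le_max_left _ _)
  filter_upwards [ae_restrict_of_ae_restrict_of_subset Icc_subset_Ici_self h1,
    ae_restrict_mem measurableSet_Icc] with s h1 hs
  exact h1 _ ⟨s, hs, rfl⟩

/-- The integral equation holds before `b` by causality, and both sides are continuous up to `b`,
where the limit has been inserted as the value. -/
theorem IsPathSolution.of_tendsto (hOp : OperatorClass σ Op) (hσ : 0 < σ)
    (hd : MemLp d ⊤ (volume.restrict (Ici 0))) (hΩ : IsOpen Ω)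
    (hG : ContinuousOn G {p | p.2.2 ∈ Ω}) {x : ℝ → X} {b : ℝ} (hb : 0 < b)
    (h : ∀ b' ∈ Ico 0 b, IsPathSolution σ d Op G Ω x₀ b' x) {l : X}
    (hl : Tendsto x (𝓝[<] b) (𝓝 l)) (hmem : (b, l) ∈ Ω) :
    IsPathSolution σ d Op G Ω x₀ b (Function.update x b l) := by
  set x' := Function.update x b l with hx'
  have hxx : ∀ t, t < b → x' t = x t := fun t ht => Function.update_of_ne ht.ne _ _
  have hc0 : ContinuousOn x (Ico (-σ) b) := by
    intro t ht
    obtain ⟨b', hb', hbb⟩ := exists_between (max_lt ht.2 hb)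
    have := (h b' ⟨(le_max_right _ _).trans hb'.le, hbb⟩).continuousOn t
      ⟨ht.1, (le_max_left _ _).trans hb'.le⟩
    refine this.mono_of_mem_nhdsWithin ?_
    rw [← Ici_inter_Iic, ← Ici_inter_Iio]
    exact mem_of_superset (inter_mem_nhdsWithin _ (Iic_mem_nhds ((le_max_left _ _).trans_lt hb')))
      (fun s hs => ⟨hs.1.1, hs.2⟩)
  have hc : ContinuousOn x' (Icc (-σ) b) := by
    rw [hx', continuousOn_update_iff, Icc_sdiff_right]
    refine ⟨hc0, fun _ => ?_⟩
    rwa [nhdsWithin_Ico_eq_nhdsLT (by linarith)]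
  have hm : ∀ t ∈ Icc 0 b, (t, x' t) ∈ Ω := by
    intro t ht
    rcases ht.2.eq_or_lt with rfl | hlt
    · simpa [hx'] using hmem
    · rw [hxx t hlt]
      exact (h t ⟨ht.1, hlt⟩).mem t ⟨ht.1, le_rfl⟩
  have hsub : Icc 0 b ⊆ Icc (-σ) b := Icc_subset_Icc_left (by linarith)
  have hint := intervalIntegrable_rhs hOp hσ hd hΩ hG hb.le hc hm
  refine ⟨hb.le, hc, fun t ht => ?_, hm, ?_⟩
  · rw [hxx t (ht.2.trans_lt hb)]
    exact (h 0 ⟨le_rfl, hb⟩).initial ht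
  · have hcont : ContinuousOn (fun t => x' 0 + ∫ s in (0 : ℝ)..t, G
        (d s, Op (stopAt x' b) s, s, x' s))
        (Icc 0 b) := by
      refine continuousOn_const.add ?_
      have := intervalIntegral.continuousOn_primitive_interval' hint left_mem_uIcc
      rwa [uIcc_of_le hb.le] at this
    refine EqOn.of_subset_closure (s := Ico 0 b) ?_ (hc.mono hsub) hcont Ico_subset_Icc_self
      (by rw [closure_Ico hb.ne])
    intro t ht
    simp only []
    rw [hxx t ht.2, hxx 0 hb, (h t ht).equation t ⟨ht.1, le_rfl⟩]
    congr 1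
    refine integral_congr_of_ae_Ico le_rfl ht.1 le_rfl ?_
    filter_upwards [hOp.stopAt_ae_eq hσ ht.1 le_rfl ht.2.le (h t ht).continuousOn hc
      (fun s hs => (hxx s (hs.2.trans ht.2)).symm), ae_restrict_mem measurableSet_Ico] with s hs hs'
    rw [hs, hxx s (hs'.2.trans ht.2)]

end PathSolution

section PathSolution

variable {P Z X : Type*} [NormedAddCommGroup P] [NormedAddCommGroup Z]
  [NormedAddCommGroup X] [NormedSpace ℝ X]
  {σ : ℝ} {d : ℝ → P} {Op : (ℝ → X) → ℝ → Z} {G : P × Z × ℝ × X → X} {Ω : Set (ℝ × X)}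
  {x₀ : ℝ → X} [ProperSpace P] [ProperSpace Z] [FiniteDimensional ℝ X]

/-- The local Lipschitz property enters the argument only through this sequential continuity;
countably many null sets are discarded. -/
theorem OperatorClass.tendsto_of_tendstoUniformly (hOp : OperatorClass σ Op) {b : ℝ} (hb : 0 ≤ b)
    {ξ : ℝ → X} (hξ : ContinuousOn ξ (Icc (-σ) b)) :
    ∃ Δ > 0, ∃ δ > 0, ∀ (u : ℕ → ℝ → X) (x : ℝ → X), (∀ n, Continuous (u n)) → Continuous x →
      (∀ n, EqOn (u n) ξ (Icc (-σ) b)) → EqOn x ξ (Icc (-σ) b) →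
      (∀ n, ∀ t, b ≤ t → ‖u n t - ξ b‖ < δ) → (∀ t, b ≤ t → ‖x t - ξ b‖ < δ) →
      TendstoUniformly u x atTop →
      ∀ᵐ s ∂(volume.restrict (Icc b (b + Δ))), Tendsto (fun n => Op (u n) s) atTop (𝓝 (Op x s))
          := by
  obtain ⟨Δ, hΔ, δ, hδ, c, hc, H⟩ := hOp.locLip b hb ξ hξ
  refine ⟨Δ, hΔ, δ, hδ, fun u x hu hx hue hxe hun hxn hlim => ?_⟩
  have h1 : ∀ n, ∀ᵐ s ∂(volume.restrict (Icc b (b + Δ))),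
      ‖Op (u n) s - Op x s‖ ≤ c * sSup ((fun τ => ‖u n τ - x τ‖) '' Icc b (b + Δ)) := fun n =>
    H (u n) x (hu n).continuousOn hx.continuousOn (hue n) hxe (fun s hs => hun n s hs.1)
      fun s hs => hxn s hs.1
  filter_upwards [ae_all_iff.2 h1] with s hs
  rw [tendsto_iff_norm_sub_tendsto_zero]
  refine squeeze_zero (fun _ => norm_nonneg _) hs ?_
  rw [← mul_zero c]
  refine Tendsto.const_mul c ?_
  rw [Metric.tendsto_atTop]
  intro ε hε
  obtain ⟨n₀, hn₀⟩ := eventually_atTop.1 (Metric.tendstoUniformly_iff.1 hlim (ε / 2)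
      (by positivity))
  refine ⟨n₀, fun n hn => ?_⟩
  have hle : sSup ((fun τ => ‖u n τ - x τ‖) '' Icc b (b + Δ)) ≤ ε / 2 := by
    refine Real.sSup_le ?_ (by positivity)
    rintro _ ⟨τ, -, rfl⟩
    have := hn₀ n hn τ
    rw [dist_comm, dist_eq_norm] at this
    exact this.le
  have h0 : 0 ≤ sSup ((fun τ => ‖u n τ - x τ‖) '' Icc b (b + Δ)) := by
    refine Real.sSup_nonneg ?_
    rintro _ ⟨τ, -, rfl⟩
    positivity
  rw [Real.dist_eq, sub_zero, abs_of_nonneg h0]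
  linarith

/-- A solution on a compact interval can be continued. -/
theorem IsPathSolution.exists_extension (hOp : OperatorClass σ Op) (hσ : 0 < σ)
    (hd : MemLp d ⊤ (volume.restrict (Ici 0))) (hΩ : IsOpen Ω)
    (hG : ContinuousOn G {p | p.2.2 ∈ Ω}) {x : ℝ → X} {b : ℝ}
    (h : IsPathSolution σ d Op G Ω x₀ b x) :
    ∃ b' > b, ∃ x', EqOn x' x (Icc (-σ) b) ∧ IsPathSolution σ d Op G Ω x₀ b' x' := by
  have hX : ProperSpace X := FiniteDimensional.proper ℝ X
  have hb0 := h.nonneg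
  have hσb : -σ ≤ b := by linarith
  obtain ⟨Δ, hΔ, δ, hδ, hlip⟩ := hOp.tendsto_of_tendstoUniformly hb0 h.continuousOn
  obtain ⟨ε₀, hε₀, hball⟩ := Metric.isOpen_iff.1 hΩ (b, x b) (h.mem b ⟨hb0, le_rfl⟩)
  -- Halving makes the closed tube of radius `ε` fit strictly inside both the domain ball and the
  -- Lipschitz neighbourhood.
  set ε := min (ε₀ / 2) (δ / 2) with hε
  have hεpos : 0 < ε := by positivity
  set h₀ := min (ε₀ / 2) Δ with hh₀
  have hh₀pos : 0 < h₀ := by positivity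
  have hmemΩ : ∀ s v, b ≤ s → s ≤ b + h₀ → ‖v - x b‖ ≤ ε → (s, v) ∈ Ω := by
    intro s v h1 h2 h3
    refine hball ?_
    rw [Metric.mem_ball, Prod.dist_eq, Real.dist_eq, dist_eq_norm, abs_of_nonneg (by linarith)]
    refine max_lt ?_ ?_
    · have : h₀ ≤ ε₀ / 2 := min_le_left _ _
      simp only; linarith
    · have : ε ≤ ε₀ / 2 := min_le_left _ _
      simp only; linarith
  -- Clamping the time makes the history continuous on all of `ℝ`; values before `-σ` are
  -- irrelevant.
  set hist : ℝ → X := fun t => x (max (-σ) (min t b)) with hhist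
  have hhistc : Continuous hist := by
    refine h.continuousOn.comp_continuous (by fun_prop) fun t =>
        ⟨le_max_left _ _, max_le hσb (min_le_right _ _)⟩
  have hhist_eq : ∀ t ∈ Icc (-σ) b, hist t = x t := by
    intro t ht
    simp only [hhist]
    rw [min_eq_left ht.2, max_eq_right ht.1]
  have hhistb : hist b = x b := hhist_eq b ⟨hσb, le_rfl⟩
  obtain ⟨C₁, hC₁⟩ := isCompact_Icc.exists_bound_of_continuousOn h.continuousOn
  have hC₁0 : 0 ≤ C₁ := (norm_nonneg _).trans (hC₁ b ⟨hσb, le_rfl⟩)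
  have hK : IsCompact (Icc b (b + h₀) ×ˢ Metric.closedBall (x b) ε) :=
    isCompact_Icc.prod (isCompact_closedBall _ _)
  obtain ⟨M, hM0, hM⟩ := exists_uniform_bound_rhs hOp hd hG hK
    (by rintro ⟨s, v⟩ ⟨hs, hv⟩
        exact hmemΩ s v hs.1 hs.2 (by simpa [dist_eq_norm] using hv))
    (C := C₁ + ε) (by positivity)
  -- This step length keeps the displacement `M η` within the tube radius.
  set η := min h₀ (ε / (M + 1)) with hη
  have hηpos : 0 < η := by positivity
  have hηh : η ≤ h₀ := min_le_left _ _
  have hηM : M * (b + η - b) ≤ ε := by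
    have h1 : η ≤ ε / (M + 1) := min_le_right _ _
    rw [le_div_iff₀ (by positivity)] at h1
    nlinarith
  have tube_bound : ∀ z ∈ pathTube hist b ε, ∀ t ∈ Ici (-σ), ‖z t‖ ≤ C₁ + ε := by
    intro z hz t ht
    rcases le_total t b with htb | htb
    · rw [hz.2.1 t htb, hhist_eq t ⟨ht, htb⟩]
      linarith [hC₁ t ⟨ht, htb⟩]
    · have h1 := hz.2.2 t htb
      rw [hhistb] at h1
      have h2 := norm_le_norm_add_norm_sub' (z t) (x b)
      linarith [hC₁ b ⟨hσb, le_rfl⟩]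
  have tube_mem : ∀ z ∈ pathTube hist b ε, ∀ s ∈ Icc b (b + η), (s, z s) ∈ Ω := fun z hz s hs =>
    hmemΩ s (z s) hs.1 (by linarith [hs.2]) (hhistb ▸ hz.2.2 s hs.1)
  have hsub : Icc b (b + η) ⊆ Ici 0 := fun s hs => hb0.trans hs.1
  obtain ⟨z, hz, hzeq⟩ := exists_solution_of_causal
    (Φ := fun z s => G (d s, Op z s, s, z s)) hhistc (by linarith : b < b + η) hM0 hηM
    (fun z hz => aestronglyMeasurable_rhs hOp hd hΩ hG hb0 hz.1.continuousOn hz.1.continuousOn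
      (tube_mem z hz))
    (fun z hz => by
      filter_upwards [ae_restrict_of_ae_restrict_of_subset hsub
        (hM z hz.1.continuousOn (tube_bound z hz)), ae_restrict_mem measurableSet_Icc] with s h1 hs
      refine h1 _ ⟨⟨hs.1, by linarith [hs.2]⟩, ?_⟩
      simpa [dist_eq_norm, hhistb] using hz.2.2 s hs.1)
    (fun z hz z' hz' t ht hzz => by
      have := hOp.causal t (hb0.trans ht.1) z z' hz.1.continuousOn hz'.1.continuousOn
        fun s hs => hzz s hs.2.le
      filter_upwards [ae_restrict_of_ae_restrict_of_subset (Ico_subset_Ico_left hb0) this,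
        ae_restrict_mem measurableSet_Ico] with s hs hs'
      rw [hs, hzz s hs'.2.le])
    (fun u z hu hz hlim => by
      have hδε : ε < δ := (min_le_right _ _).trans_lt (by linarith)
      have := hlip u z (fun n => (hu n).1) hz.1
        (fun n t ht => ((hu n).2.1 t ht.2).trans (hhist_eq t ht))
        (fun t ht => (hz.2.1 t ht.2).trans (hhist_eq t ht))
        (fun n t ht => hhistb ▸ ((hu n).2.2 t ht).trans_lt hδε)
        (fun t ht => hhistb ▸ (hz.2.2 t ht).trans_lt hδε) hlim
      have hsubΔ : Icc b (b + η) ⊆ Icc b (b + Δ) :=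
        Icc_subset_Icc_right (by linarith [min_le_right (ε₀ / 2) Δ])
      filter_upwards [ae_restrict_of_ae_restrict_of_subset hsubΔ this,
        ae_restrict_mem measurableSet_Icc] with s hs hs'
      have hcont : ContinuousAt G (d s, Op z s, s, z s) :=
        hG.continuousAt ((hΩ.preimage (continuous_snd.comp continuous_snd)).mem_nhds
          (tube_mem z hz s hs'))
      exact hcont.tendsto.comp (tendsto_const_nhds.prodMk_nhds (hs.prodMk_nhds
        (tendsto_const_nhds.prodMk_nhds (hlim.tendsto_at s)))))
  have hzx : EqOn z x (Icc (-σ) b) := fun t ht => (hz.2.1 t ht.2).trans (hhist_eq t ht)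
  have hmem : ∀ t ∈ Icc 0 (b + η), (t, z t) ∈ Ω := by
    intro t ht
    rcases le_total t b with htb | htb
    · rw [hzx ⟨by linarith [ht.1], htb⟩]
      exact h.mem t ⟨ht.1, htb⟩
    · exact tube_mem z hz t ⟨htb, ht.2⟩
  refine ⟨b + η, by linarith, z, hzx, by linarith, hz.1.continuousOn, ?_, hmem, ?_⟩
  · exact fun t ht => (hzx ⟨ht.1, ht.2.trans hb0⟩).trans (h.initial ht)
  have hint := intervalIntegrable_rhs hOp hσ hd hΩ hG (by linarith : 0 ≤ b + η)
    hz.1.continuousOn hmem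
  have key : ∀ t ∈ Icc 0 b, z t = z 0 + ∫ s in (0 : ℝ)..t, G (d s, Op (stopAt z (b + η)) s, s, z s)
      :=
    (h.congr_of_le hOp hσ hb0 le_rfl hzx.symm).equation_of_le hOp hσ hz.1.continuousOn (by linarith)
  intro t ht
  rcases le_total t b with htb | htb
  · exact key t ⟨ht.1, htb⟩
  have hi1 : IntervalIntegrable (fun s => G (d s, Op (stopAt z (b + η)) s, s, z s)) volume 0 b :=
    hint.mono_set (by
      rw [uIcc_of_le hb0, uIcc_of_le (by linarith)]
      exact Icc_subset_Icc_right (by linarith))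
  have hi2 : IntervalIntegrable (fun s => G (d s, Op (stopAt z (b + η)) s, s, z s)) volume b t :=
    hint.mono_set (by rw [uIcc_of_le htb, uIcc_of_le (by linarith)]; exact Icc_subset_Icc hb0 ht.2)
  rw [← intervalIntegral.integral_add_adjacent_intervals hi1 hi2, ← add_assoc,
    ← key b ⟨hb0, le_rfl⟩, hzeq t ⟨htb, ht.2⟩, hhistb, hzx ⟨hσb, le_rfl⟩]
  congr 1
  refine integral_congr_of_ae_Ico hb0 htb ht.2 ?_
  have := hOp.causal (b + η) (by linarith) z (stopAt z (b + η)) hz.1.continuousOn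
    (continuousOn_stopAt (by linarith) hz.1.continuousOn) fun s hs => by
      simp [stopAt, min_eq_left hs.2.le]
  filter_upwards [this] with s hs
  rw [hs]

/-- A maximal solution on a half-open interval exists. -/
theorem exists_maximal_pathSolution (hOp : OperatorClass σ Op) (hσ : 0 < σ)
    (hd : MemLp d ⊤ (volume.restrict (Ici 0))) (hΩ : IsOpen Ω)
    (hG : ContinuousOn G {p | p.2.2 ∈ Ω}) {T : ℝ} (hΩT : ∀ p ∈ Ω, p.1 < T)
    (h₀ : ContinuousOn x₀ (Icc (-σ) 0)) (h₀Ω : (0, x₀ 0) ∈ Ω) :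
    ∃ (b : ℝ) (x : ℝ → X), 0 < b ∧ b ≤ T ∧ (∀ s ∈ Ico 0 b, IsPathSolution σ d Op G Ω x₀ s x) ∧
      ∀ (b' : ℝ) (x' : ℝ → X), (∀ s ∈ Ico 0 b', IsPathSolution σ d Op G Ω x₀ s x') → b ≤ b' →
        EqOn x x' (Ico (-σ) b) → b' ≤ b := by
  have hle : ∀ (b : ℝ) (x : ℝ → X), 0 < b → (∀ s ∈ Ico 0 b, IsPathSolution σ d Op G Ω x₀ s x) →
      b ≤ T := by
    intro b x hb hx
    refine le_of_forall_lt fun s hs => ?_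
    rcases lt_or_ge s 0 with h0 | h0
    · exact h0.trans (hΩT _ h₀Ω)
    · exact hΩT _ ((hx s ⟨h0, hs⟩).mem s ⟨h0, le_rfl⟩)
  -- Zorn's lemma is applied to half-open intervals: the union of a chain is again of this type,
  -- with the supremum, at most `T`, as its end.
  let S := {p : ℝ × (ℝ → X) // 0 < p.1 ∧ ∀ s ∈ Ico 0 p.1, IsPathSolution σ d Op G Ω x₀ s p.2}
  let R : S → S → Prop := fun p q => p.1.1 ≤ q.1.1 ∧ EqOn p.1.2 q.1.2 (Ico (-σ) p.1.1)
  have hstart : IsPathSolution σ d Op G Ω x₀ 0 x₀ := by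
    refine ⟨le_rfl, h₀, fun _ _ => rfl, fun t ht => ?_, fun t ht => ?_⟩ <;>
    obtain rfl : t = 0 := le_antisymm ht.2 ht.1
    · exact h₀Ω
    · simp
  obtain ⟨b₁, hb₁, x₁, -, hx₁⟩ := hstart.exists_extension hOp hσ hd hΩ hG
  have : Nonempty S := ⟨⟨(b₁, x₁), hb₁, fun s hs => hx₁.congr_of_le hOp hσ hs.1 hs.2.le fun _ _ =>
      rfl⟩⟩
  obtain ⟨⟨⟨b, x⟩, hb, hx⟩, hmax⟩ := exists_maximal_of_nonempty_chains_bounded (r := R) (by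
    intro C hC hne
    have hbdd : BddAbove ((fun p : S => p.1.1) '' C) := by
      refine ⟨T, ?_⟩
      rintro _ ⟨p, -, rfl⟩
      exact hle _ _ p.2.1 p.2.2
    have hagree : ∀ p ∈ C, ∀ q ∈ C, ∀ t, -σ ≤ t → t < p.1.1 → t < q.1.1 → p.1.2 t = q.1.2 t := by
      intro p hp q hq t ht h1 h2
      by_cases hpq : p = q
      · rw [hpq]
      rcases hC hp hq hpq with h | h
      · exact h.2 ⟨ht, h1⟩
      · exact (h.2 ⟨ht, h2⟩).symm
    classical
    set B := sSup ((fun p : S => p.1.1) '' C) with hB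
    set y : ℝ → X := fun t => if h : ∃ p ∈ C, t < p.1.1 then h.choose.1.2 t else 0 with hy
    have hyeq : ∀ p ∈ C, EqOn p.1.2 y (Ico (-σ) p.1.1) := by
      intro p hp t ht
      have hex : ∃ p ∈ C, t < p.1.1 := ⟨p, hp, ht.2⟩
      simp only [hy, dif_pos hex]
      exact hagree p hp _ hex.choose_spec.1 t ht.1 ht.2 hex.choose_spec.2
    have hpB : ∀ p ∈ C, p.1.1 ≤ B := fun p hp => le_csSup hbdd ⟨p, hp, rfl⟩
    obtain ⟨p₀, hp₀⟩ := hne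
    refine ⟨⟨(B, y), p₀.2.1.trans_le (hpB p₀ hp₀), fun s hs => ?_⟩, fun p hp =>
        ⟨hpB p hp, hyeq p hp⟩⟩
    obtain ⟨_, ⟨p, hp, rfl⟩, hsp⟩ := exists_lt_of_lt_csSup (⟨_, p₀, hp₀, rfl⟩ :
      ((fun p : S => p.1.1) '' C).Nonempty) hs.2
    exact (p.2.2 s ⟨hs.1, hsp⟩).congr_of_le hOp hσ hs.1 le_rfl
      ((hyeq p hp).mono (Icc_subset_Ico_right hsp)))
    (fun {p q w} hpq hqw => ⟨hpq.1.trans hqw.1,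
      hpq.2.trans (hqw.2.mono (Ico_subset_Ico_right hpq.1))⟩)
  refine ⟨b, x, hb, hle b x hb hx, hx, fun b' x' hx' hbb' he => ?_⟩
  exact (hmax ⟨(b', x'), hb.trans_le hbb', hx'⟩ ⟨hbb', he⟩).1

end PathSolution

/-! ### From the high-gain property to a repelling shell. -/

section HighGainLevel

/-- A gain condition on thin spherical shells close to the unit sphere: for bounded `δ`, `z` the
feedback `N (α (‖v‖²)) v` makes `⟨v, f (δ, z, ·)⟩` arbitrarily negative there. -/
def ShellGain {P Z E : Type*} [NormedAddCommGroup P] [NormedAddCommGroup Z]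
    [NormedAddCommGroup E] [InnerProductSpace ℝ E] (f : P × Z × E → E) (α N : ℝ → ℝ) : Prop :=
  ∀ C K₀ M : ℝ, K₀ < 1 → ∃ κ κ', K₀ ≤ κ ∧ κ < κ' ∧ κ' < 1 ∧ ∀ δ z v, ‖δ‖ ≤ C → ‖z‖ ≤ C →
    κ ≤ ‖v‖ ^ 2 → ‖v‖ ^ 2 ≤ κ' → inner ℝ v (f (δ, z, N (α (‖v‖ ^ 2)) • v)) ≤ -M

variable {m r p q : ℕ} {c : ℝ} {α N : ℝ → ℝ} {f : Vec p × Vec q × Vec m → Vec m}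

theorem bddBelow_highGain (hf : Continuous f) {ρ : ℝ} {Kp : Set (Vec p)} {Kq : Set (Vec q)}
    (hKp : IsCompact Kp) (hKq : IsCompact Kq) (s : ℝ) :
    BddBelow {a : ℝ | ∃ δ ∈ Kp, ∃ z ∈ Kq, ∃ v : Vec m, ρ ≤ ‖v‖ ∧ ‖v‖ ≤ 1 ∧
      a = inner ℝ v (f (δ, z, -(s • v)))} := by
  have hcomp : IsCompact (Kp ×ˢ Kq ×ˢ Metric.closedBall (0 : Vec m) 1) :=
    hKp.prod (hKq.prod (isCompact_closedBall _ _))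
  have hcont : Continuous fun w : Vec p × Vec q × Vec m =>
      (inner ℝ w.2.2 (f (w.1, w.2.1, -(s • w.2.2))) : ℝ) := by fun_prop
  refine (hcomp.image hcont).bddBelow.mono ?_
  rintro a ⟨δ, hδ, z, hz, v, -, hv, rfl⟩
  exact ⟨(δ, z, v), ⟨hδ, hz, by simpa using hv⟩, rfl⟩

/-- A value `s` with large `χ(s)` is realised by the gain on some sphere, and choosing `χ(s)` large
enough forces that sphere beyond any prescribed radius below one. Compactness thickens it to a
shell. -/
theorem HighGain.shellGain (hm : 0 < m) (hf : Continuous f) (hg : HighGain f)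
    (hαN : ControlDesign r c α N) (hc : 0 < c) : ShellGain f α N := by
  obtain ⟨ρ, hρ, H⟩ := hg
  intro C K₀ M hK₀
  set C' := max C 0 with hC'
  set Kp := Metric.closedBall (0 : Vec p) C'
  set Kq := Metric.closedBall (0 : Vec q) C'
  have hKp : IsCompact Kp := isCompact_closedBall _ _
  have hKq : IsCompact Kq := isCompact_closedBall _ _
  have h0p : (0 : Vec p) ∈ Kp := by simp [Kp, hC']
  have h0q : (0 : Vec q) ∈ Kq := by simp [Kq, hC']
  have hunb := H Kp Kq hKp ⟨0, h0p⟩ hKq ⟨0, h0q⟩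
  have : Nonempty (Fin m) := ⟨⟨0, hm⟩⟩
  obtain ⟨v₀, hv₀⟩ := exists_norm_eq (Vec m) zero_le_one
  -- The entry `ρ ^ 2` places the sphere in the annulus `ρ ≤ ‖v‖ ≤ 1` over which `χ` is defined.
  set K₁ := max K₀ (ρ ^ 2) with hK₁
  have hK₁1 : K₁ < 1 := max_lt hK₀ (by nlinarith [hρ.1, hρ.2])
  have hK₁0 : 0 ≤ K₁ := (sq_nonneg ρ).trans (le_max_right _ _)
  -- the values of `χ` on `N '' [0, A]` are bounded
  obtain ⟨B, hB⟩ := (isCompact_Icc (a := (0 : ℝ)) (b := α K₁)).exists_bound_of_continuousOn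
    (f := fun a => (inner ℝ v₀ (f (0, 0, -(N a • v₀))) : ℝ)) (by
      have hN : ContinuousOn N (Icc 0 (α K₁)) := hαN.N_cont.mono Icc_subset_Ici_self
      have : Continuous fun s : ℝ => (inner ℝ v₀ (f (0, 0, -(s • v₀))) : ℝ) := by fun_prop
      exact this.comp_continuousOn hN)
  obtain ⟨_, ⟨s, rfl⟩, hs⟩ := not_bddAbove_iff.1 hunb (max M B)
  have hlow : ∀ δ ∈ Kp, ∀ z ∈ Kq, ∀ v : Vec m, ρ ≤ ‖v‖ → ‖v‖ ≤ 1 →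
      max M B < inner ℝ v (f (δ, z, -(s • v))) := fun δ hδ z hz v h1 h2 =>
    hs.trans_le (csInf_le (bddBelow_highGain hf hKp hKq s) ⟨δ, hδ, z, hz, v, h1, h2, rfl⟩)
  obtain ⟨a, ha0, rfl⟩ := hαN.N_surj (mem_univ s)
  -- For arguments up to `α K₁`, the value of `χ` at `N` of the argument is at most `B`, as testing
  -- with `v₀` and zero data shows; `χ(s) > B` rules them out.
  have haA : α K₁ < a := by
    by_contra! hle
    have h1 := hlow 0 h0p 0 h0q v₀ (hv₀ ▸ hρ.2.le) hv₀.le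
    have h2 := (le_abs_self _).trans (hB a ⟨ha0, hle⟩)
    exact (h2.trans (le_max_right M B)).not_gt h1
  obtain ⟨κ, hκ, rfl⟩ := hαN.α_bij.surjOn
    (show a ∈ Ici (c * (r + 1)) from (hαN.le_α ⟨hK₁0, hK₁1⟩).trans haA.le)
  have hK₁κ : K₁ < κ := (hαN.strictMonoOn_α.lt_iff_lt ⟨hK₁0, hK₁1⟩ hκ).1 haA
  have hκ0 : 0 < κ := hK₁0.trans_lt hK₁κ
  -- spread the estimate from the sphere to a shell
  have hcomp : IsCompact (Kp ×ˢ Kq ×ˢ Metric.sphere (0 : Vec m) (Real.sqrt κ)) :=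
    hKp.prod (hKq.prod (isCompact_sphere _ _))
  -- Points of the shell are written `l v` with `v` on the compact sphere, so the thickness comes
  -- from a neighbourhood of `l = 1` uniform in all other variables.
  set F : ℝ × Vec p × Vec q × Vec m → ℝ := fun w =>
    inner ℝ (w.1 • w.2.2.2) (f (w.2.1, w.2.2.1, N (α (‖w.1 • w.2.2.2‖ ^ 2)) • w.1 •
        w.2.2.2)) with hF
  have hev : ∀ᶠ l in 𝓝 (1 : ℝ), ∀ w ∈ Kp ×ˢ Kq ×ˢ Metric.sphere (0 : Vec m) (Real.sqrt κ),
      F (l, w) < -M := by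
    refine hcomp.eventually_forall_of_forall_eventually fun w hw => ?_
    obtain ⟨δ, z, v⟩ := w
    obtain ⟨hδ, hz, hv⟩ := hw
    have hv : ‖v‖ = Real.sqrt κ := by simpa using hv
    have hv2 : ‖v‖ ^ 2 = κ := by rw [hv, Real.sq_sqrt hκ0.le]
    have hval : F (1, δ, z, v) < -M := by
      -- With `-v` in the definition of `χ`, the input `-(s • (-v))` is the feedback `s • v`, and
      -- the inner product changes sign.
      have := hlow δ hδ z hz (-v) (by
        rw [norm_neg, hv]
        exact Real.le_sqrt_of_sq_le ((le_max_right _ _).trans hK₁κ.le)) (by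
        rw [norm_neg, hv]
        exact Real.sqrt_le_one.2 hκ.2.le)
      simp only [smul_neg, neg_neg, inner_neg_left] at this
      simp only [hF, one_smul, hv2]
      linarith [le_max_left M B]
    have hcont : ContinuousAt F (1, δ, z, v) := by
      have hsq : ContinuousAt (fun w : ℝ × Vec p × Vec q × Vec m => ‖w.1 • w.2.2.2‖ ^ 2)
          (1, δ, z, v) := by fun_prop
      have hκn : ‖(1 : ℝ) • v‖ ^ 2 = κ := by rw [one_smul, hv2]
      have hα : ContinuousAt α (‖(1 : ℝ) • v‖ ^ 2) := by
        rw [hκn]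
        exact hαN.α_smooth.continuousOn.continuousAt (Ico_mem_nhds hκ0 hκ.2)
      have hN : ContinuousAt N (α (‖(1 : ℝ) • v‖ ^ 2)) := by
        rw [hκn]
        refine hαN.N_cont.continuousAt (Ici_mem_nhds ?_)
        exact lt_of_lt_of_le (by positivity) (hαN.le_α hκ)
      have hNα : ContinuousAt (fun w : ℝ × Vec p × Vec q × Vec m =>
          N (α (‖w.1 • w.2.2.2‖ ^ 2))) (1, δ, z, v) :=
        ContinuousAt.comp (f := fun w : ℝ × Vec p × Vec q × Vec m => α (‖w.1 • w.2.2.2‖ ^ 2))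
          (g := N) hN (ContinuousAt.comp (f := fun w : ℝ × Vec p × Vec q × Vec m =>
            ‖w.1 • w.2.2.2‖ ^ 2) (g := α) hα hsq)
      have hv' : ContinuousAt (fun w : ℝ × Vec p × Vec q × Vec m => w.1 • w.2.2.2) (1, δ, z, v)
          := by
        fun_prop
      have hg : ContinuousAt (fun w : ℝ × Vec p × Vec q × Vec m =>
          f (w.2.1, w.2.2.1, N (α (‖w.1 • w.2.2.2‖ ^ 2)) • w.1 • w.2.2.2)) (1, δ, z, v) :=
        hf.continuousAt.comp (f := fun w : ℝ × Vec p × Vec q × Vec m =>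
          (w.2.1, w.2.2.1, N (α (‖w.1 • w.2.2.2‖ ^ 2)) • w.1 • w.2.2.2)) (by fun_prop)
      exact hv'.inner hg
    exact hcont.eventually_lt continuousAt_const hval
  obtain ⟨ε, hε, hball⟩ := Metric.eventually_nhds_iff.1 hev
  set μ := min (ε / 2) 1 with hμ
  have hμ0 : 0 < μ := by positivity
  -- The first bound means `l ≤ 1 + μ` for the scaling factor; the second keeps the shell inside the
  -- unit ball.
  refine ⟨κ, min ((1 + μ) ^ 2 * κ) ((1 + κ) / 2), (le_max_left _ _).trans hK₁κ.le,
    lt_min (by nlinarith [mul_pos hμ0 hκ0, mul_pos (mul_pos hμ0 hμ0) hκ0]) (by linarith [hκ.2]),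
        (min_le_right _ _).trans_lt (by linarith [hκ.2]), ?_⟩
  intro δ z v hδ hz h1 h2
  set l := ‖v‖ / Real.sqrt κ with hl
  have hsκ : 0 < Real.sqrt κ := Real.sqrt_pos.2 hκ0
  have hl1 : 1 ≤ l := by
    rw [hl, le_div_iff₀ hsκ, one_mul]
    exact Real.sqrt_le_iff.2 ⟨norm_nonneg _, h1⟩
  have hl2 : l ≤ 1 + μ := by
    rw [hl, div_le_iff₀ hsκ]
    refine abs_le_of_sq_le_sq' ?_ (by positivity) |>.2
    rw [mul_pow, Real.sq_sqrt hκ0.le]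
    exact h2.trans (min_le_left _ _)
  have hl0 : l ≠ 0 := by positivity
  have hw := hball (y := l) (by
    rw [Real.dist_eq, abs_of_nonneg (by linarith)]
    linarith [min_le_left (ε / 2) 1]) (δ, z, l⁻¹ • v)
        ⟨mem_closedBall_zero_iff.2 (hδ.trans (le_max_left _ _)),
      mem_closedBall_zero_iff.2 (hz.trans (le_max_left _ _)), by
      rw [mem_sphere_zero_iff_norm, norm_smul, norm_inv, Real.norm_of_nonneg (by positivity), hl]
      have : ‖v‖ ≠ 0 := fun h0 => hl0 (by rw [hl, h0, zero_div])
      field_simp⟩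
  have hvl : l • l⁻¹ • v = v := by rw [smul_smul, mul_inv_cancel₀ hl0, one_smul]
  simp only [hF, hvl] at hw
  exact hw.le

end HighGainLevel

/-! ### The barrier for the last error signal. -/

section Barrier

variable {E : Type*} [NormedAddCommGroup E] [InnerProductSpace ℝ E] [FiniteDimensional ℝ E]

/-- A barrier for `e = φ • g`, where `g` is a primitive of `h` and `φ' = c φ²`. -/
theorem norm_sq_le_of_inner_le {c T b κ κ' : ℝ} (hc : 0 < c) (hbT : b < T) (hb : 0 ≤ b)
    (hκ : κ < κ') (hκ' : κ' ≤ 1) {g h : ℝ → E} (hi : IntervalIntegrable h volume 0 b)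
    (hg : ∀ t ∈ Icc 0 b, g t = g 0 + ∫ s in (0 : ℝ)..t, h s)
    (h0 : ‖funnelFun c T 0 • g 0‖ ^ 2 ≤ κ)
    (hin : ∀ᵐ t ∂(volume.restrict (Icc 0 b)), κ ≤ ‖funnelFun c T t • g t‖ ^ 2 →
      ‖funnelFun c T t • g t‖ ^ 2 ≤ κ' → inner ℝ (funnelFun c T t • g t) (h t) ≤ -c) :
    ∀ t ∈ Ico 0 b, ‖funnelFun c T t • g t‖ ^ 2 ≤ κ := by
  have : CompleteSpace E := FiniteDimensional.complete ℝ E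
  set φ := funnelFun c T with hφ
  have hφc : ContinuousOn φ (Icc 0 b) := (contDiffOn_funnelFun c T).continuousOn.mono
    fun t ht => ht.2.trans_lt hbT
  have hgc : ContinuousOn g (Icc 0 b) := by
    refine ContinuousOn.congr (continuousOn_const.add ?_) hg
    have := intervalIntegral.continuousOn_primitive_interval' hi left_mem_uIcc
    rwa [uIcc_of_le hb] at this
  have hec : ContinuousOn (fun t => φ t • g t) (Icc 0 b) := hφc.smul hgc
  refine le_of_no_increase_in_band hκ ((hec.norm.pow 2).mono Ico_subset_Icc_self) h0 ?_
  intro s t has hst htb hband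
  have hsub : Icc s t ⊆ Icc 0 b := Icc_subset_Icc has htb.le
  have hist : IntervalIntegrable h volume s t := hi.mono_set (by
    rwa [uIcc_of_le hst.le, uIcc_of_le hb])
  have hgs : ∀ τ ∈ Icc s t, g τ = g s + ∫ v in s..τ, h v := by
    intro τ hτ
    have h1 : IntervalIntegrable h volume 0 s := hi.mono_set (by
      rw [uIcc_of_le has, uIcc_of_le hb]; exact Icc_subset_Icc_right (hst.le.trans htb.le))
    have h2 : IntervalIntegrable h volume s τ := hist.mono_set (by
      rw [uIcc_of_le hτ.1, uIcc_of_le hst.le]; exact Icc_subset_Icc_right hτ.2)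
    rw [hg τ (hsub hτ), hg s (hsub ⟨le_rfl, hst.le⟩), add_assoc,
      intervalIntegral.integral_add_adjacent_intervals h1 h2]
  have hgac : AbsolutelyContinuousOnInterval g s t := by
    refine hist.absolutelyContinuousOnInterval_primitive.of_dist_le (C := 1) fun x hx y hy => ?_
    rw [uIcc_of_le hst.le] at hx hy
    rw [hgs x hx, hgs y hy, dist_add_left, one_mul]
  have hφac : AbsolutelyContinuousOnInterval φ s t := by
    have hd : ContDiffOn ℝ 1 φ (Icc s t) := ((contDiffOn_funnelFun c T).of_le (by simp)).mono
      fun τ hτ => (hsub hτ).2.trans_lt hbT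
    obtain ⟨K, hK⟩ := hd.exists_lipschitzOnWith (by simp) (convex_Icc s t) isCompact_Icc
    refine LipschitzOnWith.absolutelyContinuousOnInterval (K := K) ?_
    rwa [uIcc_of_le hst.le]
  have heac := hφac.smul hgac
  obtain ⟨B, hB⟩ := isCompact_Icc.exists_bound_of_continuousOn hec
  -- The integrand `h` is not assumed continuous, so the sign of the derivative is available only
  -- a.e. and monotonicity must come from absolute continuity.
  have hVac : AbsolutelyContinuousOnInterval (fun τ => ‖φ τ • g τ‖ ^ 2) s t := by
    refine heac.of_dist_le (C := 2 * B) fun x hx y hy => ?_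
    rw [uIcc_of_le hst.le] at hx hy
    have h1 := hB x (hsub hx)
    have h2 := hB y (hsub hy)
    have h3 := abs_norm_sub_norm_le (φ x • g x) (φ y • g y)
    rw [Real.dist_eq, dist_eq_norm, sq_sub_sq, abs_mul, abs_of_nonneg (by positivity)]
    simp only [Pi.smul_apply']
    have hB0 : 0 ≤ B := (norm_nonneg _).trans h1
    gcongr
    linarith
  have key := hVac.integral_deriv_eq_sub
  suffices hle : ∫ τ in s..t, deriv (fun τ => ‖φ τ • g τ‖ ^ 2) τ ≤ 0 by
    rw [key] at hle
    linarith
  rw [intervalIntegral.integral_of_le hst.le]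
  refine integral_nonpos_of_ae ?_
  rw [Filter.EventuallyLE, ← restrict_Ioo_eq_restrict_Ioc]
  filter_upwards [ae_restrict_of_ae hist.ae_hasDerivAt_integral,
    ae_restrict_of_ae_restrict_of_subset (Ioo_subset_Icc_self.trans hsub) hin,
    ae_restrict_mem measurableSet_Ioo] with τ h1 h2 hτ
  have hτ' : τ ∈ Icc s t := ⟨hτ.1.le, hτ.2.le⟩
  have hτT : τ < T := (hsub hτ').2.trans_lt hbT
  have hdg : HasDerivAt g (h τ) τ := by
    refine ((h1 (by rwa [uIcc_of_le hst.le]) s (left_mem_uIcc)).const_add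
        (g s)).congr_of_eventuallyEq ?_
    filter_upwards [Icc_mem_nhds hτ.1 hτ.2] with v hv using hgs v hv
  have hde := ((hasDerivAt_funnelFun hc.ne' hτT).smul hdg).norm_sq
  have hb1 := hband τ hτ'
  have h3 := h2 hb1.1 hb1.2
  have hφpos : 0 < φ τ := funnelFun_pos hc hτT
  have hval := hde.deriv
  simp only [Pi.smul_apply', Pi.zero_apply] at hval ⊢
  rw [hφ, hval, ← hφ]
  -- Pairing with `φ g` gives at most `-c φ + c φ ‖φ g‖²`, which is nonpositive because `‖φ g‖² ≤ κ'
  -- ≤ 1`.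
  have e1 : (φ τ • h τ + (c * φ τ ^ 2) • g τ : E) = φ τ • h τ + (c * φ τ) • φ τ • g τ := by
    module
  rw [e1, inner_add_right, inner_smul_right, inner_smul_right, real_inner_self_eq_norm_sq]
  have h4 := mul_le_mul_of_nonneg_left h3 hφpos.le
  have h5 := mul_le_mul_of_nonneg_left (hb1.2.trans hκ') (mul_pos hc hφpos).le
  linarith

end Barrier

/-! ### The closed loop as a first order functional differential equation. -/

section ClosedLoop

variable {r : ℕ} {P Z E : Type*} [NormedAddCommGroup P] [NormedAddCommGroup Z]
  [NormedAddCommGroup E] [InnerProductSpace ℝ E]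

/-- The domain of the feedback law, in terms of time and the state of the system. -/
def trackDomain (φ α : ℝ → ℝ) (T : ℝ) (xref : ℝ → JetVec r E) : Set (ℝ × JetVec r E) :=
  {p | (p.1, p.2 - xref (max 0 p.1)) ∈ errDomain φ α T r}

/-- The feedback law as a function of time and of the jet of the error. -/
noncomputable def funnelControl (φ α N : ℝ → ℝ) (p : ℝ × JetVec r E) : E :=
  N (α (‖errFun φ α (r - 1) p‖ ^ 2)) • errFun φ α (r - 1) p

/-- The right-hand side of the closed loop as a first order system. -/
noncomputable def trackRhs (f : P × Z × E → E) (φ α N : ℝ → ℝ) (xref : ℝ → JetVec r E)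
    (w : P × Z × ℝ × JetVec r E) : JetVec r E :=
  shiftL r E w.2.2.2 +
    lastL r E (f (w.1, w.2.1, funnelControl φ α N (w.2.2.1, w.2.2.2 - xref (max 0 w.2.2.1))))

variable {f : P × Z × E → E} {c T : ℝ} {α N : ℝ → ℝ} {xref : ℝ → JetVec r E}

theorem mem_trackDomain {φ : ℝ → ℝ} {t : ℝ} (ht : 0 ≤ t) {v : JetVec r E} :
    (t, v) ∈ trackDomain φ α T xref ↔ (t, v - xref t) ∈ errDomain φ α T r := by
  simp [trackDomain, max_eq_right ht]

/-- Replacing `t` by `max 0 t` extends the reference constantly to negative times, so the domain can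
be open around time zero. -/
theorem continuousOn_trackShift (hT : 0 < T) (hxref : ContinuousOn xref (Ico 0 T)) :
    ContinuousOn (fun p : ℝ × JetVec r E => (p.1, p.2 - xref (max 0 p.1))) {p | p.1 < T} := by
  refine continuousOn_fst.prodMk (continuousOn_snd.sub ?_)
  exact hxref.comp (by fun_prop) fun p hp => ⟨le_max_left _ _, max_lt hT hp⟩

theorem isOpen_trackDomain (hT : 0 < T) (hα : ControlDesign r c α N)
    (hxref : ContinuousOn xref (Ico 0 T)) : IsOpen (trackDomain (funnelFun c T) α T xref) := by
  have ho : IsOpen (errDomain (funnelFun c T) α T r : Set (ℝ × JetVec r E)) :=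
    isOpen_errDomain (contDiffOn_funnelFun c T) hα.α_smooth le_rfl
  have := (continuousOn_trackShift hT hxref).isOpen_inter_preimage
    (isOpen_Iio.preimage continuous_fst) ho
  convert this using 1
  ext p
  exact ⟨fun hp => ⟨hp.1, hp⟩, fun hp => hp.2⟩

theorem continuousOn_funnelControl (hr : 0 < r) (hc : 0 < c) (hα : ControlDesign r c α N) :
    ContinuousOn (funnelControl (funnelFun c T) α N)
      (errDomain (funnelFun c T) α T r : Set (ℝ × JetVec r E)) := by
  have he : ContinuousOn (errFun (funnelFun c T) α (r - 1))
      (errDomain (funnelFun c T) α T r : Set (ℝ × JetVec r E)) :=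
    (contDiffOn_errFun (contDiffOn_funnelFun c T) hα.α_smooth (Nat.sub_le r 1)).continuousOn.mono
      (errDomain_anti (Nat.sub_le r 1))
  refine ContinuousOn.smul (hα.N_cont.comp (hα.α_smooth.continuousOn.comp (he.norm.pow 2) ?_) ?_) he
  · intro p hp
    have := hp.2 (r - 1) (by omega)
    exact ⟨by positivity, by rw [sq_lt_one_iff₀ (norm_nonneg _)]; exact this⟩
  · intro p hp
    have := hp.2 (r - 1) (by omega)
    have h2 := hα.le_α (s := ‖errFun (funnelFun c T) α (r - 1) p‖ ^ 2)
      ⟨by positivity, by rw [sq_lt_one_iff₀ (norm_nonneg _)]; exact this⟩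
    exact le_trans (by positivity) h2

theorem continuousOn_trackRhs (hT : 0 < T) (hr : 0 < r) (hc : 0 < c) (hf : Continuous f)
    (hα : ControlDesign r c α N) (hxref : ContinuousOn xref (Ico 0 T)) :
    ContinuousOn (trackRhs f (funnelFun c T) α N xref)
      {w | w.2.2 ∈ trackDomain (funnelFun c T) α T xref} := by
  have hu : ContinuousOn (fun w : P × Z × ℝ × JetVec r E =>
      funnelControl (funnelFun c T) α N (w.2.2.1, w.2.2.2 - xref (max 0 w.2.2.1)))
      {w | w.2.2 ∈ trackDomain (funnelFun c T) α T xref} :=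
    ((continuousOn_funnelControl hr hc hα).comp
      ((continuousOn_trackShift hT hxref).mono fun p hp => hp.1)
      fun p (hp : p ∈ trackDomain (funnelFun c T) α T xref) => hp).comp
      (continuous_snd.comp continuous_snd).continuousOn fun w hw => hw
  have h1 : Continuous fun w : P × Z × ℝ × JetVec r E => w.2.2.2 := by fun_prop
  have h2 : Continuous fun w : P × Z × ℝ × JetVec r E => w.1 := by fun_prop
  have h3 : Continuous fun w : P × Z × ℝ × JetVec r E => w.2.1 := by fun_prop
  exact ((shiftL r E).continuous.comp h1).continuousOn.add
    ((lastL r E).continuous.comp_continuousOn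
      (hf.comp_continuousOn (h2.continuousOn.prodMk (h3.continuousOn.prodMk hu))))

theorem coordL_trackRhs_of_lt {φ : ℝ → ℝ} {k : ℕ} (hk : k + 1 < r) (w : P × Z × ℝ × JetVec r E) :
    coordL r E k (trackRhs f φ α N xref w) = coordL r E (k + 1) w.2.2.2 := by
  rw [trackRhs, map_add, coordL_shiftL, coordL_lastL (by omega), if_neg hk.ne, add_zero]

theorem coordL_trackRhs_last {φ : ℝ → ℝ} (hr : 0 < r) (w : P × Z × ℝ × JetVec r E) :
    coordL r E (r - 1) (trackRhs f φ α N xref w) =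
      f (w.1, w.2.1, funnelControl φ α N (w.2.2.1, w.2.2.2 - xref (max 0 w.2.2.1))) := by
  rw [trackRhs, map_add, coordL_shiftL, coordL_lastL (by omega), if_pos (by omega),
    coordL_of_le (by omega), zero_add]

end ClosedLoop

/-! ### Differentiating primitives and gluing jets. -/

section Primitives

variable {E : Type*} [NormedAddCommGroup E] [NormedSpace ℝ E] [CompleteSpace E]

theorem hasDerivWithinAt_of_primitive {a b : ℝ} (hab : a ≤ b) {g g' : ℝ → E}
    (hg' : ContinuousOn g' (Icc a b)) (hg : ∀ t ∈ Icc a b, g t = g a + ∫ s in a..t, g' s) :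
    ∀ t ∈ Icc a b, HasDerivWithinAt g (g' t) (Icc a b) t := by
  intro t ht
  -- Extending the integrand continuously by its end values treats the end points like interior
  -- points.
  set G : ℝ → E := fun s => g' (max a (min s b)) with hG
  have hGc : Continuous G := hg'.comp_continuous (by fun_prop) fun s =>
    ⟨le_max_left _ _, max_le hab (min_le_right _ _)⟩
  have hGe : ∀ s ∈ Icc a b, G s = g' s := fun s hs => by
    simp only [hG]
    rw [min_eq_left hs.2, max_eq_right hs.1]
  have h1 := ((hGc.integral_hasStrictDerivAt a t).hasDerivAt.const_add (g a)).hasDerivWithinAt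
    (s := Icc a b)
  rw [hGe t ht] at h1
  refine h1.congr_of_mem (fun s hs => ?_) ht
  rw [hg s hs]
  congr 1
  refine intervalIntegral.integral_congr fun v hv => ?_
  rw [uIcc_of_le hs.1] at hv
  exact (hGe v ⟨hv.1, hv.2.trans hs.2⟩).symm

theorem HasDerivWithinAt.union_Icc {a b c : ℝ} {g : ℝ → E} {g' : E} {t : ℝ}
    (h1 : t ∈ Icc a b → HasDerivWithinAt g g' (Icc a b) t)
    (h2 : t ∈ Icc b c → HasDerivWithinAt g g' (Icc b c) t) (hab : a ≤ b) (hbc : b ≤ c) :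
    HasDerivWithinAt g g' (Icc a c) t := by
  rw [← Icc_union_Icc_eq_Icc hab hbc]
  refine HasDerivWithinAt.union ?_ ?_
  · by_cases ht : t ∈ Icc a b
    · exact h1 ht
    · exact hasDerivWithinAt_iff_hasFDerivWithinAt.2
        (HasFDerivWithinAt.of_notMem_closure (by rwa [isClosed_Icc.closure_eq]))
  · by_cases ht : t ∈ Icc b c
    · exact h2 ht
    · exact hasDerivWithinAt_iff_hasFDerivWithinAt.2
        (HasFDerivWithinAt.of_notMem_closure (by rwa [isClosed_Icc.closure_eq]))

end Primitives

section JetGluing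

variable {r : ℕ} {E : Type*} [NormedAddCommGroup E] [InnerProductSpace ℝ E]

theorem Icc_mem_nhdsWithin_Ico {a b b' t : ℝ} (ht : t < b') : Icc a b' ∈ 𝓝[Ico a b] t := by
  rw [← Ici_inter_Iic, ← Ici_inter_Iio]
  exact mem_of_superset (inter_mem_nhdsWithin _ (Iic_mem_nhds ht)) fun s hs => ⟨hs.1.1, hs.2⟩

theorem continuousOn_Ico_of_Icc {X : Type*} [TopologicalSpace X] {x : ℝ → X} {a a₀ b : ℝ}
    (hb : a₀ < b) (h : ∀ s ∈ Ico a₀ b, ContinuousOn x (Icc a s)) : ContinuousOn x (Ico a b) := by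
  intro t ht
  obtain ⟨b', hb', hbb⟩ := exists_between (max_lt ht.2 hb)
  exact (h b' ⟨(le_max_right _ _).trans hb'.le, hbb⟩ t
    ⟨ht.1, (le_max_left _ _).trans hb'.le⟩).mono_of_mem_nhdsWithin
      (Icc_mem_nhdsWithin_Ico ((le_max_left _ _).trans_lt hb'))

theorem isJetOn_Ico_of_Icc {x : ℝ → JetVec r E} {a a₀ b : ℝ} (hb : a₀ < b)
    (h : ∀ s ∈ Ico a₀ b, IsJetOn x (Icc a s)) : IsJetOn x (Ico a b) := by
  refine ⟨continuousOn_Ico_of_Icc hb fun s hs => (h s hs).continuousOn, fun k hk t ht => ?_⟩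
  obtain ⟨b', hb', hbb⟩ := exists_between (max_lt ht.2 hb)
  exact ((h b' ⟨(le_max_right _ _).trans hb'.le, hbb⟩).hasDeriv k hk t
    ⟨ht.1, (le_max_left _ _).trans hb'.le⟩).mono_of_mem_nhdsWithin
      (Icc_mem_nhdsWithin_Ico ((le_max_left _ _).trans_lt hb'))

theorem coordL_add_integral [FiniteDimensional ℝ E] {F : ℝ → JetVec r E} {v : JetVec r E}
    {t₀ t₁ : ℝ}
    (hi : IntervalIntegrable F volume t₀ t₁) (k : ℕ) :
    coordL r E k (v + ∫ s in t₀..t₁, F s) =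
      coordL r E k v + ∫ s in t₀..t₁, coordL r E k (F s) := by
  have : CompleteSpace E := FiniteDimensional.complete ℝ E
  have : CompleteSpace (JetVec r E) := FiniteDimensional.complete ℝ _
  rw [map_add, ContinuousLinearMap.intervalIntegral_comp_comm _ hi]

end JetGluing

/-! ### Data of the tracking problem and the jet structure of its solutions. -/

section ClosedLoop

variable {r : ℕ} {P Z E : Type*} [NormedAddCommGroup P] [NormedAddCommGroup Z]
  [NormedAddCommGroup E] [InnerProductSpace ℝ E] [ProperSpace P] [ProperSpace Z]
  [FiniteDimensional ℝ E]
  {f : P × Z × E → E} {c T σ b : ℝ} {α N : ℝ → ℝ} {xref x x₀ : ℝ → JetVec r E} {d : ℝ → P}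
  {Op : (ℝ → JetVec r E) → ℝ → Z}

/-- A path solution of the tracking problem. -/
abbrev IsTrackSolution (σ : ℝ) (d : ℝ → P) (f : P × Z × E → E) (Op : (ℝ → JetVec r E) → ℝ → Z)
    (c T : ℝ) (α N : ℝ → ℝ) (xref x₀ : ℝ → JetVec r E) (b : ℝ) (x : ℝ → JetVec r E) : Prop :=
  IsPathSolution σ d Op (trackRhs f (funnelFun c T) α N xref)
    (trackDomain (funnelFun c T) α T xref) x₀ b x

/-- The assumptions on the data of the tracking problem. -/
structure TrackData (σ : ℝ) (d : ℝ → P) (f : P × Z × E → E) (Op : (ℝ → JetVec r E) → ℝ → Z)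
    (c T : ℝ) (α N : ℝ → ℝ) (xref : ℝ → JetVec r E) : Prop where
  r_pos : 0 < r
  σ_pos : 0 < σ
  T_pos : 0 < T
  c_pos : 0 < c
  f_cont : Continuous f
  d_mem : MemLp d ⊤ (volume.restrict (Ici 0))
  op : OperatorClass σ Op
  design : ControlDesign r c α N
  gain : ShellGain f α N
  xref_jet : IsJetOn xref (Ico 0 T)
  xref_bdd : ∃ C, ∀ t ∈ Ico 0 T, ‖xref t‖ ≤ C
  xref_prim : ∃ h : ℝ → E, MemLp h ⊤ (volume.restrict (Ico 0 T)) ∧ ∀ s ∈ Ico 0 T, ∀ t ∈ Ico 0 T,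
    coordL r E (r - 1) (xref t) = coordL r E (r - 1) (xref s) + ∫ τ in s..t, h τ

namespace TrackData

variable (D : TrackData σ d f Op c T α N xref)
include D

theorem isOpen : IsOpen (trackDomain (funnelFun c T) α T xref) :=
  isOpen_trackDomain D.T_pos D.design D.xref_jet.continuousOn

theorem continuousOn : ContinuousOn (trackRhs f (funnelFun c T) α N xref)
    {w : P × Z × ℝ × JetVec r E | w.2.2 ∈ trackDomain (funnelFun c T) α T xref} :=
  continuousOn_trackRhs D.T_pos D.r_pos D.c_pos D.f_cont D.design D.xref_jet.continuousOn

theorem intervalIntegrable (h : IsTrackSolution σ d f Op c T α N xref x₀ b x) :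
    IntervalIntegrable (fun s => trackRhs f (funnelFun c T) α N xref
      (d s, Op (stopAt x b) s, s, x s)) volume 0 b :=
  intervalIntegrable_rhs D.op D.σ_pos D.d_mem D.isOpen D.continuousOn h.nonneg h.continuousOn h.mem

theorem lt_of_mem (h : IsTrackSolution σ d f Op c T α N xref x₀ b x) : b < T :=
  (h.mem b ⟨h.nonneg, le_rfl⟩).1

theorem coordL_eq (h : IsTrackSolution σ d f Op c T α N xref x₀ b x) (k : ℕ) :
    ∀ t ∈ Icc 0 b, coordL r E k (x t) = coordL r E k (x 0) + ∫ s in (0 : ℝ)..t,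
      coordL r E k (trackRhs f (funnelFun c T) α N xref (d s, Op (stopAt x b) s, s, x s)) := by
  intro t ht
  have hi := (D.intervalIntegrable h).mono_set (c := 0) (d := t) (by
    rw [uIcc_of_le ht.1, uIcc_of_le h.nonneg]
    exact Icc_subset_Icc_right ht.2)
  rw [h.equation t ht, coordL_add_integral hi]

/-- All blocks but the last of the integral equation say that `x_k` is the primitive of the
continuous function `x_{k+1}`. -/
theorem isJetOn_Icc_zero (h : IsTrackSolution σ d f Op c T α N xref x₀ b x) :
    IsJetOn x (Icc 0 b) := by
  have : CompleteSpace E := FiniteDimensional.complete ℝ E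
  have hc : ContinuousOn x (Icc 0 b) := h.continuousOn.mono
      (Icc_subset_Icc_left (by linarith [D.σ_pos]))
  refine ⟨hc, fun k hk => hasDerivWithinAt_of_primitive h.nonneg
    ((coordL r E (k + 1)).continuous.comp_continuousOn hc) fun t ht => ?_⟩
  rw [D.coordL_eq h k t ht]
  simp only [coordL_trackRhs_of_lt hk]

theorem isJetOn_Icc (h : IsTrackSolution σ d f Op c T α N xref x₀ b x)
    (hx₀ : IsJetOn x₀ (Icc (-σ) 0)) : IsJetOn x (Icc (-σ) b) := by
  have hσ := D.σ_pos
  have hCE : CompleteSpace E := FiniteDimensional.complete ℝ E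
  refine ⟨h.continuousOn, fun k hk t _ => ?_⟩
  refine HasDerivWithinAt.union_Icc (b := 0) (fun ht => ?_)
    (fun ht => (D.isJetOn_Icc_zero h).hasDeriv k hk t ht) (by linarith) h.nonneg
  rw [h.initial ht]
  exact (hx₀.hasDeriv k hk t ht).congr_of_mem (fun s hs => by rw [h.initial hs]) ht

theorem isJetOn_error (hb : 0 < b) (hx : ∀ s ∈ Ico 0 b, IsTrackSolution σ d f Op c T α N xref x₀ s
    x) :
    IsJetOn (fun t => x t - xref t) (Ico 0 b) := by
  have hsub : Ico 0 b ⊆ Ico 0 T := by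
    intro t ht
    exact ⟨ht.1, D.lt_of_mem (hx t ht)⟩
  exact (isJetOn_Ico_of_Icc hb fun s hs => D.isJetOn_Icc_zero (hx s hs)).sub (D.xref_jet.mono hsub)

omit D in
theorem mem_errDomain (hx : ∀ s ∈ Ico 0 b, IsTrackSolution σ d f Op c T α N xref x₀ s x) :
    ∀ t ∈ Ico 0 b, (t, x t - xref t) ∈ errDomain (funnelFun c T) α T r := fun t ht =>
  (mem_trackDomain ht.1).1 ((hx t ht).mem t ⟨ht.1, le_rfl⟩)

end TrackData

end ClosedLoop

/-! ### Uniform bounds along a solution and its continuation up to `T`. -/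

namespace TrackData

variable {r : ℕ} {P Z E : Type*} [NormedAddCommGroup P] [NormedAddCommGroup Z]
  [NormedAddCommGroup E] [InnerProductSpace ℝ E] [ProperSpace P] [ProperSpace Z]
  [FiniteDimensional ℝ E]
  {f : P × Z × E → E} {c T σ b : ℝ} {α N : ℝ → ℝ} {xref x x₀ : ℝ → JetVec r E} {d : ℝ → P}
  {Op : (ℝ → JetVec r E) → ℝ → Z}
  (D : TrackData σ d f Op c T α N xref) (hb : 0 < b)
  (hx : ∀ s ∈ Ico 0 b, IsTrackSolution σ d f Op c T α N xref x₀ s x)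

include D hb hx

theorem le_of_solution : b ≤ T := by
  refine le_of_forall_lt fun s hs => ?_
  rcases lt_or_ge s 0 with h0 | h0
  · exact h0.trans D.T_pos
  · exact D.lt_of_mem (hx s ⟨h0, hs⟩)

theorem exists_bound_path : ∃ C > 0, ∀ t ∈ Ico (-σ) b, ‖x t‖ ≤ C := by
  have hbT := D.le_of_solution hb hx
  have hcoord : ∀ k, ∃ C, k < r → ∀ t ∈ Ico 0 b, ‖coordL r E k (x t - xref t)‖ ≤ C * (T - t) := by
    intro k
    by_cases hk : k < r
    · obtain ⟨C, hC⟩ := exists_bound_coordL D.c_pos hb hbT D.design (D.isJetOn_error hb hx)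
        (mem_errDomain hx) hk
      exact ⟨C, fun _ => hC⟩
    · exact ⟨0, fun h => absurd h hk⟩
  choose C hC using hcoord
  set B := (∑ k ∈ Finset.range r, |C k|) * T with hB
  have hη : ∀ t ∈ Ico 0 b, ‖x t - xref t‖ ≤ Real.sqrt (r * B ^ 2) := by
    intro t ht
    refine norm_stateVec_le fun k hk => (hC k hk t ht).trans ?_
    have h1 : |C k| ≤ ∑ k ∈ Finset.range r, |C k| :=
      Finset.single_le_sum (f := fun k => |C k|) (fun _ _ => abs_nonneg _) (Finset.mem_range.2 hk)
    have h2 : 0 < T - t := sub_pos.2 (ht.2.trans_le hbT)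
    calc C k * (T - t) ≤ |C k| * (T - t) := by gcongr; exact le_abs_self _
      _ ≤ B := by
        rw [hB]
        gcongr
        linarith [ht.1]
  obtain ⟨Cr, hCr⟩ := D.xref_bdd
  obtain ⟨C₀, hC₀⟩ := isCompact_Icc.exists_bound_of_continuousOn (hx 0 ⟨le_rfl, hb⟩).continuousOn
  refine ⟨max (max C₀ (Real.sqrt (r * B ^ 2) + Cr)) 1, by positivity, fun t ht => ?_⟩
  refine le_trans ?_ (le_max_left _ _)
  rcases le_total t 0 with h0 | h0
  · exact (hC₀ t ⟨ht.1, h0⟩).trans (le_max_left _ _)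
  · refine le_trans ?_ (le_max_right _ _)
    have h1 := hη t ⟨h0, ht.2⟩
    have h2 := hCr t ⟨h0, ht.2.trans_le hbT⟩
    have h3 := norm_le_norm_add_norm_sub' (x t) (xref t)
    linarith

/-- A stopped path obeys the bound of the whole path, so the constant is the same for all stopping
times. -/
theorem exists_ae_bound_operator : ∃ C, ∀ s ∈ Ico 0 b,
    ∀ᵐ t ∂(volume.restrict (Ici 0)), ‖d t‖ ≤ C ∧ ‖Op (stopAt x s) t‖ ≤ C := by
  have hσ := D.σ_pos
  obtain ⟨C, hC, hxC⟩ := D.exists_bound_path hb hx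
  obtain ⟨C₂, -, hC₂⟩ := D.op.bibo C hC
  obtain ⟨C₁, hC₁⟩ := D.d_mem.exists_ae_bound
  refine ⟨max C₁ C₂, fun s hs => ?_⟩
  have hs1 := hs.1
  filter_upwards [hC₁, hC₂ (stopAt x s) (continuousOn_stopAt (by linarith) (hx s hs).continuousOn)
    fun t ht => hxC _ ⟨le_min ht (by linarith), (min_le_right _ _).trans_lt hs.2⟩] with t h1 h2
  exact ⟨h1.trans (le_max_left _ _), h2.trans (le_max_right _ _)⟩

omit hb in
-- The corrected derivative is `g` in `e_r = φ g`. Its rate is the system's right-hand side, minus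
-- the `r`-th derivative of the reference, plus the rate of the correction term; it is stated in
-- integral form because the first two need exist only a.e.
theorem primitive_corrected {s : ℝ} (hs : s ∈ Ico 0 b) {h : ℝ → E}
    (hh : MemLp h ⊤ (volume.restrict (Ico 0 T)))
    (hprim : ∀ s ∈ Ico 0 T, ∀ t ∈ Ico 0 T,
      coordL r E (r - 1) (xref t) = coordL r E (r - 1) (xref s) + ∫ τ in s..t, h τ) :
    IntervalIntegrable (fun τ => coordL r E (r - 1) (trackRhs f (funnelFun c T) α N xref
      (d τ, Op (stopAt x s) τ, τ, x τ)) - h τ +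
        totalDeriv (corrFun (funnelFun c T) α (r - 1)) (τ, x τ - xref τ)) volume 0 s ∧
    ∀ t ∈ Icc 0 s, coordL r E (r - 1) (x t - xref t) +
        corrFun (funnelFun c T) α (r - 1) (t, x t - xref t) =
      coordL r E (r - 1) (x 0 - xref 0) + corrFun (funnelFun c T) α (r - 1) (0, x 0 - xref 0) +
      ∫ τ in (0 : ℝ)..t, (coordL r E (r - 1) (trackRhs f (funnelFun c T) α N xref
      (d τ, Op (stopAt x s) τ, τ, x τ)) - h τ +
        totalDeriv (corrFun (funnelFun c T) α (r - 1)) (τ, x τ - xref τ)) := by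
  have hCE : CompleteSpace E := FiniteDimensional.complete ℝ E
  have hr := D.r_pos
  have hb : 0 < b := hs.1.trans_lt hs.2
  have hbT := D.le_of_solution hb hx
  have hη := D.isJetOn_error hb hx
  have hdom := mem_errDomain hx
  have hsub : Icc 0 s ⊆ Ico 0 b := fun t ht => ⟨ht.1, ht.2.trans_lt hs.2⟩
  have hi1 : IntervalIntegrable (fun τ => coordL r E (r - 1) (trackRhs f (funnelFun c T) α N xref
      (d τ, Op (stopAt x s) τ, τ, x τ))) volume 0 s := by
    have := D.intervalIntegrable (hx s hs)
    exact ⟨(coordL r E (r - 1)).integrable_comp this.1, (coordL r E (r - 1)).integrable_comp this.2⟩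
  have hi2 : IntervalIntegrable h volume 0 s :=
    (intervalIntegrable_of_memLp_top D.T_pos.le (Or.inr rfl) hh).mono_set (by
      rw [uIcc_of_le hs.1, uIcc_of_le D.T_pos.le]
      exact Icc_subset_Icc_right (hs.2.le.trans hbT))
  have htd : ContinuousOn (fun τ => totalDeriv (corrFun (funnelFun c T) α (r - 1))
      (τ, x τ - xref τ))
      (Icc 0 s) := by
    have hcd := contDiffOn_corrFun (r := r) (E := E) (contDiffOn_funnelFun c T) D.design.α_smooth
      (Nat.sub_le r 1)
    rw [show r - (r - 1) = 1 by omega] at hcd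
    have hfd := hcd.continuousOn_fderiv_of_isOpen
      (isOpen_errDomain (contDiffOn_funnelFun c T) D.design.α_smooth (Nat.sub_le r 1)) (by simp)
    have hxc : ContinuousOn (fun τ => x τ - xref τ) (Icc 0 s) := hη.continuousOn.mono hsub
    have hpt : ContinuousOn (fun τ => (τ, x τ - xref τ)) (Icc 0 s) := continuousOn_id.prodMk hxc
    exact (hfd.comp hpt fun τ hτ => errDomain_anti (Nat.sub_le r 1) (hdom τ (hsub hτ))).clm_apply
      (continuousOn_const.prodMk ((shiftL r E).continuous.comp_continuousOn hxc))
  have hi3 : IntervalIntegrable (fun τ => totalDeriv (corrFun (funnelFun c T) α (r - 1))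
      (τ, x τ - xref τ)) volume 0 s :=
    ContinuousOn.intervalIntegrable (by rwa [uIcc_of_le hs.1])
  refine ⟨(hi1.sub hi2).add hi3, fun t ht => ?_⟩
  have hmono : uIcc 0 t ⊆ uIcc 0 s := by
    rw [uIcc_of_le ht.1, uIcc_of_le hs.1]
    exact Icc_subset_Icc_right ht.2
  have hsubt : Icc 0 t ⊆ Ico 0 b := (Icc_subset_Icc_right ht.2).trans hsub
  have hcorr := (primitive_of_hasDerivWithinAt ht.1
    (fun τ hτ => (hasDerivWithinAt_corrFun (contDiffOn_funnelFun c T) D.design.α_smooth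
      (by omega : r - 1 < r) (hη.continuousOn τ (hsubt hτ))
      (fun k hk => hη.hasDeriv k hk τ (hsubt hτ))
      (errDomain_anti (Nat.sub_le r 1) (hdom τ (hsubt hτ)))).mono hsubt)
    (htd.mono (Icc_subset_Icc_right ht.2))).2
  rw [intervalIntegral.integral_add ((hi1.mono_set hmono).sub (hi2.mono_set hmono))
    (hi3.mono_set hmono), intervalIntegral.integral_sub (hi1.mono_set hmono) (hi2.mono_set hmono),
    map_sub, map_sub, D.coordL_eq (hx s hs) (r - 1) t ht, hprim 0 ⟨le_rfl, D.T_pos⟩ t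
      ⟨ht.1, (hsubt ⟨ht.1, le_rfl⟩).2.trans_le hbT⟩, hcorr]
  abel

/-- The last error variable stays away from the funnel boundary. -/
theorem exists_bound_lastErr : ∃ κ < 1, ∀ t ∈ Ico 0 b,
    ‖errFun (funnelFun c T) α (r - 1) (t, x t - xref t)‖ ^ 2 ≤ κ := by
  have hr := D.r_pos
  have hbT := D.le_of_solution hb hx
  have hη := D.isJetOn_error hb hx
  have hdom := mem_errDomain hx
  obtain ⟨C, hC⟩ := D.exists_ae_bound_operator hb hx
  obtain ⟨h, hh, hprim⟩ := D.xref_prim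
  obtain ⟨Ch, hCh⟩ := hh.exists_ae_bound
  obtain ⟨Cd, hCd⟩ := exists_bound_totalDeriv_corrFun D.c_pos hr hb hbT D.design hη hdom
  have h0 : ‖errFun (funnelFun c T) α (r - 1) (0, x 0 - xref 0)‖ < 1 :=
    (hdom 0 ⟨le_rfl, hb⟩).2 (r - 1) (by omega)
  -- The level `c + (Ch + Cd)` pays for the reference and the correction term and leaves the margin
  -- `-c` required by the barrier.
  obtain ⟨κ, κ', hκ0, hκκ, hκ1, hgain⟩ := D.gain C
    (‖errFun (funnelFun c T) α (r - 1) (0, x 0 - xref 0)‖ ^ 2) (c + (Ch + Cd))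
    (by rw [sq_lt_one_iff₀ (norm_nonneg _)]; exact h0)
  refine ⟨κ, hκκ.trans hκ1, fun t ht => ?_⟩
  -- The barrier works on compact intervals `[0, s]`; `κ` was fixed before `s`, so the bound is
  -- uniform up to `b`.
  obtain ⟨s, hts, hsb⟩ := exists_between ht.2
  have hs : s ∈ Ico 0 b := ⟨ht.1.trans hts.le, hsb⟩
  obtain ⟨hi, hp⟩ := D.primitive_corrected hx hs hh hprim
  refine norm_sq_le_of_inner_le D.c_pos (hsb.trans_le hbT) hs.1 hκκ hκ1.le hi hp hκ0 ?_ t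
    ⟨ht.1, hts⟩
  have hsT : Icc 0 s ⊆ Ico 0 T := fun τ hτ => ⟨hτ.1, hτ.2.trans_lt (hsb.trans_le hbT)⟩
  filter_upwards [ae_restrict_of_ae_restrict_of_subset Icc_subset_Ici_self (hC s hs),
    ae_restrict_of_ae_restrict_of_subset hsT hCh, ae_restrict_mem measurableSet_Icc]
    with τ h1 h2 hτ h3 h4
  set e := errFun (funnelFun c T) α (r - 1) (τ, x τ - xref τ) with he
  have h5 := hgain _ _ e h1.1 h1.2 h3 h4
  have h6 := hCd τ ⟨hτ.1, hτ.2.trans_lt hsb⟩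
  have h7 : ‖e‖ ≤ 1 := ((hdom τ ⟨hτ.1, hτ.2.trans_lt hsb⟩).2 (r - 1) (by omega)).le
  change inner ℝ e _ ≤ _
  rw [coordL_trackRhs_last hr, max_eq_right hτ.1, inner_add_right, inner_sub_right]
  change inner ℝ e (f (d τ, Op (stopAt x s) τ, N (α (‖e‖ ^ 2)) • e)) - _ + _ ≤ _
  have h8 := abs_le.1 ((abs_real_inner_le_norm e (h τ)).trans
    (mul_le_mul h7 h2 (norm_nonneg _) zero_le_one))
  have h9 := abs_le.1 ((abs_real_inner_le_norm e
    (totalDeriv (corrFun (funnelFun c T) α (r - 1)) (τ, x τ - xref τ))).trans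
    (mul_le_mul h7 h6 (norm_nonneg _) zero_le_one))
  linarith [h8.1, h9.2]

theorem exists_bound_control : ∃ C, ∀ t ∈ Ico 0 b,
    ‖funnelControl (funnelFun c T) α N (t, x t - xref t)‖ ≤ C := by
  have hr := D.r_pos
  have hc := D.c_pos
  obtain ⟨κ, hκ, hbd⟩ := D.exists_bound_lastErr hb hx
  have hα : ContinuousOn α (Icc 0 κ) := D.design.α_smooth.continuousOn.mono fun s hs =>
    ⟨hs.1, hs.2.trans_lt hκ⟩
  obtain ⟨C, hC⟩ := isCompact_Icc.exists_bound_of_continuousOn (D.design.N_cont.comp hα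
    fun s hs => le_trans (by positivity) (D.design.le_α ⟨hs.1, hs.2.trans_lt hκ⟩))
  refine ⟨C, fun t ht => ?_⟩
  have h1 := hC _ ⟨by positivity, hbd t ht⟩
  have h2 := (mem_errDomain hx t ht).2 (r - 1) (by omega)
  rw [funnelControl, norm_smul]
  calc _ ≤ C * 1 := mul_le_mul h1 h2.le (norm_nonneg _) ((norm_nonneg _).trans h1)
    _ = C := mul_one C

theorem exists_bound_system : ∃ M, ∀ s ∈ Ico 0 b, ∀ᵐ t ∂(volume.restrict (Icc 0 s)),
    ‖f (d t, Op (stopAt x s) t, funnelControl (funnelFun c T) α N (t, x t - xref t))‖ ≤ M := by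
  have : ProperSpace E := FiniteDimensional.proper ℝ E
  obtain ⟨Cu, hCu⟩ := D.exists_bound_control hb hx
  obtain ⟨C, hC⟩ := D.exists_ae_bound_operator hb hx
  have hcomp : IsCompact (Metric.closedBall (0 : P) C ×ˢ Metric.closedBall (0 : Z) C ×ˢ
      Metric.closedBall (0 : E) Cu) :=
    (isCompact_closedBall _ _).prod ((isCompact_closedBall _ _).prod (isCompact_closedBall _ _))
  obtain ⟨M, hM⟩ := hcomp.exists_bound_of_continuousOn D.f_cont.continuousOn
  refine ⟨M, fun s hs => ?_⟩
  filter_upwards [ae_restrict_of_ae_restrict_of_subset Icc_subset_Ici_self (hC s hs),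
    ae_restrict_mem measurableSet_Icc] with t h1 ht
  exact hM _ ⟨mem_closedBall_zero_iff.2 h1.1, mem_closedBall_zero_iff.2 h1.2,
    mem_closedBall_zero_iff.2 (hCu t ⟨ht.1, ht.2.trans_lt hs.2⟩)⟩

/-- The path and the system's right-hand side are bounded up to `b`. This provides the limit of `x`
at `b`. -/
theorem exists_lipschitz : ∃ K, LipschitzOnWith K x (Ico 0 b) := by
  obtain ⟨C, hC, hxC⟩ := D.exists_bound_path hb hx
  obtain ⟨M, hM⟩ := D.exists_bound_system hb hx
  set B := ‖shiftL r E‖ * C + ‖lastL r E‖ * M with hB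
  have hσ := D.σ_pos
  have key : ∀ s ∈ Ico 0 b, ∀ t ∈ Ico 0 b, s ≤ t → ‖x t - x s‖ ≤ B * (t - s) := by
    intro s hs t ht hst
    have h := hx t ht
    have hi := D.intervalIntegrable h
    have h1 := hi.mono_set (c := 0) (d := s) (by
      rw [uIcc_of_le hs.1, uIcc_of_le ht.1]; exact Icc_subset_Icc_right hst)
    have h2 := hi.mono_set (c := s) (d := t) (by
      rw [uIcc_of_le hst, uIcc_of_le ht.1]; exact Icc_subset_Icc_left hs.1)
    rw [h.equation t ⟨ht.1, le_rfl⟩, h.equation s ⟨hs.1, hst⟩,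
      ← intervalIntegral.integral_add_adjacent_intervals h1 h2, add_sub_add_left_eq_sub,
      add_sub_cancel_left]
    refine norm_integral_le_of_ae_bound (a := 0) (b := t) hs.1 hst le_rfl ?_
    filter_upwards [hM t ht, ae_restrict_mem measurableSet_Icc] with τ h3 hτ
    have h4 := hxC τ ⟨by linarith [hτ.1], hτ.2.trans_lt ht.2⟩
    simp only [trackRhs, max_eq_right hτ.1]
    refine (norm_add_le _ _).trans (add_le_add ?_ ?_)
    · exact ((shiftL r E).le_opNorm _).trans (by gcongr)
    · exact ((lastL r E).le_opNorm _).trans (by gcongr)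
  refine ⟨B.toNNReal, LipschitzOnWith.of_dist_le_mul fun s hs t ht => ?_⟩
  have hle : ∀ l : ℝ, 0 ≤ l → B * l ≤ B.toNNReal * l := fun l hl =>
    mul_le_mul_of_nonneg_right (Real.le_coe_toNNReal B) hl
  rcases le_total s t with hst | hst
  · rw [dist_comm, dist_eq_norm, dist_comm s t, Real.dist_eq, abs_of_nonneg (by linarith)]
    exact (key s hs t ht hst).trans (hle _ (by linarith))
  · rw [dist_eq_norm, Real.dist_eq, abs_of_nonneg (by linarith)]
    exact (key t ht s hs hst).trans (hle _ (by linarith))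

theorem exists_continuous_extension :
    ∃ x' : ℝ → JetVec r E, ContinuousOn x' (Ici 0) ∧ EqOn x x' (Ico 0 b) := by
  obtain ⟨K, hK⟩ := D.exists_lipschitz hb hx
  obtain ⟨x', hx', he⟩ := hK.extend_finite_dimension
  exact ⟨x', hx'.continuous.continuousOn, he⟩

/-- The bounds below one pass to the limit. This is done for one signal after another, since `errFun
n` is known to be continuous only where the earlier signals are below one. -/
theorem mem_trackDomain_of_tendsto (hbT : b < T) {l : JetVec r E}
    (hl : Tendsto x (𝓝[<] b) (𝓝 l)) : (b, l) ∈ trackDomain (funnelFun c T) α T xref := by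
  have hr := D.r_pos
  have hη := D.isJetOn_error hb hx
  have hdom := mem_errDomain hx
  rw [mem_trackDomain hb.le]
  have href : Tendsto xref (𝓝[<] b) (𝓝 (xref b)) :=
    (D.xref_jet.continuousOn.continuousAt (Ico_mem_nhds hb hbT)).tendsto.mono_left
      nhdsWithin_le_nhds
  have hlim : Tendsto (fun t => (t, x t - xref t)) (𝓝[<] b) (𝓝 (b, l - xref b)) :=
    (tendsto_id.mono_left nhdsWithin_le_nhds).prodMk_nhds (hl.sub href)
  have hbound : ∀ k < r, ∃ ε < 1, ∀ t ∈ Ico 0 b,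
      ‖errFun (funnelFun c T) α k (t, x t - xref t)‖ ^ 2 ≤ ε := by
    intro k hk
    rcases (Nat.le_sub_one_of_lt hk).eq_or_lt with rfl | hk'
    · exact D.exists_bound_lastErr hb hx
    · exact exists_bound_errFun_lt_one D.c_pos hb hbT.le D.design hη hdom (by omega)
  suffices ∀ n ≤ r, (b, l - xref b) ∈ errDomain (funnelFun c T) α T n from this r le_rfl
  intro n
  induction n with
  | zero => exact fun _ => ⟨hbT, by simp⟩
  | succ n ih =>
    intro hn
    refine mem_errDomain_succ.2 ⟨ih (by omega), ?_⟩
    have hcont : ContinuousAt (errFun (funnelFun c T) α n) (b, l - xref b) :=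
      (contDiffOn_errFun (contDiffOn_funnelFun c T) D.design.α_smooth
        (by omega : n ≤ r)).continuousOn.continuousAt
        ((isOpen_errDomain (contDiffOn_funnelFun c T) D.design.α_smooth
          (by omega : n ≤ r)).mem_nhds (ih (by omega)))
    obtain ⟨ε, hε, hbd⟩ := hbound n (by omega)
    have hle : ‖errFun (funnelFun c T) α n (b, l - xref b)‖ ^ 2 ≤ ε := by
      refine le_of_tendsto ((hcont.tendsto.comp hlim).norm.pow 2) ?_
      filter_upwards [Ico_mem_nhdsLT hb] with t ht using hbd t ht
    rw [← sq_lt_one_iff₀ (norm_nonneg _)]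
    exact hle.trans_lt hε

/-- A solution on `[-σ,b)` with `b < T` can be continued beyond `b`. -/
theorem exists_extension_of_lt (hbT : b < T) : ∃ b' > b, ∃ x', EqOn x x' (Ico (-σ) b) ∧
    IsTrackSolution σ d f Op c T α N xref x₀ b' x' := by
  have hσ := D.σ_pos
  obtain ⟨x₁, hx₁, he⟩ := D.exists_continuous_extension hb hx
  have hl : Tendsto x (𝓝[<] b) (𝓝 (x₁ b)) := by
    refine Tendsto.congr' ?_ ((hx₁.continuousAt (Ici_mem_nhds hb)).tendsto.mono_left
      nhdsWithin_le_nhds)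
    filter_upwards [Ico_mem_nhdsLT hb] with t ht using (he ht).symm
  have h := IsPathSolution.of_tendsto D.op hσ D.d_mem D.isOpen D.continuousOn hb hx hl
    (D.mem_trackDomain_of_tendsto hb hx hbT hl)
  obtain ⟨b', hb', x', hxx, hx'⟩ := h.exists_extension D.op hσ D.d_mem D.isOpen D.continuousOn
  refine ⟨b', hb', x', fun t ht => ?_, hx'⟩
  rw [hxx ⟨ht.1, ht.2.le⟩, Function.update_of_ne ht.2.ne]

omit hb hx in
/-- A solution exists up to time `T`. -/
theorem exists_global_solution (h₀ : ContinuousOn x₀ (Icc (-σ) 0))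
    (h₀Ω : (0, x₀ 0) ∈ trackDomain (funnelFun c T) α T xref) :
    ∃ x, ∀ s ∈ Ico 0 T, IsTrackSolution σ d f Op c T α N xref x₀ s x := by
  obtain ⟨b, x, hb, hbT, hx, hmax⟩ := exists_maximal_pathSolution D.op D.σ_pos D.d_mem D.isOpen
    D.continuousOn (fun p hp => hp.1) h₀ h₀Ω
  rcases hbT.eq_or_lt with rfl | hlt
  · exact ⟨x, hx⟩
  · obtain ⟨b', hb', x', he, hx'⟩ := D.exists_extension_of_lt hb hx hlt
    exact absurd (hmax b' x' (fun s hs => hx'.congr_of_le D.op D.σ_pos hs.1 hs.2.le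
      fun _ _ => rfl) hb'.le he) (not_le.2 hb')

end TrackData

/-! ### Translation between closed-loop solutions and path solutions. -/

section Bridge

variable {r m p q : ℕ} {f : Vec p × Vec q × Vec m → Vec m} {c T σ b : ℝ} {α N : ℝ → ℝ}
  {d : ℝ → Vec p} {Op : (ℝ → StateVec r m) → ℝ → Vec q} {yref y0 y : ℝ → Vec m} {I J : Set ℝ}
  {η : ℝ → JetVec r (Vec m)} {e : ℝ → Vec m}

/-- Induction on the signals: `errVar (n + 1)` may be replaced by `errFun n` once the first `n`
bounds are known. -/
theorem mem_errDomain_of_errVar (hα : ControlDesign r c α N) (hJ : UniqueDiffOn ℝ J)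
    (hη : IsJetOn η J) (he : EqOn e (fun s => coordL r (Vec m) 0 (η s)) J) {t : ℝ} (ht : t ∈ J)
    (htT : t < T) (h : ∀ k, 1 ≤ k → k ≤ r → ‖errVar (funnelFun c T) α J e k t‖ < 1) :
    (t, η t) ∈ errDomain (funnelFun c T) α T r := by
  suffices ∀ n ≤ r, (t, η t) ∈ errDomain (funnelFun c T) α T n from this r le_rfl
  intro n
  induction n with
  | zero => exact fun _ => ⟨htT, by simp⟩
  | succ n ih =>
    intro hn
    refine mem_errDomain_succ.2 ⟨ih (by omega), ?_⟩
    have h1 := (errVar_eventuallyEq (contDiffOn_funnelFun c T) hα.α_smooth hJ hη he ht n (by omega)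
      (ih (by omega))).eq_of_nhdsWithin ht
    rw [← h1]
    exact h (n + 1) (by omega) hn

theorem errVar_eq_errFun (hα : ControlDesign r c α N) (hJ : UniqueDiffOn ℝ J)
    (hη : IsJetOn η J) (he : EqOn e (fun s => coordL r (Vec m) 0 (η s)) J) {t : ℝ} (ht : t ∈ J)
    (h : (t, η t) ∈ errDomain (funnelFun c T) α T r) {k : ℕ} (hk1 : 1 ≤ k) (hk : k ≤ r) :
    errVar (funnelFun c T) α J e k t = errFun (funnelFun c T) α (k - 1) (t, η t) := by
  have h1 := (errVar_eventuallyEq (contDiffOn_funnelFun c T) hα.α_smooth hJ hη he ht (k - 1)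
    (by omega) (errDomain_anti (by omega : k - 1 ≤ r) h)).eq_of_nhdsWithin ht
  rwa [Nat.sub_add_cancel hk1] at h1

theorem feedback_eq_funnelControl (hr : 0 < r) (hα : ControlDesign r c α N) (hJ : UniqueDiffOn ℝ J)
    (hη : IsJetOn η J) (he : EqOn e (fun s => coordL r (Vec m) 0 (η s)) J) {t : ℝ} (ht : t ∈ J)
    (h : (t, η t) ∈ errDomain (funnelFun c T) α T r) :
    feedback r (funnelFun c T) α N J e t = funnelControl (funnelFun c T) α N (t, η t) := by
  rw [feedback, funnelControl, errVar_eq_errFun hα hJ hη he ht h hr le_rfl]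

theorem stateOf_eq_jetOf (y : ℝ → Vec m) (I : Set ℝ) : stateOf r y I = jetOf r y I := rfl

theorem coordL_zero_jetOf (hr : 0 < r) (y : ℝ → Vec m) (I : Set ℝ) (t : ℝ) :
    coordL r (Vec m) 0 (jetOf r y I t) = y t := by
  rw [coordL_jetOf y I t hr, iteratedDerivWithin_zero]

theorem jetOf_eqOn_subset {s u : Set ℝ} (hs : UniqueDiffOn ℝ s) (hu : UniqueDiffOn ℝ u)
    (hsu : s ⊆ u) (hy : ContDiffOn ℝ ((r - 1 : ℕ) : WithTop ℕ∞) y u) (hyy : EqOn y y0 s) :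
    EqOn (jetOf r y u) (jetOf r y0 s) s := by
  intro t ht
  refine stateVec_ext fun k hk => ?_
  rw [coordL_jetOf _ _ _ hk, coordL_jetOf _ _ _ hk,
    ← iteratedDerivWithin_eqOn_subset hs hu hsu hy (by omega : k ≤ r - 1) ht]
  exact iteratedDerivWithin_congr hyy ht

theorem IsSolutionInterval.uniqueDiffOn (hσ : 0 < σ) (hI : IsSolutionInterval σ I) :
    UniqueDiffOn ℝ I := by
  rcases hI with ⟨b, hb, rfl⟩ | ⟨b, hb, rfl⟩ | rfl
  · exact uniqueDiffOn_Icc (by linarith)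
  · exact uniqueDiffOn_Ico _ _
  · exact uniqueDiffOn_Ici _

theorem IsSolutionInterval.uniqueDiffOn_inter (hσ : 0 < σ) (hI : IsSolutionInterval σ I) :
    UniqueDiffOn ℝ (I ∩ Ici 0) := by
  rcases hI with ⟨b, hb, rfl⟩ | ⟨b, hb, rfl⟩ | rfl
  · rw [← Ici_inter_Iic, inter_right_comm, Ici_inter_Ici, max_eq_right (by linarith), Ici_inter_Iic]
    exact uniqueDiffOn_Icc hb
  · rw [Ico_inter_Ici, max_eq_right (by linarith)]
    exact uniqueDiffOn_Ico _ _
  · rw [Ici_inter_Ici, max_eq_right (by linarith)]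
    exact uniqueDiffOn_Ici _

theorem IsSolutionInterval.Icc_subset (hI : IsSolutionInterval σ I) {t : ℝ} (ht : t ∈ I) :
    Icc (-σ) t ⊆ I := by
  rcases hI with ⟨b, hb, rfl⟩ | ⟨b, hb, rfl⟩ | rfl
  · exact Icc_subset_Icc_right ht.2
  · exact Icc_subset_Ico_right ht.2
  · exact Icc_subset_Ici_self

theorem IsSolutionInterval.zero_mem (hσ : 0 < σ) (hI : IsSolutionInterval σ I) : (0 : ℝ) ∈ I := by
  rcases hI with ⟨b, hb, rfl⟩ | ⟨b, hb, rfl⟩ | rfl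
  · exact ⟨by linarith, hb.le⟩
  · exact ⟨by linarith, hb⟩
  · exact mem_Ici.2 (by linarith)

variable (D : TrackData σ d f Op c T α N (jetOf r yref (Ico 0 T)))
include D

/-- The jet of a solution of the closed loop solves the associated first order problem. -/
theorem IsClosedLoopSolution.isTrackSolution
    (h : IsClosedLoopSolution σ d f Op c T α N yref y0 I y) (hb : b ∈ I ∩ Ici 0) :
    IsTrackSolution σ d f Op c T α N (jetOf r yref (Ico 0 T)) (jetOf r y0 (Icc (-σ) 0)) b
      (jetOf r y I) := by
  have hσ := D.σ_pos
  have hr := D.r_pos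
  have hb0 : 0 ≤ b := hb.2
  have hI := h.interval
  have hIu := hI.uniqueDiffOn hσ
  have hJu := hI.uniqueDiffOn_inter hσ
  have hx : IsJetOn (jetOf r y I) I := isJetOn_jetOf hIu h.smooth
  have hJT : I ∩ Ici 0 ⊆ Ico 0 T := fun t ht => ⟨ht.2, h.time_lt t ht⟩
  have hη : IsJetOn (fun t => jetOf r y I t - jetOf r yref (Ico 0 T) t) (I ∩ Ici 0) :=
    (hx.mono inter_subset_left).sub (D.xref_jet.mono hJT)
  have he : EqOn (fun s => y s - yref s)
      (fun s => coordL r (Vec m) 0 (jetOf r y I s - jetOf r yref (Ico 0 T) s)) (I ∩ Ici 0) := by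
    intro s _
    simp only [map_sub, coordL_zero_jetOf hr]
  have hmem : ∀ t ∈ I ∩ Ici 0, (t, jetOf r y I t - jetOf r yref (Ico 0 T) t) ∈
      errDomain (funnelFun c T) α T r := fun t ht =>
    mem_errDomain_of_errVar D.design hJu hη he ht (h.time_lt t ht) (h.in_domain t ht)
  have hsub : Icc (-σ) b ⊆ I := hI.Icc_subset hb.1
  have hsubJ : Icc 0 b ⊆ I ∩ Ici 0 := fun t ht => ⟨hsub ⟨by linarith [ht.1], ht.2⟩, ht.1⟩
  have hcont : ContinuousOn (jetOf r y I) (Icc (-σ) b) := hx.continuousOn.mono hsub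
  have hmem' : ∀ t ∈ Icc 0 b, (t, jetOf r y I t) ∈ trackDomain (funnelFun c T) α T
      (jetOf r yref (Ico 0 T)) := fun t ht => (mem_trackDomain ht.1).2 (hmem t (hsubJ ht))
  refine ⟨hb0, hcont, jetOf_eqOn_subset (uniqueDiffOn_Icc (by linarith)) hIu
    ((Icc_subset_Icc_right hb0).trans hsub) h.smooth h.initial, hmem', fun t ht => ?_⟩
  have hi := (intervalIntegrable_rhs D.op hσ D.d_mem D.isOpen D.continuousOn hb0 hcont
      hmem').mono_set
    (c := 0) (d := t) (by
      rw [uIcc_of_le ht.1, uIcc_of_le hb0]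
      exact Icc_subset_Icc_right ht.2)
  refine stateVec_ext fun k hk => ?_
  rw [coordL_add_integral hi]
  have hsubt : Icc 0 t ⊆ I := fun s hs => (hsubJ ⟨hs.1, hs.2.trans ht.2⟩).1
  -- The lower blocks follow from the jet property; only the last one uses the differential
  -- equation.
  by_cases hk1 : k + 1 < r
  · simp only [coordL_trackRhs_of_lt hk1]
    exact (primitive_of_hasDerivWithinAt ht.1
      (fun s hs => (hx.hasDeriv k hk1 s (hsubt hs)).mono hsubt)
      ((coordL r (Vec m) (k + 1)).continuous.comp_continuousOn (hx.continuousOn.mono hsubt))).2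
  · obtain rfl : k = r - 1 := by omega
    rcases ht.1.eq_or_lt with rfl | ht0
    · simp
    have htI : t ∈ I ∩ Ioi 0 := ⟨(hsubJ ht).1, ht0⟩
    rw [coordL_jetOf _ _ _ hk, coordL_jetOf _ _ _ hk, h.equation t htI]
    congr 1
    -- The closed-loop equation stops the path at `t`, the path equation at `b`; on `[0, t)`
    -- causality identifies the operator values.
    refine integral_congr_of_ae_Ico le_rfl ht.1 le_rfl ?_
    filter_upwards [D.op.stopAt_ae_eq hσ ht.1 le_rfl ht.2
      (hcont.mono (Icc_subset_Icc_right ht.2)) hcont fun _ _ => rfl,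
      ae_restrict_mem measurableSet_Ico] with s hs hs'
    have hsJ : s ∈ I ∩ Ici 0 := hsubJ ⟨hs'.1, hs'.2.le.trans ht.2⟩
    rw [coordL_trackRhs_last hr, max_eq_right hs'.1, ← hs,
      feedback_eq_funnelControl hr D.design hJu hη he hsJ (hmem s hsJ)]
    rfl

/-- A path solution is the jet of a solution of the closed loop. -/
theorem isClosedLoopSolution_of_isTrackSolution (hb : 0 < b)
    (hy0 : ContDiffOn ℝ ((r - 1 : ℕ) : WithTop ℕ∞) y0 (Icc (-σ) 0))
    (hI : I = Icc (-σ) b ∨ I = Ico (-σ) b) {x : ℝ → JetVec r (Vec m)}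
    (h : ∀ s ∈ I ∩ Ici 0, IsTrackSolution σ d f Op c T α N (jetOf r yref (Ico 0 T))
      (jetOf r y0 (Icc (-σ) 0)) s x) :
    IsClosedLoopSolution σ d f Op c T α N yref y0 I (fun t => coordL r (Vec m) 0 (x t)) := by
  have hσ := D.σ_pos
  have hr := D.r_pos
  have hI' : IsSolutionInterval σ I := hI.elim (fun h => Or.inl ⟨b, hb, h⟩)
    fun h => Or.inr (Or.inl ⟨b, hb, h⟩)
  have hIu := hI'.uniqueDiffOn hσ
  have hJu := hI'.uniqueDiffOn_inter hσ
  have h0I : (0 : ℝ) ∈ I := hI'.zero_mem hσ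
  have hx₀ : IsJetOn (jetOf r y0 (Icc (-σ) 0)) (Icc (-σ) 0) :=
    isJetOn_jetOf (uniqueDiffOn_Icc (by linarith)) hy0
  have hx : IsJetOn x I := by
    rcases hI with rfl | rfl
    · exact D.isJetOn_Icc (h b ⟨⟨by linarith, le_rfl⟩, hb.le⟩) hx₀
    · exact isJetOn_Ico_of_Icc hb fun s hs =>
        D.isJetOn_Icc (h s ⟨⟨by linarith [hs.1], hs.2⟩, hs.1⟩) hx₀
  have hJT : I ∩ Ici 0 ⊆ Ico 0 T := fun t ht => ⟨ht.2, D.lt_of_mem (h t ht)⟩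
  have hη : IsJetOn (fun t => x t - jetOf r yref (Ico 0 T) t) (I ∩ Ici 0) :=
    (hx.mono inter_subset_left).sub (D.xref_jet.mono hJT)
  have he : EqOn (fun s => coordL r (Vec m) 0 (x s) - yref s)
      (fun s => coordL r (Vec m) 0 (x s - jetOf r yref (Ico 0 T) s)) (I ∩ Ici 0) := by
    intro s _
    simp only [map_sub, coordL_zero_jetOf hr]
  have hmem : ∀ t ∈ I ∩ Ici 0, (t, x t - jetOf r yref (Ico 0 T) t) ∈
      errDomain (funnelFun c T) α T r := fun t ht =>
    (mem_trackDomain ht.2).1 ((h t ht).mem t ⟨ht.2, le_rfl⟩)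
  have hjet : ∀ k < r, EqOn (iteratedDerivWithin k (fun t => coordL r (Vec m) 0 (x t)) I)
      (fun s => coordL r (Vec m) k (x s)) I := fun k hk =>
    hx.iteratedDerivWithin_eqOn hIu (fun _ _ => rfl) hk
  have hstate : EqOn (stateOf r (fun t => coordL r (Vec m) 0 (x t)) I) x I := by
    intro t ht
    rw [stateOf_eq_jetOf]
    refine stateVec_ext fun k hk => ?_
    rw [coordL_jetOf _ _ _ hk, hjet k hk ht]
  have hae : ∀ t ∈ I ∩ Ici 0, ∀ᵐ s ∂(volume.restrict (Ico 0 t)),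
      coordL r (Vec m) (r - 1) (trackRhs f (funnelFun c T) α N (jetOf r yref (Ico 0 T))
        (d s, Op (stopAt x t) s, s, x s)) =
      f (d s, Op (stopAt (stateOf r (fun t => coordL r (Vec m) 0 (x t)) I) t) s,
        feedback r (funnelFun c T) α N (I ∩ Ici 0)
          (fun s => coordL r (Vec m) 0 (x s) - yref s) s) := by
    intro t ht
    have hsub : Icc (-σ) t ⊆ I := hI'.Icc_subset ht.1
    have hc1 : ContinuousOn x (Icc (-σ) t) := hx.continuousOn.mono hsub
    have hc2 := hc1.congr (hstate.mono hsub)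
    filter_upwards [D.op.stopAt_ae_eq hσ ht.2 le_rfl le_rfl hc1 hc2
      (hstate.symm.mono (Ico_subset_Icc_self.trans hsub)), ae_restrict_mem measurableSet_Ico]
      with s hs hs'
    have hsJ : s ∈ I ∩ Ici 0 := ⟨hsub ⟨by linarith [hs'.1], hs'.2.le⟩, hs'.1⟩
    rw [coordL_trackRhs_last hr, max_eq_right hs'.1, ← hs,
      feedback_eq_funnelControl hr D.design hJu hη he hsJ (hmem s hsJ)]
  refine ⟨hI', ?_, ?_, fun t ht => (hJT ht).2, ?_, ?_, ?_⟩
  · exact hx.contDiffOn_coordL hIu (by omega)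
  · intro t ht
    simp only []
    rw [(h 0 ⟨h0I, self_mem_Ici⟩).initial ht, coordL_zero_jetOf hr]
  · intro t ht k hk1 hk
    rw [errVar_eq_errFun D.design hJu hη he ht (hmem t ht) hk1 hk]
    exact (hmem t ht).2 (k - 1) (by omega)
  · intro t ht
    have htJ : t ∈ I ∩ Ici 0 := ⟨ht.1, Ioi_subset_Ici_self ht.2⟩
    have hi := D.intervalIntegrable (h t htJ)
    have hi' : IntervalIntegrable (fun s => coordL r (Vec m) (r - 1) (trackRhs f (funnelFun c T) α N
        (jetOf r yref (Ico 0 T)) (d s, Op (stopAt x t) s, s, x s))) volume 0 t :=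
      ⟨(coordL r (Vec m) (r - 1)).integrable_comp hi.1,
        (coordL r (Vec m) (r - 1)).integrable_comp hi.2⟩
    refine hi'.congr_ae ?_
    rw [uIoc_of_le htJ.2, ← restrict_Ico_eq_restrict_Ioc]
    exact hae t htJ
  · intro t ht
    have htJ : t ∈ I ∩ Ici 0 := ⟨ht.1, Ioi_subset_Ici_self ht.2⟩
    rw [hjet _ (by omega) ht.1, hjet _ (by omega) h0I]
    simp only []
    rw [D.coordL_eq (h t htJ) (r - 1) t ⟨htJ.2, le_rfl⟩]
    congr 1
    exact integral_congr_of_ae_Ico le_rfl htJ.2 le_rfl (hae t htJ)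

/-- The continuation `z` is `C^{r-1}` across time zero, so its jet at `0` is the left-sided jet of
`y0`. -/
theorem InitialCondition.mem_trackDomain (hinit : InitialCondition r σ c T α yref y0) :
    (0, jetOf r y0 (Icc (-σ) 0) 0) ∈ trackDomain (funnelFun c T) α T (jetOf r yref (Ico 0 T)) := by
  have hσ := D.σ_pos
  have hT := D.T_pos
  have hr := D.r_pos
  obtain ⟨z, hz, hzy, hk⟩ := hinit
  have hx : IsJetOn (jetOf r z (Ico (-σ) T)) (Ico (-σ) T) :=
    isJetOn_jetOf (uniqueDiffOn_Ico _ _) hz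
  have hη : IsJetOn (fun t => jetOf r z (Ico (-σ) T) t - jetOf r yref (Ico 0 T) t) (Ico 0 T) :=
    (hx.mono (Ico_subset_Ico_left (by linarith))).sub D.xref_jet
  have := mem_errDomain_of_errVar (T := T) D.design (uniqueDiffOn_Ico 0 T) hη
      (e := fun t => z t - yref t)
    (fun s _ => by simp only [map_sub, coordL_zero_jetOf hr]) ⟨le_rfl, hT⟩ hT hk
  rw [_root_.mem_trackDomain le_rfl]
  rwa [← jetOf_eqOn_subset (uniqueDiffOn_Icc (by linarith)) (uniqueDiffOn_Ico _ _)
    (Icc_subset_Ico_right hT) hz hzy ⟨by linarith, le_rfl⟩]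

end Bridge

/-! ### Sobolev regularity of curves with bounded jets. -/

section SobolevOfJet

variable {r : ℕ} {E : Type*} [NormedAddCommGroup E] [InnerProductSpace ℝ E]

theorem ae_restrict_Ico_of_forall_Icc {a b : ℝ} {Q : ℝ → Prop}
    (h : ∀ s ∈ Ico a b, ∀ᵐ t ∂(volume.restrict (Icc a s)), Q t) :
    ∀ᵐ t ∂(volume.restrict (Ico a b)), Q t := by
  rcases le_or_gt b a with hab | hab
  · simp [Ico_eq_empty (not_lt.2 hab)]
  obtain ⟨u, -, hu, hlim⟩ := exists_seq_strictMono_tendsto' hab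
  have : Ico a b ⊆ ⋃ n, Icc a (u n) := by
    intro t ht
    obtain ⟨n, hn⟩ := (hlim.eventually (lt_mem_nhds ht.2)).exists
    exact mem_iUnion.2 ⟨n, ht.1, hn.le⟩
  refine ae_restrict_of_ae_restrict_of_subset this ?_
  rw [ae_restrict_iUnion_iff]
  exact fun n => h (u n) ⟨(hu n).1.le, (hu n).2⟩

variable {a b : ℝ} {x : ℝ → JetVec r E} {y : ℝ → E}

theorem memLp_coordL (hx : ContinuousOn x (Ico a b)) (hbd : ∃ C, ∀ t ∈ Ico a b, ‖x t‖ ≤ C)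
    (k : ℕ) : MemLp (fun t => coordL r E k (x t)) ⊤ (volume.restrict (Ico a b)) := by
  obtain ⟨C, hC⟩ := hbd
  refine memLp_top_of_bound (((coordL r E k).continuous.comp_continuousOn hx).aestronglyMeasurable
    measurableSet_Ico) C ?_
  filter_upwards [ae_restrict_mem measurableSet_Ico] with t ht
  exact (norm_coordL_le k _).trans (hC t ht)

theorem hasWeakDerivOn_coordL [FiniteDimensional ℝ E] (hab : a < b) (hx : IsJetOn x (Ico a b))
    {k : ℕ} (hk : k + 1 < r) : HasWeakDerivOn (Ico a b) (fun t => coordL r E k (x t))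
      (fun t => coordL r E (k + 1) (x t)) := by
  have : CompleteSpace E := FiniteDimensional.complete ℝ E
  exact hasWeakDerivOn_of_hasDerivWithinAt hab (Or.inr rfl) (fun t ht => hx.hasDeriv k hk t ht)
    ((coordL r E (k + 1)).continuous.comp_continuousOn hx.continuousOn)

theorem memSobolevInf_of_eqOn [CompleteSpace E] {y y' : ℝ → E} {n : ℕ} {I : Set ℝ}
    (hI : MeasurableSet I)
    (hy : EqOn y' y I) (h : MemSobolevInf n y I) : MemSobolevInf n y' I := by
  obtain ⟨g, rfl, hg, hw⟩ := h
  have hae : g 0 =ᵐ[volume.restrict I] y' := by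
    filter_upwards [ae_restrict_mem hI] with t ht using (hy ht).symm
  refine ⟨fun j => if j = 0 then y' else g j, by simp, fun j hj => ?_, fun j hj => ?_⟩
  · rcases Nat.eq_zero_or_pos j with rfl | h0
    · exact (hg 0 hj).ae_eq hae
    · simpa [h0.ne'] using hg j hj
  · rcases Nat.eq_zero_or_pos j with rfl | h0
    · simpa using (hw 0 hj).congr_left hae
    · simpa [h0.ne'] using hw j hj

theorem memSobolevInf_of_isJetOn_of_lt [FiniteDimensional ℝ E] (hab : a < b)
    (hx : IsJetOn x (Ico a b)) (hbd : ∃ C, ∀ t ∈ Ico a b, ‖x t‖ ≤ C) {n : ℕ} (hn : n < r) :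
    MemSobolevInf n (fun t => coordL r E 0 (x t)) (Ico a b) :=
  ⟨fun j t => coordL r E j (x t), rfl, fun j _ => memLp_coordL hx.continuousOn hbd j,
    fun _ hj => hasWeakDerivOn_coordL hab hx (by omega)⟩

theorem memSobolevInf_of_isJetOn [FiniteDimensional ℝ E] (hr : 0 < r) (ha : a ≤ 0) (hb : 0 < b)
    (hx : IsJetOn x (Ico a b)) (hbd : ∃ C, ∀ t ∈ Ico a b, ‖x t‖ ≤ C) {h : ℝ → E}
    (hh : MemLp h ⊤ (volume.restrict (Ico a b)))
    (hprim : ∀ t ∈ Ico a b, coordL r E (r - 1) (x t) =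
      coordL r E (r - 1) (x 0) + ∫ s in (0 : ℝ)..t, h s) :
    MemSobolevInf r (fun t => coordL r E 0 (x t)) (Ico a b) := by
  have hab : a < b := ha.trans_lt hb
  have : CompleteSpace E := FiniteDimensional.complete ℝ E
  have hint := intervalIntegrable_of_memLp_top hab.le (Or.inr rfl) hh
  have hi : ∀ s ∈ Ico a b, ∀ t ∈ Ico a b, IntervalIntegrable h volume s t := fun s hs t ht =>
    hint.mono_set (by
      rw [uIcc_of_le hab.le]
      exact uIcc_subset_Icc ⟨hs.1, hs.2.le⟩ ⟨ht.1, ht.2.le⟩)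
  refine ⟨fun j => if j < r then fun t => coordL r E j (x t) else h, by simp [hr], fun j hj => ?_,
    fun j hj => ?_⟩
  · by_cases hjr : j < r
    · simpa [hjr] using memLp_coordL hx.continuousOn hbd j
    · simpa [hjr] using hh
  · by_cases hjr : j + 1 < r
    · simpa [hjr, hj] using hasWeakDerivOn_coordL hab hx hjr
    · obtain rfl : j = r - 1 := by omega
      simp only [hj, hjr, if_true, if_false]
      refine hasWeakDerivOn_of_primitive hab (ae_eq_Ioo_of_interval (Or.inr rfl))
        (interior_of_interval (Or.inr rfl)) fun s hs t ht hst => ?_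
      have hs' : s ∈ Ico a b := ⟨hs.1.le, hs.2⟩
      have ht' : t ∈ Ico a b := ⟨ht.1.le, ht.2⟩
      refine ⟨hi s hs' t ht', ?_⟩
      rw [hprim t ht', hprim s hs', add_assoc,
        intervalIntegral.integral_add_adjacent_intervals (hi 0 ⟨ha, hb⟩ s hs') (hi s hs' t ht')]

end SobolevOfJet

/-! ### The top derivative of a solution as an essentially bounded function. -/

namespace TrackData

variable {r : ℕ} {P Z E : Type*} [NormedAddCommGroup P] [NormedAddCommGroup Z]
  [NormedAddCommGroup E] [InnerProductSpace ℝ E] [ProperSpace P] [ProperSpace Z]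
  [FiniteDimensional ℝ E]
  {f : P × Z × E → E} {c T σ b : ℝ} {α N : ℝ → ℝ} {xref x x₀ : ℝ → JetVec r E} {d : ℝ → P}
  {Op : (ℝ → JetVec r E) → ℝ → Z}
  (D : TrackData σ d f Op c T α N xref)
  (hx : ∀ s ∈ Ico 0 T, IsTrackSolution σ d f Op c T α N xref x₀ s x)

include D hx

theorem aestronglyMeasurable_control : AEStronglyMeasurable
    (fun t => funnelControl (funnelFun c T) α N (t, x t - xref t)) (volume.restrict (Ico 0 T)) := by
  have hη := D.isJetOn_error D.T_pos hx
  refine ContinuousOn.aestronglyMeasurable ?_ measurableSet_Ico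
  exact (continuousOn_funnelControl D.r_pos D.c_pos D.design).comp
    (continuousOn_id.prodMk hη.continuousOn) (mem_errDomain hx)

theorem memLp_control : MemLp (fun t => funnelControl (funnelFun c T) α N (t, x t - xref t)) ⊤
    (volume.restrict (Ico 0 T)) := by
  obtain ⟨C, hC⟩ := D.exists_bound_control D.T_pos hx
  refine memLp_top_of_bound (D.aestronglyMeasurable_control hx) C ?_
  filter_upwards [ae_restrict_mem measurableSet_Ico] with t ht using hC t ht

/-- The highest derivative is the primitive of an essentially bounded function. -/
theorem exists_memLp_primitive : ∃ h : ℝ → E, MemLp h ⊤ (volume.restrict (Ico 0 T)) ∧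
    ∀ t ∈ Ico 0 T, coordL r E (r - 1) (x t) =
      coordL r E (r - 1) (x 0) + ∫ s in (0 : ℝ)..t, h s := by
  have hσ := D.σ_pos
  have hT := D.T_pos
  obtain ⟨x₁, hx₁, he⟩ := D.exists_continuous_extension hT hx
  -- A single path on `[-σ, ∞)` that agrees with `x` up to `T` replaces all stopped paths, so one
  -- integrand serves for every `t`.
  set ξ : ℝ → JetVec r E := fun t => if t < 0 then x t else x₁ t with hξ
  have hξx : EqOn ξ x (Ico (-σ) T) := by
    intro t ht
    simp only [hξ]
    split_ifs with h
    · rfl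
    · exact (he ⟨not_lt.1 h, ht.2⟩).symm
  have hξc : ContinuousOn ξ (Ici (-σ)) := by
    rw [← Icc_union_Ici_eq_Ici (by linarith : -σ ≤ 0)]
    refine ContinuousOn.union_of_isClosed ?_ ?_ isClosed_Icc isClosed_Ici
    · exact (hx 0 ⟨le_rfl, hT⟩).continuousOn.congr (hξx.mono (Icc_subset_Ico_right hT))
    · exact hx₁.congr fun t ht => by simp [hξ, not_lt.2 (mem_Ici.1 ht)]
  set h : ℝ → E := fun t => f (d t, Op ξ t, funnelControl (funnelFun c T) α N (t, x t - xref t))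
    with hh
  have hae : ∀ s ∈ Ico 0 T, ∀ᵐ t ∂(volume.restrict (Ico 0 s)), Op (stopAt x s) t = Op ξ t := by
    intro s hs
    have hs1 := hs.1
    refine D.op.causal s hs.1 _ _ (continuousOn_stopAt (by linarith) (hx s hs).continuousOn) hξc ?_
    intro t ht
    rw [hξx ⟨ht.1, ht.2.trans hs.2⟩, stopAt, min_eq_left ht.2.le]
  obtain ⟨M, hM⟩ := D.exists_bound_system hT hx
  refine ⟨h, memLp_top_of_bound ?_ M ?_, fun t ht => ?_⟩
  · refine D.f_cont.comp_aestronglyMeasurable ?_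
    have hsub : Ico 0 T ⊆ Ici 0 := Ico_subset_Ici_self
    have hsub' : Ico 0 T ⊆ Icc 0 T := Ico_subset_Icc_self
    exact (D.d_mem.1.mono_measure (Measure.restrict_mono hsub le_rfl)).prodMk
      (((D.op.locBdd ξ hξc T).1.mono_measure (Measure.restrict_mono hsub' le_rfl)).prodMk
        (D.aestronglyMeasurable_control hx))
  · refine ae_restrict_Ico_of_forall_Icc fun s hs => ?_
    have h1 := hae s hs
    rw [restrict_Ico_eq_restrict_Icc] at h1
    filter_upwards [hM s hs, h1] with t h2 h3
    rwa [h3] at h2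
  · rw [D.coordL_eq (hx t ht) (r - 1) t ⟨ht.1, le_rfl⟩]
    congr 1
    refine integral_congr_of_ae_Ico le_rfl ht.1 le_rfl ?_
    filter_upwards [hae t ht, ae_restrict_mem measurableSet_Ico] with s hs hs'
    rw [coordL_trackRhs_last D.r_pos, hs, max_eq_right hs'.1]

theorem exists_memLp_primitive_of_initial {h₀ : ℝ → E}
    (hh₀ : MemLp h₀ ⊤ (volume.restrict (Icc (-σ) 0)))
    (hprim : ∀ t ∈ Icc (-σ) 0, coordL r E (r - 1) (x t) =
      coordL r E (r - 1) (x 0) + ∫ s in (0 : ℝ)..t, h₀ s) :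
    ∃ h : ℝ → E, MemLp h ⊤ (volume.restrict (Ico (-σ) T)) ∧
    ∀ t ∈ Ico (-σ) T, coordL r E (r - 1) (x t) =
      coordL r E (r - 1) (x 0) + ∫ s in (0 : ℝ)..t, h s := by
  have hσ := D.σ_pos
  have hT := D.T_pos
  obtain ⟨h₁, hh₁, hp₁⟩ := D.exists_memLp_primitive hx
  have hneg : EqOn ((Iio 0).piecewise h₀ h₁) h₀ (Iio 0) := fun t ht => piecewise_eq_of_mem _ _ _ ht
  have hpos : EqOn ((Iio 0).piecewise h₀ h₁) h₁ (Ici 0) := fun t ht =>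
    piecewise_eq_of_notMem _ _ _ fun hlt => (mem_Iio.1 hlt).not_ge ht
  refine ⟨(Iio 0).piecewise h₀ h₁, ?_, fun t ht => ?_⟩
  · obtain ⟨C₀, hC₀⟩ := hh₀.exists_ae_bound
    obtain ⟨C₁, hC₁⟩ := hh₁.exists_ae_bound
    have hsplit : Ico (-σ) T = Ico (-σ) 0 ∪ Ico 0 T :=
      (Ico_union_Ico_eq_Ico (by linarith) hT.le).symm
    rw [← restrict_Ico_eq_restrict_Icc] at hh₀ hC₀
    have e0 : h₀ =ᵐ[volume.restrict (Ico (-σ) 0)] (Iio 0).piecewise h₀ h₁ := by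
      filter_upwards [ae_restrict_mem measurableSet_Ico] with t ht using (hneg ht.2).symm
    have e1 : h₁ =ᵐ[volume.restrict (Ico 0 T)] (Iio 0).piecewise h₀ h₁ := by
      filter_upwards [ae_restrict_mem measurableSet_Ico] with t ht using (hpos ht.1).symm
    rw [hsplit]
    refine memLp_top_of_bound (aestronglyMeasurable_union_iff.2 ⟨hh₀.1.congr e0, hh₁.1.congr e1⟩)
      (max C₀ C₁) ?_
    rw [ae_restrict_union_iff]
    constructor
    · filter_upwards [hC₀, e0] with t h1 h2
      rw [← h2]
      exact h1.trans (le_max_left _ _)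
    · filter_upwards [hC₁, e1] with t h1 h2
      rw [← h2]
      exact h1.trans (le_max_right _ _)
  · rcases le_total t 0 with h0 | h0
    · rw [hprim t ⟨ht.1, h0⟩, intervalIntegral.integral_symm, intervalIntegral.integral_symm t 0]
      congr 2
      refine integral_congr_of_ae_Ico le_rfl h0 le_rfl ?_
      filter_upwards [ae_restrict_mem measurableSet_Ico] with s hs using (hneg hs.2).symm
    · rw [hp₁ t ⟨h0, ht.2⟩]
      congr 1
      refine integral_congr_of_ae_Ico le_rfl h0 le_rfl ?_
      filter_upwards [ae_restrict_mem measurableSet_Ico] with s hs using (hpos hs.1).symm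

end TrackData

/-! ### Maximal solutions and the main theorem. -/

section Maximal

variable {r m p q : ℕ} {f : Vec p × Vec q × Vec m → Vec m} {c T σ b : ℝ} {α N : ℝ → ℝ}
  {d : ℝ → Vec p} {Op : (ℝ → StateVec r m) → ℝ → Vec q} {yref y0 y : ℝ → Vec m} {I : Set ℝ}
  (D : TrackData σ d f Op c T α N (jetOf r yref (Ico 0 T)))

include D

theorem IsClosedLoopSolution.eq_Ico_of_subset
    (h : IsClosedLoopSolution σ d f Op c T α N yref y0 I y) (hsub : Ico (-σ) T ⊆ I) :
    I = Ico (-σ) T := by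
  have hσ := D.σ_pos
  have hT := D.T_pos
  have hTI : T ∉ I := fun hmem => lt_irrefl T (h.time_lt T ⟨hmem, hT.le⟩)
  refine Subset.antisymm (fun t ht => ⟨?_, ?_⟩) hsub
  · rcases h.interval with ⟨b, hb, rfl⟩ | ⟨b, hb, rfl⟩ | rfl
    exacts [ht.1, ht.1, ht]
  · by_contra! hle
    exact hTI (h.interval.Icc_subset ht ⟨by linarith, hle⟩)

/-- A solution on a closed interval, or on a half-open one ending before `T`, continues as a path
solution, which translates back into a proper extension. -/
theorem IsMaximalClosedLoopSolution.eq_Ico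
    (hy0 : ContDiffOn ℝ ((r - 1 : ℕ) : WithTop ℕ∞) y0 (Icc (-σ) 0))
    (h : IsMaximalClosedLoopSolution σ d f Op c T α N yref y0 I y) : I = Ico (-σ) T := by
  have hσ := D.σ_pos
  have hT := D.T_pos
  have hr := D.r_pos
  obtain ⟨hs, hmax⟩ := h
  have habs : ∀ (b : ℝ), 0 < b → I ⊆ Icc (-σ) b → b ∉ I → ∀ x' : ℝ → JetVec r (Vec m),
      EqOn (jetOf r y I) x' I → IsTrackSolution σ d f Op c T α N (jetOf r yref (Ico 0 T))
        (jetOf r y0 (Icc (-σ) 0)) b x' → False := by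
    intro b hb hsub hbI x' he hx'
    have hsol := isClosedLoopSolution_of_isTrackSolution D hb hy0 (Or.inl rfl) (x := x')
      fun s hs => hx'.congr_of_le D.op hσ hs.2 hs.1.2 fun _ _ => rfl
    have := hmax _ _ hsol hsub fun t ht => by
      rw [← he ht, coordL_zero_jetOf hr]
    exact hbI (this ▸ right_mem_Icc.2 (by linarith))
  rcases hs.interval with ⟨b, hb, rfl⟩ | ⟨b, hb, rfl⟩ | rfl
  · exfalso
    have hx := hs.isTrackSolution D ⟨⟨by linarith, le_rfl⟩, hb.le⟩
    obtain ⟨b', hb', x', he, hx'⟩ := hx.exists_extension D.op hσ D.d_mem D.isOpen D.continuousOn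
    exact habs b' (hb.trans hb') (Icc_subset_Icc_right hb'.le) (fun h => hb'.not_ge h.2) x'
      he.symm hx'
  · have hx : ∀ s ∈ Ico 0 b, IsTrackSolution σ d f Op c T α N (jetOf r yref (Ico 0 T))
        (jetOf r y0 (Icc (-σ) 0)) s (jetOf r y (Ico (-σ) b)) := fun s hs' =>
      hs.isTrackSolution D ⟨⟨by linarith [hs'.1], hs'.2⟩, hs'.1⟩
    rcases (D.le_of_solution hb hx).eq_or_lt with rfl | hlt
    · rfl
    exfalso
    obtain ⟨b', hb', x', he, hx'⟩ := D.exists_extension_of_lt hb hx hlt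
    exact habs b' (hb.trans hb') (Ico_subset_Icc_self.trans (Icc_subset_Icc_right hb'.le))
      (fun h => hb'.not_gt h.2) x' he hx'
  · exact hs.eq_Ico_of_subset D Ico_subset_Ici_self

end Maximal

theorem SystemClass.trackData {m r p q : ℕ} (hm : 0 < m) (hr : 0 < r) {σ : ℝ} {d : ℝ → Vec p}
    {f : Vec p × Vec q × Vec m → Vec m} {Op : (ℝ → StateVec r m) → ℝ → Vec q}
    (hsys : SystemClass σ d f Op) {T c : ℝ} (hT : 0 < T) (hc : 0 < c) {yref : ℝ → Vec m}
    (hyref : MemSobolevInf r yref (Ico 0 T))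
    (hyref_rep : ContDiffOn ℝ ((r - 1 : ℕ) : WithTop ℕ∞) yref (Ico 0 T)) {α N : ℝ → ℝ}
    (hαN : ControlDesign r c α N) : TrackData σ d f Op c T α N (jetOf r yref (Ico 0 T)) := by
  obtain ⟨hbd, h, hh, hp⟩ := hyref.bounded_jet_and_primitive hT (Or.inr rfl) hr hyref_rep
  refine ⟨hr, hsys.memory_pos, hT, hc, hsys.continuous, hsys.disturbance, hsys.operator, hαN,
    hsys.highGain.shellGain hm hsys.continuous hαN hc, isJetOn_jetOf (uniqueDiffOn_Ico 0 T)
        hyref_rep,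
    ?_, h, hh, fun s hs t ht => ?_⟩
  · have : ∀ k, ∃ C, k < r → ∀ t ∈ Ico 0 T, ‖iteratedDerivWithin k yref (Ico 0 T) t‖ ≤ C := fun k =>
        by
      by_cases hk : k < r
      · obtain ⟨C, hC⟩ := hbd k hk
        exact ⟨C, fun _ => hC⟩
      · exact ⟨0, fun h => absurd h hk⟩
    choose C hC using this
    refine ⟨Real.sqrt (r * (∑ k ∈ Finset.range r, |C k|) ^ 2), fun t ht =>
      norm_stateVec_le fun k hk => ?_⟩
    rw [coordL_jetOf _ _ _ hk]
    exact ((hC k hk t ht).trans (le_abs_self _)).trans (Finset.single_le_sum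
      (f := fun k => |C k|) (fun _ _ => abs_nonneg _) (Finset.mem_range.2 hk))
  · rw [coordL_jetOf _ _ _ (by omega), coordL_jetOf _ _ _ (by omega)]
    exact hp s hs t ht

theorem theorem1 (m r p q : ℕ) (hm : 0 < m) (hr : 0 < r) (hp : 0 < p) (hq : 0 < q)
    (σ : ℝ) (d : ℝ → Vec p) (f : Vec p × Vec q × Vec m → Vec m)
    (Op : (ℝ → StateVec r m) → ℝ → Vec q)
    (hsys : SystemClass σ d f Op)
    (y0 : ℝ → Vec m)
    (hy0 : ContDiffOn ℝ ((r - 1 : ℕ) : WithTop ℕ∞) y0 (Icc (-σ) 0))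
    (T c : ℝ) (hT : 0 < T) (hc : 0 < c)
    (yref : ℝ → Vec m) (hyref : MemSobolevInf r yref (Ico 0 T))
    -- `yref` is the `C^{r-1}` representative of its class
    (hyref_rep : ContDiffOn ℝ ((r - 1 : ℕ) : WithTop ℕ∞) yref (Ico 0 T))
    (α N : ℝ → ℝ) (hαN : ControlDesign r c α N)
    (hinit : InitialCondition r σ c T α yref y0) :
    (∃ (I : Set ℝ) (y : ℝ → Vec m),
      IsMaximalClosedLoopSolution σ d f Op c T α N yref y0 I y) ∧
    ∀ (I : Set ℝ) (y : ℝ → Vec m),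
      IsMaximalClosedLoopSolution σ d f Op c T α N yref y0 I y →
        -- (i)
        I = Ico (-σ) T ∧
        -- (ii)
        MemLp (feedback r (funnelFun c T) α N (Ico 0 T) (fun t => y t - yref t)) ⊤
          (volume.restrict (Ico 0 T)) ∧
        MemSobolevInf r y (Ico 0 T) ∧
        MemSobolevInf (r - 1) y (Ico (-σ) T) ∧
        (MemSobolevInf r y0 (Icc (-σ) 0) → MemSobolevInf r y (Ico (-σ) T)) ∧
        -- (iii)
        (∀ t ∈ Ico 0 T, funnelFun c T t * ‖y t - yref t‖ < 1) ∧
        -- (iv)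
        ∀ i < r, Tendsto
          (fun t => ‖iteratedDerivWithin i (fun s => y s - yref s) (Ico 0 T) t‖)
          (𝓝[<] T) (𝓝 0) := by

  have D := hsys.trackData hm hr hT hc hyref hyref_rep hαN
  have hσ := hsys.memory_pos
  have hJ : Ico (-σ) T ∩ Ici 0 = Ico 0 T := by
    rw [Ico_inter_Ici, max_eq_right (by linarith)]
  have hx₀ : IsJetOn (jetOf r y0 (Icc (-σ) 0)) (Icc (-σ) 0) :=
    isJetOn_jetOf (uniqueDiffOn_Icc (by linarith)) hy0
  constructor
  · obtain ⟨x, hx⟩ := D.exists_global_solution hx₀.continuousOn (hinit.mem_trackDomain D)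
    -- Maximality is automatic: time `T` lies in no solution interval, so an interval containing
    -- `[-σ, T)` equals it.
    refine ⟨Ico (-σ) T, _, isClosedLoopSolution_of_isTrackSolution D hT hy0 (Or.inr rfl) (x := x)
      fun s hs => hx s (hJ ▸ hs), fun I' y' h hsub _ => h.eq_Ico_of_subset D hsub⟩
  · intro I y hmax
    obtain rfl := hmax.eq_Ico D hy0
    have hs := hmax.1
    have hx : ∀ s ∈ Ico 0 T, IsTrackSolution σ d f Op c T α N (jetOf r yref (Ico 0 T))
        (jetOf r y0 (Icc (-σ) 0)) s (jetOf r y (Ico (-σ) T)) := fun s hs' =>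
      hs.isTrackSolution D (by rwa [hJ])
    have hη := D.isJetOn_error hT hx
    have hdom := TrackData.mem_errDomain hx
    have he : EqOn (fun s => y s - yref s) (fun s => coordL r (Vec m) 0
        (jetOf r y (Ico (-σ) T) s - jetOf r yref (Ico 0 T) s)) (Ico 0 T) := by
      intro s _
      simp only [map_sub, coordL_zero_jetOf hr]
    have hJu := uniqueDiffOn_Ico 0 T
    have hjet : IsJetOn (jetOf r y (Ico (-σ) T)) (Ico (-σ) T) :=
      isJetOn_jetOf (uniqueDiffOn_Ico _ _) hs.smooth
    have hsub : Ico 0 T ⊆ Ico (-σ) T := Ico_subset_Ico_left (by linarith)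
    obtain ⟨C, -, hC⟩ := D.exists_bound_path hT hx
    have hy : ∀ J, EqOn y (fun t => coordL r (Vec m) 0 (jetOf r y (Ico (-σ) T) t)) J := fun J t _ =>
      (coordL_zero_jetOf hr y _ t).symm
    refine ⟨rfl, ?_, ?_, ?_, fun hy0W => ?_, fun t ht => ?_, fun i hi => ?_⟩
    · refine (D.memLp_control hx).ae_eq ?_
      filter_upwards [ae_restrict_mem measurableSet_Ico] with t ht
      exact (feedback_eq_funnelControl hr hαN hJu hη he ht (hdom t ht)).symm
    · obtain ⟨h, hh, hp⟩ := D.exists_memLp_primitive hx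
      exact memSobolevInf_of_eqOn measurableSet_Ico (hy _) (memSobolevInf_of_isJetOn hr le_rfl hT
        (hjet.mono hsub) ⟨C, fun t ht => hC t (hsub ht)⟩ hh hp)
    · exact memSobolevInf_of_eqOn measurableSet_Ico (hy _) (memSobolevInf_of_isJetOn_of_lt
        (by linarith) hjet ⟨C, hC⟩ (by omega))
    · obtain ⟨-, h₀, hh₀, hp₀⟩ := hy0W.bounded_jet_and_primitive (by linarith) (Or.inl rfl) hr hy0
      obtain ⟨h, hh, hp⟩ := D.exists_memLp_primitive_of_initial hx hh₀ fun t ht => by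
        have h0 : (0 : ℝ) ∈ Icc (-σ) 0 := ⟨by linarith, le_rfl⟩
        have hini := (hx 0 ⟨le_rfl, hT⟩).initial
        rw [hini ht, hini h0, coordL_jetOf _ _ _ (by omega), coordL_jetOf _ _ _ (by omega)]
        exact hp₀ 0 h0 t ht
      exact memSobolevInf_of_eqOn measurableSet_Ico (hy _) (memSobolevInf_of_isJetOn hr
        (by linarith) hT hjet ⟨C, hC⟩ hh hp)
    -- Index zero is `e_1 = φ e`, since its correction term vanishes.
    · have h1 := (hdom t ht).2 0 hr
      have h2 := he ht
      simp only [errFun, norm_smul, corrFun, add_zero] at h1 h2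
      rw [Real.norm_of_nonneg (funnelFun_pos hc ht.2).le] at h1
      rwa [h2]
    · obtain ⟨C', hC'⟩ := exists_bound_coordL hc hT le_rfl hαN hη hdom hi
      refine squeeze_zero' (Eventually.of_forall fun _ => norm_nonneg _) (g := fun t => C' * (T - t))
        ?_ ?_
      · filter_upwards [Ico_mem_nhdsLT hT] with t ht
        rw [hη.iteratedDerivWithin_eqOn hJu he hi ht]
        exact hC' t ht
      · have : ContinuousAt (fun t => C' * (T - t)) T := by fun_prop
        have h2 := this.tendsto
        simp only [sub_self, mul_zero] at h2
        exact h2.mono_left nhdsWithin_le_nhds
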